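/- Let $(M,g)$ be a complete, oriented, smooth Riemannian manifold of dimension $3$ (without boundary, second countable), with Riemannian measure $dx$, Levi-Civita connection $\nabla$ and Ricci tensor $\mathrm{Ric}$. Let $\nu>0$, let $J\subseteq\mathbb R$ be an interval with more than one point, and let $(u_t,p_t)_{t\in J}$ be a smooth solution of $$\partial_t u_t+\nabla_{u_t}u_t+\nu\,\square u_t=-\nabla p_t,\qquad \operatorname{div}u_t=0,$$ where $\square=dd^*+d^*d$ is the de Rham--Hodge Laplacian, acting on vector fields through the identification of a vector field $X$ with the one-form $\tilde X=\langle X,\cdot\rangle$. Let $\omega_t=*\,d\tilde u_t$ be the vorticity, a one-form ($*$ is the Hodge star). Let $\nabla^s u_t$ be the symmetric part of $\nabla u_t$, i.e. $\langle\nabla^s_Xu,Y\rangle=\tfrac12(\langle\nabla_Xu,Y\rangle+\langle\nabla_Yu,X\rangle)$, let $(\omega\odot\nabla^su)(X)=\omega(\nabla^s_Xu)$, and $(\mathrm{Ric}\,\omega)(X)=\omega(\mathrm{Ric}\,X)$. Assume that around every time in $J$ there are a neighbourhood in $J$, a compact set $K\subseteq M$ and an integrable function $G$ on $M$ such that, at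 all times $t$ of the neighbourhood and at all points outside $K$, the functions $|\omega_t|^2$, $|u_t||\omega_t|^2$, $|\nabla\omega_t|^2$, $|\langle\mathrm{Ric}\,\omega_t,\omega_t\rangle|$ and $|\langle\omega_t\odot\nabla^su_t,\omega_t\rangle|$ are bounded by $G$. (If $M$ is compact this is no condition.) Then for every $t\in J$ the functions $|\omega_t|^2$, $|\nabla\omega_t|^2$, $\langle\mathrm{Ric}\,\omega_t,\omega_t\rangle$ and $\langle\omega_t\odot\nabla^su_t,\omega_t\rangle$ are integrable, $s\mapsto\int_M|\omega_s|^2\,dx$ is differentiable on $J$ at $t$ (one-sidedly if $t$ is an endpoint of $J$), and $$\frac12\frac{d}{dt}\int_M|\omega_t|^2\,dx+\nu\int_M|\nabla\omega_t|^2\,dx=-\nu\int_M\langle\mathrm{Ric}\,\omega_t,\omega_t\rangle\,dx+\int_M\langle\omega_t\odot\nabla^su_t,\omega_t\rangle\,dx .$$ -/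

import Mathlib

open Bundle Manifold MeasureTheory Set
open scoped ContDiff Topology

namespace VorticityEnergy

noncomputable section

/-- The model space of a three-dimensional manifold. -/
abbrev E3 := EuclideanSpace ℝ (Fin 3)

/-- The partial derivative `∂f/∂yⁱ` of a function of three variables. -/
def pd (i : Fin 3) (f : E3 → ℝ) (y : E3) : ℝ :=
  fderiv ℝ f y (EuclideanSpace.single i 1)

section Manifold

variable {M : Type*} [EMetricSpace M] [ChartedSpace E3 M] [IsManifold (𝓡 3) ∞ M]

/-- Vector fields on `M`. -/
abbrev VField (M : Type*) [EMetricSpace M] [ChartedSpace E3 M] :=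
  ∀ x : M, TangentSpace (𝓡 3) x

/-- Differential one-forms on `M`. -/
abbrev OneForm (M : Type*) [EMetricSpace M] [ChartedSpace E3 M] :=
  ∀ x : M, TangentSpace (𝓡 3) x →L[ℝ] ℝ

/-! ### Coordinates

The point `x₀` names the preferred chart `φ = extChartAt (𝓡 3) x₀` around `x₀`, and `y : E3` is a
point of its target.  Tensor fields are read in the chart as component functions of `y`. -/

/-- The coordinate vector `∂ᵢ` of the chart around `x₀`, at the point `q` of its domain:
the image of the `i`-th basis vector under the differential of the inverse chart. -/
def coordVec (x₀ : M) (i : Fin 3) (q : M) : TangentSpace (𝓡 3) q :=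
  (trivializationAt E3 (TangentSpace (𝓡 3) : M → Type _) x₀).symmL ℝ q (EuclideanSpace.single i 1)

/-- The coordinate covector `dxⁱ` of the chart around `x₀`, at the point `q` of its domain:
the `i`-th component of the differential of the chart. -/
def coordCovec (x₀ : M) (i : Fin 3) (q : M) : TangentSpace (𝓡 3) q →L[ℝ] ℝ :=
  (EuclideanSpace.proj i : E3 →L[ℝ] ℝ).comp
    ((trivializationAt E3 (TangentSpace (𝓡 3) : M → Type _) x₀).continuousLinearMapAt ℝ q)

/-- The point of `M` with coordinates `y` in the chart around `x₀`. -/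
def pt (x₀ : M) (y : E3) : M := (extChartAt (𝓡 3) x₀).symm y

/-- The coordinates of `x` in the preferred chart around `x` itself. -/
def ctr (x : M) : E3 := extChartAt (𝓡 3) x x

/-- The components `Xⁱ` of a vector field. -/
def vecComp (x₀ : M) (X : VField M) (y : E3) (i : Fin 3) : ℝ :=
  coordCovec x₀ i (pt x₀ y) (X (pt x₀ y))

/-- The components `αᵢ` of a one-form. -/
def formComp (x₀ : M) (α : OneForm M) (y : E3) (i : Fin 3) : ℝ :=
  α (pt x₀ y) (coordVec x₀ i (pt x₀ y))

/-- The exterior derivative of a function, in coordinates. -/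
def extD0 (f : E3 → ℝ) (y : E3) (i : Fin 3) : ℝ := pd i f y

/-- The exterior derivative of a one-form, in coordinates. -/
def extD1 (a : E3 → Fin 3 → ℝ) (y : E3) (i j : Fin 3) : ℝ :=
  pd i (fun z => a z j) y - pd j (fun z => a z i) y

/-- The exterior derivative of a two-form, in coordinates. -/
def extD2 (b : E3 → Fin 3 → Fin 3 → ℝ) (y : E3) (i j k : Fin 3) : ℝ :=
  pd i (fun z => b z j k) y + pd j (fun z => b z k i) y + pd k (fun z => b z i j) y

variable [RiemannianBundle (fun x : M => TangentSpace (𝓡 3) x)]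

instance finiteDimensional_tangentSpace (x : M) : FiniteDimensional ℝ (TangentSpace (𝓡 3) x) :=
  inferInstanceAs (FiniteDimensional ℝ E3)

instance completeSpace_tangentSpace (x : M) : CompleteSpace (TangentSpace (𝓡 3) x) :=
  FiniteDimensional.complete ℝ _

instance fact_finrank_tangentSpace (x : M) :
    Fact (Module.finrank ℝ (TangentSpace (𝓡 3) x) = 3) :=
  ⟨(finrank_euclideanSpace_fin : Module.finrank ℝ E3 = 3)⟩

/-! ### Metric, Levi-Civita connection and Ricci curvature -/

/-- The matrix `gᵢⱼ = ⟨∂ᵢ, ∂ⱼ⟩` of the Riemannian metric. -/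
def metricMat (x₀ : M) (y : E3) : Matrix (Fin 3) (Fin 3) ℝ :=
  fun i j => inner ℝ (coordVec x₀ i (pt x₀ y)) (coordVec x₀ j (pt x₀ y))

/-- The inverse matrix `gⁱʲ = ⟨dxⁱ, dxʲ⟩`. -/
def metricInv (x₀ : M) (y : E3) : Matrix (Fin 3) (Fin 3) ℝ := (metricMat x₀ y)⁻¹

/-- The Christoffel symbols `Γᵏᵢⱼ` of the Levi-Civita connection. -/
def christoffel (x₀ : M) (k i j : Fin 3) (y : E3) : ℝ :=
  (1 / 2) * ∑ l, metricInv x₀ y k l *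
    (pd i (fun z => metricMat x₀ z j l) y + pd j (fun z => metricMat x₀ z i l) y
      - pd l (fun z => metricMat x₀ z i j) y)

/-- The components `Rᵢⱼ` of the Ricci tensor (positive on round spheres). -/
def ricciComp (x₀ : M) (y : E3) (i j : Fin 3) : ℝ :=
  ∑ k, (pd k (christoffel x₀ k i j) y - pd j (christoffel x₀ k i k) y)
    + ∑ k, ∑ l, (christoffel x₀ k k l y * christoffel x₀ l i j y
      - christoffel x₀ k j l y * christoffel x₀ l i k y)

/-- The Ricci tensor as a field of endomorphisms of the tangent spaces. -/
def ricci (x : M) : TangentSpace (𝓡 3) x →L[ℝ] TangentSpace (𝓡 3) x :=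
  ∑ i, ∑ k, (∑ l, metricInv x (ctr x) k l * ricciComp x (ctr x) l i) •
    (coordCovec x i x).smulRight (coordVec x k x)

/-- The components `(∇ᵢX)ᵏ = ∂ᵢXᵏ + Γᵏᵢⱼ Xʲ`. -/
def covVecComp (x₀ : M) (X : VField M) (y : E3) (i k : Fin 3) : ℝ :=
  pd i (fun z => vecComp x₀ X z k) y + ∑ j, christoffel x₀ k i j y * vecComp x₀ X y j

/-- The covariant derivative `v ↦ ∇ᵥX` of a vector field. -/
def covVec (X : VField M) (x : M) : TangentSpace (𝓡 3) x →L[ℝ] TangentSpace (𝓡 3) x :=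
  ∑ i, ∑ k, covVecComp x X (ctr x) i k • (coordCovec x i x).smulRight (coordVec x k x)

/-- The components `(∇ᵢα)ⱼ = ∂ᵢαⱼ - Γᵏᵢⱼ αₖ`. -/
def covFormComp (x₀ : M) (α : OneForm M) (y : E3) (i j : Fin 3) : ℝ :=
  pd i (fun z => formComp x₀ α z j) y - ∑ k, christoffel x₀ k i j y * formComp x₀ α y k

/-- The covariant derivative `v ↦ ∇ᵥα` of a one-form. -/
def covForm (α : OneForm M) (x : M) :
    TangentSpace (𝓡 3) x →L[ℝ] (TangentSpace (𝓡 3) x →L[ℝ] ℝ) :=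
  ∑ i, ∑ j, covFormComp x α (ctr x) i j • (coordCovec x i x).smulRight (coordCovec x j x)

/-- `|∇α|²`, the Hilbert-Schmidt norm squared of `∇α`. -/
def covFormNormSq (α : OneForm M) (x : M) : ℝ :=
  ∑ a, ‖covForm α x (stdOrthonormalBasis ℝ (TangentSpace (𝓡 3) x) a)‖ ^ 2

/-- The divergence, the trace of the covariant derivative. -/
def divergence (X : VField M) (x : M) : ℝ := ∑ i, covVecComp x X (ctr x) i i

/-- The symmetric part `∇ˢX` of `∇X`:
`⟨∇ˢX(v), w⟩ = (⟨∇ᵥX, w⟩ + ⟨∇_wX, v⟩) / 2`. -/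
def strain (X : VField M) (x : M) : TangentSpace (𝓡 3) x →L[ℝ] TangentSpace (𝓡 3) x :=
  (1 / 2 : ℝ) • (covVec X x + ContinuousLinearMap.adjoint (covVec X x))

/-! ### Musical isomorphisms and the gradient -/

/-- The one-form `⟨X, ·⟩` of a vector field. -/
def flat (X : VField M) : OneForm M := fun x => innerSL ℝ (X x)

/-- The vector field `α♯` of a one-form: `⟨α♯, v⟩ = α(v)`. -/
def sharp (α : OneForm M) : VField M :=
  fun x => (InnerProductSpace.toDual ℝ (TangentSpace (𝓡 3) x)).symm (α x)

/-- The pointwise inner product of one-forms. -/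
def formInner (α β : OneForm M) (x : M) : ℝ := inner ℝ (sharp α x) (sharp β x)

/-- The differential of a function, as a one-form. -/
def differential (f : M → ℝ) : OneForm M :=
  fun x => ∑ i, extD0 (fun z => f (pt x z)) (ctr x) i • coordCovec x i x

/-- The gradient of a function. -/
def gradient (f : M → ℝ) : VField M := sharp (differential f)

/-- `(α ⊙ T)(v) = α(T v)` for a one-form `α` and a field of endomorphisms `T`. -/
def formAct (α : OneForm M)
    (T : ∀ x : M, TangentSpace (𝓡 3) x →L[ℝ] TangentSpace (𝓡 3) x) : OneForm M :=
  fun x => (α x).comp (T x)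

/-! ### Orientation, Hodge star and the de Rham-Hodge Laplacian -/

/-- A choice of orientations of the tangent spaces. -/
abbrev TangentOrientation (M : Type*) [EMetricSpace M] [ChartedSpace E3 M] :=
  ∀ x : M, Orientation ℝ (TangentSpace (𝓡 3) x) (Fin 3)

/-- The components of the Riemannian volume form for the orientation `o`. -/
def volComp (o : TangentOrientation M) (x₀ : M) (q : M) (i j k : Fin 3) : ℝ :=
  (o q).volumeForm ![coordVec x₀ i q, coordVec x₀ j q, coordVec x₀ k q]

/-- The orientations of the tangent spaces fit together to an orientation of the manifold, that is,
the Riemannian volume form which they define is continuous on the domain of every chart. -/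
def IsOrientation (o : TangentOrientation M) : Prop :=
  ∀ x₀ : M, ContinuousOn (fun q => volComp o x₀ q 0 1 2) (chartAt E3 x₀).source

/-- The Hodge star of a one-form, `(*α)ⱼₖ = αⁱ volᵢⱼₖ`. -/
def star1 (o : TangentOrientation M) (x₀ : M) (a : E3 → Fin 3 → ℝ) (y : E3) (j k : Fin 3) : ℝ :=
  ∑ i, ∑ l, metricInv x₀ y i l * a y l * volComp o x₀ (pt x₀ y) i j k

/-- The Hodge star of a two-form, `(*β)ₖ = βⁱʲ volᵢⱼₖ / 2`. -/
def star2 (o : TangentOrientation M) (x₀ : M) (b : E3 → Fin 3 → Fin 3 → ℝ) (y : E3)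
    (k : Fin 3) : ℝ :=
  (1 / 2) * ∑ i, ∑ j, ∑ l, ∑ m, metricInv x₀ y i l * metricInv x₀ y j m * b y l m *
    volComp o x₀ (pt x₀ y) i j k

/-- The Hodge star of a three-form, `*γ = γⁱʲᵏ volᵢⱼₖ / 6`. -/
def star3 (o : TangentOrientation M) (x₀ : M) (c : E3 → Fin 3 → Fin 3 → Fin 3 → ℝ)
    (y : E3) : ℝ :=
  (1 / 6) * ∑ i, ∑ j, ∑ k, ∑ l, ∑ m, ∑ n, metricInv x₀ y i l * metricInv x₀ y j m *
    metricInv x₀ y k n * c y l m n * volComp o x₀ (pt x₀ y) i j k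

/-- The adjoint `d*` of the exterior derivative on one-forms.  In dimension `n` the adjoint on
`p`-forms is `(-1)^(n(p+1)+1) * d *`, which is `- * d *` for `n = 3`, `p = 1`. -/
def codiff1 (o : TangentOrientation M) (x₀ : M) (a : E3 → Fin 3 → ℝ) (y : E3) : ℝ :=
  - star3 o x₀ (extD2 (star1 o x₀ a)) y

/-- The adjoint `d*` of the exterior derivative on two-forms, `* d *` for `n = 3`, `p = 2`. -/
def codiff2 (o : TangentOrientation M) (x₀ : M) (b : E3 → Fin 3 → Fin 3 → ℝ) (y : E3)
    (k : Fin 3) : ℝ :=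
  star2 o x₀ (extD1 (star2 o x₀ b)) y k

/-- The de Rham-Hodge Laplacian `□ = d d* + d* d` on one-forms. -/
def hodgeForm (o : TangentOrientation M) (α : OneForm M) : OneForm M := fun x =>
  ∑ i, (extD0 (codiff1 o x (formComp x α)) (ctr x) i
    + codiff2 o x (extD1 (formComp x α)) (ctr x) i) • coordCovec x i x

/-- The de Rham-Hodge Laplacian on vector fields. -/
def hodgeVec (o : TangentOrientation M) (X : VField M) : VField M := sharp (hodgeForm o (flat X))

/-- The vorticity `*(d(flat X))` of a vector field, a one-form. -/
def vorticity (o : TangentOrientation M) (X : VField M) : OneForm M := fun x =>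
  ∑ k, star2 o x (extD1 (formComp x (flat X))) (ctr x) k • coordCovec x k x

/-! ### Riemannian volume measure -/

/-- The measure `√(det g) dy` of the chart around `x₀`, extended by zero outside its domain. -/
def chartVolume [MeasurableSpace M] (x₀ : M) : Measure M :=
  Measure.map (extChartAt (𝓡 3) x₀).symm
    ((volume.restrict (extChartAt (𝓡 3) x₀).target).withDensity
      (fun y => ENNReal.ofReal √(metricMat x₀ y).det))

/-- The Riemannian volume measure.  The chart measures agree on overlaps, so that their supremum is
the measure that restricts to `√(det g) dy` in every chart. -/
def riemVolume (M : Type*) [EMetricSpace M] [ChartedSpace E3 M] [IsManifold (𝓡 3) ∞ M]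
    [RiemannianBundle (fun x : M => TangentSpace (𝓡 3) x)] [MeasurableSpace M] : Measure M :=
  ⨆ x₀ : M, chartVolume x₀

/-! ### The Navier-Stokes equations -/

/-- `(u, p)` is a smooth solution, over the time interval `J`, of
`∂ₜu + ∇ᵤu + ν □u = -∇p`, `div u = 0`. -/
structure IsSmoothSolution (o : TangentOrientation M) (ν : ℝ) (J : Set ℝ)
    (u : ℝ → VField M) (p : ℝ → M → ℝ) : Prop where
  smooth_velocity : ContMDiffOn (𝓘(ℝ, ℝ).prod (𝓡 3)) (𝓡 3).tangent ∞
    (fun z : ℝ × M => (⟨z.2, u z.1 z.2⟩ : TangentBundle (𝓡 3) M)) (J ×ˢ univ)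
  smooth_pressure : ∀ t ∈ J, ContMDiff (𝓡 3) 𝓘(ℝ, ℝ) ∞ (p t)
  momentum : ∀ t ∈ J, ∀ x : M,
    derivWithin (fun s => u s x) J t + covVec (u t) x (u t x) + ν • hodgeVec o (u t) x
      = - gradient (p t) x
  div_free : ∀ t ∈ J, ∀ x : M, divergence (u t) x = 0

/-- Integrability at infinity, locally uniformly in time: around every time of `J` there is one
integrable function that bounds, outside a compact set, `|ω|²`, `|u||ω|²`, `|∇ω|²`, `⟨Ric ω, ω⟩`
and `⟨ω ⊙ ∇ˢu, ω⟩`.  On a compact manifold this is no condition. -/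
def IntegrableAtInfinity [MeasurableSpace M] (o : TangentOrientation M) (J : Set ℝ)
    (u : ℝ → VField M) : Prop :=
  ∀ t ∈ J, ∃ K : Set M, IsCompact K ∧ ∃ G : M → ℝ, Integrable G (riemVolume M) ∧
    ∀ᶠ s in 𝓝[J] t, ∀ x ∉ K,
      ‖vorticity o (u s) x‖ ^ 2 ≤ G x ∧
      ‖u s x‖ * ‖vorticity o (u s) x‖ ^ 2 ≤ G x ∧
      covFormNormSq (vorticity o (u s)) x ≤ G x ∧
      |formInner (formAct (vorticity o (u s)) ricci) (vorticity o (u s)) x| ≤ G x ∧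
      |formInner (formAct (vorticity o (u s)) (strain (u s))) (vorticity o (u s)) x| ≤ G x

end Manifold

end

end VorticityEnergy

open VorticityEnergy

namespace VorticityEnergy

noncomputable section

set_option linter.unusedSectionVars false

/-! Write `W = curl u` for the vector field dual to the vorticity. The local half of the argument is
vector calculus. Since `div u = 0`, the term `d d*` drops out of the Hodge Laplacian and `□u = curl
curl u` (`hodgeVec_eq`). Also `∇_u u = W × u + ½∇|u|²` (`adv_self`). Taking the curl of the momentum
equation removes both gradients, and the formula for the curl of a cross product (`curl_cross`)
gives `∂ₜW = ∇_W u - ∇_u W - ν curl curl W` (`IsSmoothSolution.curl_timeDeriv`).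

Pair this with `W`. The stretching term `⟨∇_W u, W⟩` sees only the symmetric part of `∇u`. The
transport term is `div(½|W|² u)`. The viscous term is converted by Bochner's formula `div ∇ ½|W|² =
|∇W|² + Ric(W, W) - ⟨curl curl W, W⟩` (`bochner`), which results from taking the divergence of `∇_W
W = curl W × W + ½∇|W|²`. The outcome is the pointwise law `½ ∂ₜ|W|² = -ν|∇W|² - ν Ric(W, W) + ⟨∇ˢu
W, W⟩ + div Z` with flux `Z = ν∇½|W|² - ½|W|² u` (`IsSmoothSolution.balance`).

The global half shows that `div Z` contributes nothing. The assumptions at infinity make `|Z|`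
integrable, uniformly for nearby times (`norm_flux_le`). Completeness enters through Hopf-Rinow:
finite balls are compact, so there are compactly supported cutoffs `χₙ → 1` with Lipschitz constant
`1/(n+1)`. The divergence theorem against a Lipschitz function (`abs_integral_mul_divergence_le`)
yields `|∫ χₙ div Z| ≤ ‖Z‖₁/(n+1)`. A mean value estimate for `∫ χₙ|W|²`, uniform in `n`, then
passes to the limit and differentiates `∫|W|²` (`hasDerivWithinAt_integral_of_balance`).

The operators are defined at each point through the chart centred at that point. To differentiate
them one needs the same formulas on a whole chart, so a good part of the work is chart independence,
obtained for the connection from Koszul's formula and for `d` and the curl from the connection. -/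

/-- Bilinear forms on the model space. -/
abbrev Bil := E3 →L[ℝ] E3 →L[ℝ] ℝ

local instance normedAddCommGroup_bil : NormedAddCommGroup Bil := inferInstance
local instance normedSpace_bil : NormedSpace ℝ Bil := inferInstance
local instance addCommGroup_bil : AddCommGroup Bil := inferInstance
local instance addCommMonoid_bil : AddCommMonoid Bil := inferInstance
local instance module_bil : Module ℝ Bil := inferInstance
local instance topologicalSpace_bil : TopologicalSpace Bil := inferInstance
local instance normedAddCommGroup_dual : NormedAddCommGroup (E3 →L[ℝ] ℝ) := inferInstance
local instance normedSpace_dual : NormedSpace ℝ (E3 →L[ℝ] ℝ) := inferInstance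

lemma two_le_infty : (2 : WithTop ℕ∞) ≤ ∞ :=
  WithTop.coe_le_coe.2 (le_top : (2 : ℕ∞) ≤ ⊤)

lemma one_add_one_le_infty : (1 + 1 : WithTop ℕ∞) ≤ ∞ := by
  rw [one_add_one_eq_two]
  exact two_le_infty

/-! ### Charts and transition maps. -/

section ChartBasics

variable {M : Type*} [EMetricSpace M] [ChartedSpace E3 M]

/-- The target of the extended chart around `x₀`. -/
abbrev tgt (x₀ : M) : Set E3 := (extChartAt (𝓡 3) x₀).target

/-- The domain of the chart around `x₀`. -/
abbrev src (x₀ : M) : Set M := (chartAt E3 x₀).source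

/-- The coordinates of `q` in the chart around `x₀`. -/
abbrev crd (x₀ q : M) : E3 := extChartAt (𝓡 3) x₀ q

lemma isOpen_tgt (x₀ : M) : IsOpen (tgt x₀) := isOpen_extChartAt_target x₀

lemma isOpen_src (x₀ : M) : IsOpen (src x₀) := (chartAt E3 x₀).open_source

lemma pt_mem_src {x₀ : M} {y : E3} (hy : y ∈ tgt x₀) : pt x₀ y ∈ src x₀ := by
  have := (extChartAt (𝓡 3) x₀).map_target hy
  rwa [extChartAt_source] at this

lemma crd_mem_tgt {x₀ q : M} (hq : q ∈ src x₀) : crd x₀ q ∈ tgt x₀ := by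
  apply (extChartAt (𝓡 3) x₀).map_source
  rwa [extChartAt_source]

lemma pt_crd {x₀ q : M} (hq : q ∈ src x₀) : pt x₀ (crd x₀ q) = q := by
  apply (extChartAt (𝓡 3) x₀).left_inv
  rwa [extChartAt_source]

lemma crd_pt {x₀ : M} {y : E3} (hy : y ∈ tgt x₀) : crd x₀ (pt x₀ y) = y :=
  (extChartAt (𝓡 3) x₀).right_inv hy

lemma mem_src_self (x : M) : x ∈ src x := mem_chart_source E3 x

lemma ctr_mem_tgt (x : M) : ctr x ∈ tgt x := crd_mem_tgt (mem_src_self x)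

lemma pt_ctr (x : M) : pt x (ctr x) = x := pt_crd (mem_src_self x)

lemma continuousOn_pt (x₀ : M) : ContinuousOn (pt x₀) (tgt x₀) := continuousOn_extChartAt_symm x₀

lemma continuousOn_crd (x₀ : M) : ContinuousOn (crd x₀) (src x₀) := by
  have := continuousOn_extChartAt (I := 𝓡 3) x₀
  rwa [extChartAt_source] at this

lemma tgt_mem_nhds {x₀ : M} {y : E3} (hy : y ∈ tgt x₀) : tgt x₀ ∈ 𝓝 y :=
  (isOpen_tgt x₀).mem_nhds hy

/-- A neighbourhood condition on `M` is a neighbourhood condition in coordinates. -/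
lemma eventually_pt {x₀ : M} {y : E3} (hy : y ∈ tgt x₀) {P : M → Prop}
    (h : ∀ᶠ q in 𝓝 (pt x₀ y), P q) : ∀ᶠ z in 𝓝 y, P (pt x₀ z) :=
  ((continuousOn_pt x₀).continuousAt (tgt_mem_nhds hy)).eventually h

lemma eventually_pt_mem_src {x₀ x₁ : M} {y : E3} (hy : y ∈ tgt x₀) (h : pt x₀ y ∈ src x₁) :
    ∀ᶠ z in 𝓝 y, pt x₀ z ∈ src x₁ :=
  eventually_pt hy ((isOpen_src x₁).mem_nhds h)

/-- The transition map from the chart around `x₀` to the chart around `x₁`. -/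
def trans (x₀ x₁ : M) (y : E3) : E3 := crd x₁ (pt x₀ y)

lemma pt_trans {x₀ x₁ : M} {y : E3} (h : pt x₀ y ∈ src x₁) :
    pt x₁ (trans x₀ x₁ y) = pt x₀ y := pt_crd h

variable [IsManifold (𝓡 3) ∞ M]

lemma contMDiffOn_pt (x₀ : M) : ContMDiffOn 𝓘(ℝ, E3) (𝓡 3) ∞ (pt x₀) (tgt x₀) :=
  contMDiffOn_extChartAt_symm x₀

lemma contDiffAt_trans {x₀ x₁ : M} {y : E3} (hy : y ∈ tgt x₀) (h : pt x₀ y ∈ src x₁) :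
    ContDiffAt ℝ ∞ (trans x₀ x₁) y := by
  have h1 : ContMDiffAt 𝓘(ℝ, E3) (𝓡 3) ∞ (pt x₀) y :=
    (contMDiffOn_pt x₀).contMDiffAt (tgt_mem_nhds hy)
  have h2 : ContMDiffAt (𝓡 3) 𝓘(ℝ, E3) ∞ (crd x₁) (pt x₀ y) :=
    contMDiffAt_extChartAt' h
  exact (h2.comp y h1).contDiffAt

end ChartBasics

lemma isManifold_one_three {M : Type*} [EMetricSpace M] [ChartedSpace E3 M]
    [IsManifold (𝓡 3) ∞ M] : IsManifold (𝓡 3) 1 M :=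
  IsManifold.of_le (n := ∞) (by norm_num)

attribute [local instance] isManifold_one_three

/-! ### Coordinate frames, their change of chart, and smoothness of components. -/

section Frames

variable {M : Type*} [EMetricSpace M] [ChartedSpace E3 M] [IsManifold (𝓡 3) ∞ M]

/-- The frame of the chart around `x₀` at `q`, as a linear map. -/
def frame (x₀ q : M) : E3 →L[ℝ] TangentSpace (𝓡 3) q :=
  (trivializationAt E3 (TangentSpace (𝓡 3) : M → Type _) x₀).symmL ℝ q

/-- The coframe of the chart around `x₀` at `q`, as a linear map. -/
def coframe (x₀ q : M) : TangentSpace (𝓡 3) q →L[ℝ] E3 :=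
  (trivializationAt E3 (TangentSpace (𝓡 3) : M → Type _) x₀).continuousLinearMapAt ℝ q

lemma coordVec_eq (x₀ : M) (i : Fin 3) (q : M) :
    coordVec x₀ i q = frame x₀ q (EuclideanSpace.single i 1) := rfl

lemma coordCovec_eq (x₀ : M) (i : Fin 3) (q : M) (v : TangentSpace (𝓡 3) q) :
    coordCovec x₀ i q v = coframe x₀ q v i := rfl

lemma frame_coframe {x₀ q : M} (hq : q ∈ src x₀) (v : TangentSpace (𝓡 3) q) :
    frame x₀ q (coframe x₀ q v) = v :=
  Trivialization.symmL_continuousLinearMapAt _ hq v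

lemma coframe_frame {x₀ q : M} (hq : q ∈ src x₀) (v : E3) :
    coframe x₀ q (frame x₀ q v) = v :=
  Trivialization.continuousLinearMapAt_symmL _ hq v

/-- Both trivializations are tangent coordinate changes to or from the preferred chart of the point
itself. The cocycle law composes them into the change from `x₀` to `x₁`, which is the derivative of
the transition map. -/
lemma coframe_frame_trans {x₀ x₁ : M} {y : E3} (hy : y ∈ tgt x₀) (h : pt x₀ y ∈ src x₁) (v : E3) :
    coframe x₁ (pt x₀ y) (frame x₀ (pt x₀ y) v) = fderiv ℝ (trans x₀ x₁) y v := by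
  have hs := pt_mem_src hy
  have e1 := TangentBundle.symmL_trivializationAt_eq_core (I := 𝓡 3) hs
  have e2 := TangentBundle.continuousLinearMapAt_trivializationAt_eq_core (I := 𝓡 3) h
  have e3 : fderiv ℝ (trans x₀ x₁) y = tangentCoordChange (𝓡 3) x₀ x₁ (pt x₀ y) := by
    have := hasFDerivWithinAt_tangentCoordChange (I := 𝓡 3) (x := x₀) (y := x₁) (z := pt x₀ y)
      ⟨by rwa [extChartAt_source], by rwa [extChartAt_source]⟩
    rw [show extChartAt (𝓡 3) x₀ (pt x₀ y) = y from crd_pt hy, ModelWithCorners.range_eq_univ, hasFDerivWithinAt_univ] at this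
    exact this.fderiv
  rw [e3]
  have e4 := tangentCoordChange_comp (I := 𝓡 3) (w := x₀) (x := pt x₀ y) (y := x₁)
    (z := pt x₀ y) (v := v) (by simp only [extChartAt_source]; exact ⟨⟨hs, mem_src_self _⟩, h⟩)
  rw [← e4]
  unfold coframe frame
  rw [e2, e1]
  rfl

lemma frame_trans {x₀ x₁ : M} {y : E3} (hy : y ∈ tgt x₀) (h : pt x₀ y ∈ src x₁) (v : E3) :
    frame x₀ (pt x₀ y) v = frame x₁ (pt x₀ y) (fderiv ℝ (trans x₀ x₁) y v) := by
  rw [← coframe_frame_trans hy h, frame_coframe h]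

lemma coframe_trans {x₀ x₁ : M} {y : E3} (hy : y ∈ tgt x₀) (h : pt x₀ y ∈ src x₁)
    (w : TangentSpace (𝓡 3) (pt x₀ y)) :
    coframe x₁ (pt x₀ y) w = fderiv ℝ (trans x₀ x₁) y (coframe x₀ (pt x₀ y) w) := by
  rw [← coframe_frame_trans hy h, frame_coframe (pt_mem_src hy)]

lemma single_sum (v : E3) : v = ∑ i, v i • EuclideanSpace.single i (1 : ℝ) := by
  ext j
  fin_cases j <;> simp [Fin.sum_univ_three]

lemma coordCovec_coordVec {x₀ q : M} (hq : q ∈ src x₀) (i j : Fin 3) :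
    coordCovec x₀ i q (coordVec x₀ j q) = if i = j then 1 else 0 := by
  rw [coordCovec_eq, coordVec_eq, coframe_frame hq]
  simp

lemma sum_coordCovec_smul {x₀ q : M} (hq : q ∈ src x₀) (v : TangentSpace (𝓡 3) q) :
    ∑ i, coordCovec x₀ i q v • coordVec x₀ i q = v := by
  conv_rhs => rw [← frame_coframe hq v, single_sum (coframe x₀ q v), map_sum]
  simp [coordCovec_eq, coordVec_eq]

lemma frame_eq_sum (x₀ q : M) (v : E3) : frame x₀ q v = ∑ i, v i • coordVec x₀ i q := by
  conv_lhs => rw [single_sum v, map_sum]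
  simp [coordVec_eq]

lemma form_eq_sum {x₀ q : M} (hq : q ∈ src x₀) (α : TangentSpace (𝓡 3) q →L[ℝ] ℝ) :
    α = ∑ i, α (coordVec x₀ i q) • coordCovec x₀ i q := by
  ext v
  conv_lhs => rw [← sum_coordCovec_smul hq v, map_sum]
  simp [mul_comm]

lemma form_ext {x₀ q : M} (hq : q ∈ src x₀) {α β : TangentSpace (𝓡 3) q →L[ℝ] ℝ}
    (h : ∀ i, α (coordVec x₀ i q) = β (coordVec x₀ i q)) : α = β := by
  rw [form_eq_sum hq α, form_eq_sum hq β]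
  simp [h]

lemma vec_ext {x₀ q : M} (hq : q ∈ src x₀) {v w : TangentSpace (𝓡 3) q}
    (h : ∀ i, coordCovec x₀ i q v = coordCovec x₀ i q w) : v = w := by
  rw [← sum_coordCovec_smul hq v, ← sum_coordCovec_smul hq w]
  simp [h]

/-- In the trivialization around `x₀` this section is constant, and smoothness over the base set can
be tested there. -/
lemma contMDiffOn_coordVec (x₀ : M) (i : Fin 3) :
    ContMDiffOn (𝓡 3) (𝓡 3).tangent ∞
      (fun q : M => (⟨q, coordVec x₀ i q⟩ : TangentBundle (𝓡 3) M)) (src x₀) := by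
  have := (Trivialization.contMDiffOn_section_baseSet_iff (IB := 𝓡 3) (n := ∞)
    (e := trivializationAt E3 (TangentSpace (𝓡 3) : M → Type _) x₀) (s := fun q => coordVec x₀ i q))
  refine this.2 ?_
  refine (contMDiffOn_const (c := EuclideanSpace.single i (1:ℝ))).congr fun q hq => ?_
  have h := coframe_frame (x₀ := x₀) hq (EuclideanSpace.single i 1)
  rw [← h]
  simp only [coframe, frame, coordVec]
  rw [Trivialization.continuousLinearMapAt_apply, Trivialization.linearMapAt_apply, if_pos hq]

/-- This turns the bundle-theoretic smoothness of the velocity into the form used everywhere below: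
component functions jointly smooth within `J × target`, where `J` may contain its endpoints. -/
lemma contDiffOn_vecComp_of_contMDiffOn {J : Set ℝ} {X : ℝ → VField M}
    (hX : ContMDiffOn (𝓘(ℝ, ℝ).prod (𝓡 3)) (𝓡 3).tangent ∞
      (fun z : ℝ × M => (⟨z.2, X z.1 z.2⟩ : TangentBundle (𝓡 3) M)) (J ×ˢ univ))
    (x₀ : M) (i : Fin 3) :
    ContDiffOn ℝ ∞ (fun z : ℝ × E3 => vecComp x₀ (X z.1) z.2 i) (J ×ˢ tgt x₀) := by
  set e := trivializationAt E3 (TangentSpace (𝓡 3) : M → Type _) x₀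
  have h1 : ContMDiffOn (𝓘(ℝ, ℝ).prod (𝓡 3)) 𝓘(ℝ, E3) ∞
      (fun z : ℝ × M => (e ⟨z.2, X z.1 z.2⟩).2) (J ×ˢ src x₀) := by
    have := (e.contMDiffOn_iff (IM := 𝓘(ℝ, ℝ).prod (𝓡 3)) (IB := 𝓡 3) (n := ∞)
      (f := fun z : ℝ × M => (⟨z.2, X z.1 z.2⟩ : TangentBundle (𝓡 3) M)) (s := J ×ˢ src x₀)
      (fun z hz => by
        rw [Trivialization.mem_source]
        exact hz.2)).1 (hX.mono (prod_mono le_rfl (subset_univ _)))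
    exact this.2
  have h2 : ContMDiffOn 𝓘(ℝ, ℝ × E3) (𝓘(ℝ, ℝ).prod (𝓡 3)) ∞
      (fun z : ℝ × E3 => (z.1, pt x₀ z.2)) (J ×ˢ tgt x₀) := by
    refine ContMDiffOn.prodMk ?_ ?_
    · exact contDiff_fst.contMDiff.contMDiffOn
    · exact (contMDiffOn_pt x₀).comp contDiff_snd.contMDiff.contMDiffOn (fun z hz => hz.2)
  have h3 := (h1.comp h2 (fun z hz => ⟨hz.1, pt_mem_src hz.2⟩)).contDiffOn
  have h4 : ContDiffOn ℝ ∞ (fun z : ℝ × E3 => (EuclideanSpace.proj i : E3 →L[ℝ] ℝ)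
      (e ⟨pt x₀ z.2, X z.1 (pt x₀ z.2)⟩).2) (J ×ˢ tgt x₀) :=
    (EuclideanSpace.proj i : E3 →L[ℝ] ℝ).contDiff.comp_contDiffOn h3
  refine h4.congr fun z hz => ?_
  simp only [vecComp, coordCovec, ContinuousLinearMap.comp_apply]
  rw [Trivialization.continuousLinearMapAt_apply, Trivialization.linearMapAt_apply,
    if_pos (show pt x₀ z.2 ∈ (trivializationAt E3 (TangentSpace (𝓡 3)) x₀).baseSet from
      pt_mem_src hz.2)]

variable [RiemannianBundle (fun x : M => TangentSpace (𝓡 3) x)]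
  [IsContMDiffRiemannianBundle (𝓡 3) ∞ E3 (fun x : M => TangentSpace (𝓡 3) x)]

lemma contDiffOn_metricMat (x₀ : M) (i j : Fin 3) :
    ContDiffOn ℝ ∞ (fun y => metricMat x₀ y i j) (tgt x₀) := by
  have h := ContMDiffOn.inner_bundle (IB := 𝓡 3) (n := ∞) (F := E3) (b := fun q : M => q)
    (E := fun x : M => TangentSpace (𝓡 3) x) (contMDiffOn_coordVec x₀ i) (contMDiffOn_coordVec x₀ j)
  exact (h.comp (contMDiffOn_pt x₀) (fun y hy => pt_mem_src hy)).contDiffOn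

end Frames

/-! ### The metric matrix, its inverse and the signed volume density. -/

section Metric

variable {M : Type*} [EMetricSpace M] [ChartedSpace E3 M] [IsManifold (𝓡 3) ∞ M]
variable [RiemannianBundle (fun x : M => TangentSpace (𝓡 3) x)]

/-- The Levi-Civita symbol. -/
def eps (i j k : Fin 3) : ℝ :=
  ![![![0, 0, 0], ![0, 0, 1], ![0, -1, 0]], ![![0, 0, -1], ![0, 0, 0], ![1, 0, 0]],
    ![![0, 1, 0], ![-1, 0, 0], ![0, 0, 0]]] i j k

lemma metricMat_symm (x₀ : M) (y : E3) (i j : Fin 3) :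
    metricMat x₀ y i j = metricMat x₀ y j i := real_inner_comm _ _

/-- The matrix of inner products of an orthonormal basis with the coordinate vectors. -/
def frameMat {q : M} (b : OrthonormalBasis (Fin 3) ℝ (TangentSpace (𝓡 3) q)) (x₀ : M) :
    Matrix (Fin 3) (Fin 3) ℝ := fun a i => inner ℝ (b a) (coordVec x₀ i q)

/-- The matrix of components of an orthonormal basis. -/
def coframeMat {q : M} (b : OrthonormalBasis (Fin 3) ℝ (TangentSpace (𝓡 3) q)) (x₀ : M) :
    Matrix (Fin 3) (Fin 3) ℝ := fun i a => coordCovec x₀ i q (b a)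

/-- Expand `∂ⱼ` in the orthonormal basis and apply `dxⁱ`. With `g = FᵀF` this gives both the
invertibility of `g` and the factorization of its inverse. -/
lemma coframeMat_mul_frameMat {x₀ q : M} (hq : q ∈ src x₀)
    (b : OrthonormalBasis (Fin 3) ℝ (TangentSpace (𝓡 3) q)) :
    coframeMat b x₀ * frameMat b x₀ = 1 := by
  ext i j
  have h := coordCovec_coordVec hq i j
  rw [← b.sum_repr' (coordVec x₀ j q), map_sum] at h
  simp only [map_smul, smul_eq_mul] at h
  rw [Matrix.mul_apply, Matrix.one_apply, ← h]
  exact Finset.sum_congr rfl fun a _ => mul_comm _ _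

lemma metricMat_eq_mul {x₀ : M} {y : E3}
    (b : OrthonormalBasis (Fin 3) ℝ (TangentSpace (𝓡 3) (pt x₀ y))) :
    metricMat x₀ y = (frameMat b x₀).transpose * frameMat b x₀ := by
  ext i j
  rw [Matrix.mul_apply]
  simp only [metricMat, frameMat, Matrix.transpose_apply]
  rw [← b.sum_inner_mul_inner]
  exact Finset.sum_congr rfl fun a _ => by rw [real_inner_comm]

/-- An orthonormal basis of a tangent space. -/
def onb (q : M) : OrthonormalBasis (Fin 3) ℝ (TangentSpace (𝓡 3) q) :=
  (stdOrthonormalBasis ℝ (TangentSpace (𝓡 3) q)).reindex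
    (finCongr (finrank_euclideanSpace_fin : Module.finrank ℝ E3 = 3))

lemma det_metricMat_pos {x₀ : M} {y : E3} (hy : y ∈ tgt x₀) : 0 < (metricMat x₀ y).det := by
  have h1 := congrArg Matrix.det (coframeMat_mul_frameMat (pt_mem_src hy) (onb (pt x₀ y)))
  rw [Matrix.det_mul, Matrix.det_one] at h1
  rw [metricMat_eq_mul (onb (pt x₀ y)), Matrix.det_mul, Matrix.det_transpose]
  have : (frameMat (onb (pt x₀ y)) x₀).det ≠ 0 := right_ne_zero_of_mul_eq_one h1
  exact mul_self_pos.2 this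

lemma metricMat_mul_metricInv {x₀ : M} {y : E3} (hy : y ∈ tgt x₀) :
    metricMat x₀ y * metricInv x₀ y = 1 :=
  Matrix.mul_nonsing_inv _ (isUnit_iff_ne_zero.2 (det_metricMat_pos hy).ne')

lemma metricInv_mul_metricMat {x₀ : M} {y : E3} (hy : y ∈ tgt x₀) :
    metricInv x₀ y * metricMat x₀ y = 1 :=
  Matrix.nonsing_inv_mul _ (isUnit_iff_ne_zero.2 (det_metricMat_pos hy).ne')

lemma metricInv_symm (x₀ : M) (y : E3) (i j : Fin 3) :
    metricInv x₀ y i j = metricInv x₀ y j i := by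
  have : (metricMat x₀ y).transpose = metricMat x₀ y := by
    ext i j; exact metricMat_symm x₀ y j i
  have h := Matrix.transpose_nonsing_inv (metricMat x₀ y)
  rw [this] at h
  exact congrFun (congrFun h j) i

lemma metricInv_eq_mul {x₀ : M} {y : E3} (hy : y ∈ tgt x₀)
    (b : OrthonormalBasis (Fin 3) ℝ (TangentSpace (𝓡 3) (pt x₀ y))) :
    metricInv x₀ y = coframeMat b x₀ * (coframeMat b x₀).transpose := by
  have h1 := coframeMat_mul_frameMat (pt_mem_src hy) b
  apply Matrix.inv_eq_left_inv
  rw [metricMat_eq_mul b, Matrix.mul_assoc, ← Matrix.mul_assoc (coframeMat b x₀).transpose,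
    ← Matrix.transpose_mul, mul_eq_one_comm.1 h1]
  simp [h1]

/-- The trace of a bilinear form, in coordinates. -/
lemma sum_onb_eq {x₀ : M} {y : E3} (hy : y ∈ tgt x₀)
    {ι : Type*} [Fintype ι] (b : OrthonormalBasis ι ℝ (TangentSpace (𝓡 3) (pt x₀ y)))
    (B : TangentSpace (𝓡 3) (pt x₀ y) →ₗ[ℝ] TangentSpace (𝓡 3) (pt x₀ y) →ₗ[ℝ] ℝ) :
    ∑ a, B (b a) (b a) = ∑ i, ∑ j, metricInv x₀ y i j *
      B (coordVec x₀ i (pt x₀ y)) (coordVec x₀ j (pt x₀ y)) := by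
  classical
  have hc : Fintype.card ι = 3 := by
    rw [← Module.finrank_eq_card_basis b.toBasis]
    exact (finrank_euclideanSpace_fin : Module.finrank ℝ E3 = 3)
  -- The index type is free because the Hilbert-Schmidt norm in `covFormNormSq` uses a basis indexed
  -- by `Fin` of the rank, while `onb` is indexed by `Fin 3`.
  let e := Fintype.equivFinOfCardEq hc
  have h2 : ∑ a, B (b a) (b a) = ∑ a : Fin 3, B ((b.reindex e) a) ((b.reindex e) a) := by
    simp only [OrthonormalBasis.reindex_apply]
    exact (Equiv.sum_comp e.symm (fun a => B (b a) (b a))).symm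
  rw [h2]
  generalize b.reindex e = b'
  rw [metricInv_eq_mul hy b']
  have : ∀ a, B (b' a) (b' a) = ∑ i, ∑ j, coframeMat b' x₀ i a * coframeMat b' x₀ j a *
      B (coordVec x₀ i (pt x₀ y)) (coordVec x₀ j (pt x₀ y)) := by
    intro a
    conv_lhs => rw [← sum_coordCovec_smul (pt_mem_src hy) (b' a)]
    simp only [map_sum, map_smul, LinearMap.sum_apply, LinearMap.smul_apply, smul_eq_mul,
      coframeMat, Finset.mul_sum, mul_assoc]
    rw [Finset.sum_comm]
    refine Finset.sum_congr rfl fun i _ => Finset.sum_congr rfl fun j _ => ?_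
    ring
  simp only [this, Matrix.mul_apply, Matrix.transpose_apply, Finset.sum_mul]
  rw [Finset.sum_comm]
  refine Finset.sum_congr rfl fun i _ => ?_
  rw [Finset.sum_comm]

lemma volComp_eq_eps (o : TangentOrientation M) (x₀ q : M) (i j k : Fin 3) :
    volComp o x₀ q i j k = eps i j k * volComp o x₀ q 0 1 2 := by
  have hb := (o q).volumeForm_robust ((o q).finOrthonormalBasis (by norm_num) Fact.out)
    ((o q).finOrthonormalBasis_orientation _ _)
  simp only [volComp, hb, Module.Basis.det_apply, Matrix.det_fin_three, Module.Basis.toMatrix_apply]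
  fin_cases i <;> fin_cases j <;> fin_cases k <;> simp [eps] <;> ring

/-- In a positively oriented orthonormal basis the volume form is a determinant, so `volComp` is the
determinant of `frameMat`, whose Gram matrix is `g`. Thus `volComp = ±√(det g)`; the curl
computations use this signed density. -/
lemma volComp_sq (o : TangentOrientation M) (x₀ : M) (y : E3) :
    volComp o x₀ (pt x₀ y) 0 1 2 ^ 2 = (metricMat x₀ y).det := by
  set q := pt x₀ y with hq
  let b : OrthonormalBasis (Fin 3) ℝ (TangentSpace (𝓡 3) q) :=
    (o q).finOrthonormalBasis (by norm_num) Fact.out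
  have hb : (o q).volumeForm = b.toBasis.det := (o q).volumeForm_robust b
    ((o q).finOrthonormalBasis_orientation _ _)
  rw [metricMat_eq_mul b, Matrix.det_mul, Matrix.det_transpose, sq]
  have : volComp o x₀ q 0 1 2 = (frameMat b x₀).det := by
    simp only [volComp, hb, Module.Basis.det_apply]
    congr 1
    ext a i
    simp only [Module.Basis.toMatrix_apply, frameMat, OrthonormalBasis.coe_toBasis_repr_apply,
      OrthonormalBasis.repr_apply_apply]
    fin_cases i <;> rfl
  rw [this]

end Metric

lemma HasFDerivAt.bil_apply {A : E3 → Bil} {P Q : E3 → E3} {A' : E3 →L[ℝ] Bil}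
    {P' Q' : E3 →L[ℝ] E3} {y : E3} (hA : HasFDerivAt A A' y) (hP : HasFDerivAt P P' y)
    (hQ : HasFDerivAt Q Q' y) (u : E3) :
    fderiv ℝ (fun z => A z (P z) (Q z)) y u =
      A' u (P y) (Q y) + A y (P' u) (Q y) + A y (P y) (Q' u) := by
  rw [((hA.clm_apply hP).clm_apply hQ).fderiv]
  simp
  ring

/-! ### Koszul's formula and chart independence of the Levi-Civita connection. -/

section Koszul

variable {M : Type*} [EMetricSpace M] [ChartedSpace E3 M] [IsManifold (𝓡 3) ∞ M]

lemma contDiffAt_single {f : E3 → E3} {y : E3} {n : WithTop ℕ∞}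
    (h : ∀ i, ContDiffAt ℝ n (fun z => f z i) y) : ContDiffAt ℝ n f y :=
  contDiffAt_euclidean.2 h

/-- The components of a vector field in the chart around `x₀`, as a vector. -/
def vecVec (x₀ : M) (X : VField M) (y : E3) : E3 := coframe x₀ (pt x₀ y) (X (pt x₀ y))

lemma vecVec_apply (x₀ : M) (X : VField M) (y : E3) (i : Fin 3) :
    vecVec x₀ X y i = vecComp x₀ X y i := rfl

/-- A vector field with smooth components in every chart. -/
def SmoothV (X : VField M) : Prop :=
  ∀ x₀ i, ContDiffOn ℝ ∞ (fun y => vecComp x₀ X y i) (tgt x₀)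

/-- A function with smooth coordinate expressions. -/
def SmoothF (f : M → ℝ) : Prop := ∀ x₀, ContDiffOn ℝ ∞ (fun y => f (pt x₀ y)) (tgt x₀)

lemma SmoothV.contDiffAt {X : VField M} (hX : SmoothV X) {x₀ : M} {y : E3} (hy : y ∈ tgt x₀)
    (i : Fin 3) : ContDiffAt ℝ ∞ (fun y => vecComp x₀ X y i) y :=
  (hX x₀ i).contDiffAt (tgt_mem_nhds hy)

lemma SmoothV.vecVec {X : VField M} (hX : SmoothV X) {x₀ : M} {y : E3} (hy : y ∈ tgt x₀) :
    ContDiffAt ℝ ∞ (vecVec x₀ X) y :=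
  contDiffAt_single fun i => hX.contDiffAt hy i

variable [RiemannianBundle (fun x : M => TangentSpace (𝓡 3) x)]

/-- The metric in the chart around `x₀`, as a bilinear form. -/
def metricForm (x₀ : M) (y : E3) : Bil :=
  ∑ i, ∑ j, metricMat x₀ y i j •
    (EuclideanSpace.proj i : E3 →L[ℝ] ℝ).smulRight (EuclideanSpace.proj j : E3 →L[ℝ] ℝ)

lemma metricForm_apply (x₀ : M) (y v w : E3) :
    metricForm x₀ y v w = inner ℝ (frame x₀ (pt x₀ y) v) (frame x₀ (pt x₀ y) w) := by
  rw [frame_eq_sum, frame_eq_sum, sum_inner]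
  simp only [metricForm, inner_sum, inner_smul_left, inner_smul_right, metricMat]
  simp only [sum_apply, smul_apply,
    ContinuousLinearMap.smulRight_apply, smul_eq_mul]
  refine Finset.sum_congr rfl fun i _ => Finset.sum_congr rfl fun j _ => ?_
  simp
  ring

lemma metricForm_symm (x₀ : M) (y v w : E3) : metricForm x₀ y v w = metricForm x₀ y w v := by
  rw [metricForm_apply, metricForm_apply, real_inner_comm]

lemma metricForm_single (x₀ : M) (y : E3) (i j : Fin 3) :
    metricForm x₀ y (EuclideanSpace.single i 1) (EuclideanSpace.single j 1)
      = metricMat x₀ y i j := metricForm_apply _ _ _ _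

/-- Koszul's expression for `⟨∇_v X, w⟩` in the chart around `x₀`. -/
def koszul (x₀ : M) (X : VField M) (y v w : E3) : ℝ :=
  metricForm x₀ y (fderiv ℝ (vecVec x₀ X) y v) w
    + (1 / 2) * (fderiv ℝ (metricForm x₀) y (vecVec x₀ X y) v w
      + fderiv ℝ (metricForm x₀) y v (vecVec x₀ X y) w
      - fderiv ℝ (metricForm x₀) y w (vecVec x₀ X y) v)

variable [IsContMDiffRiemannianBundle (𝓡 3) ∞ E3 (fun x : M => TangentSpace (𝓡 3) x)]

lemma contDiffAt_metricMat {x₀ : M} {y : E3} (hy : y ∈ tgt x₀) (i j : Fin 3) :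
    ContDiffAt ℝ ∞ (fun y => metricMat x₀ y i j) y :=
  (contDiffOn_metricMat x₀ i j).contDiffAt (tgt_mem_nhds hy)

lemma contDiffAt_metricForm {x₀ : M} {y : E3} (hy : y ∈ tgt x₀) :
    ContDiffAt ℝ ∞ (metricForm x₀) y := by
  unfold metricForm
  exact ContDiffAt.sum fun i _ => ContDiffAt.sum fun j _ =>
    (contDiffAt_metricMat hy i j).smul contDiffAt_const

lemma metricForm_trans {x₀ x₁ : M} {y : E3} (hy : y ∈ tgt x₀) (h : pt x₀ y ∈ src x₁) (v w : E3) :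
    metricForm x₀ y v w = metricForm x₁ (trans x₀ x₁ y) (fderiv ℝ (trans x₀ x₁) y v)
      (fderiv ℝ (trans x₀ x₁) y w) := by
  rw [metricForm_apply, metricForm_apply, pt_trans h, frame_trans hy h, frame_trans hy h]

lemma trans_mem_tgt {x₀ x₁ : M} {y : E3} (h : pt x₀ y ∈ src x₁) : trans x₀ x₁ y ∈ tgt x₁ :=
  crd_mem_tgt h

lemma vecVec_trans (X : VField M) {x₀ x₁ : M} {y : E3} (hy : y ∈ tgt x₀) (h : pt x₀ y ∈ src x₁) :
    vecVec x₁ X (trans x₀ x₁ y) = fderiv ℝ (trans x₀ x₁) y (vecVec x₀ X y) := by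
  unfold vecVec
  rw [pt_trans h, coframe_trans hy h]

/-- Differentiating the transformation law of the metric produces second derivatives of the
transition map. They are the non-tensorial terms that must cancel in Koszul's expression. -/
lemma fderiv_metricForm_trans {x₀ x₁ : M} {y : E3} (hy : y ∈ tgt x₀) (h : pt x₀ y ∈ src x₁)
    (u v w : E3) :
    fderiv ℝ (metricForm x₀) y u v w =
      fderiv ℝ (metricForm x₁) (trans x₀ x₁ y) (fderiv ℝ (trans x₀ x₁) y u)
        (fderiv ℝ (trans x₀ x₁) y v) (fderiv ℝ (trans x₀ x₁) y w)
      + metricForm x₁ (trans x₀ x₁ y) (fderiv ℝ (fderiv ℝ (trans x₀ x₁)) y u v)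
        (fderiv ℝ (trans x₀ x₁) y w)
      + metricForm x₁ (trans x₀ x₁ y) (fderiv ℝ (trans x₀ x₁) y v)
        (fderiv ℝ (fderiv ℝ (trans x₀ x₁)) y u w) := by
  have hψ := contDiffAt_trans hy h
  have h1 : HasFDerivAt (trans x₀ x₁) (fderiv ℝ (trans x₀ x₁) y) y :=
    (hψ.differentiableAt (by simp)).hasFDerivAt
  have h2 : HasFDerivAt (fderiv ℝ (trans x₀ x₁)) (fderiv ℝ (fderiv ℝ (trans x₀ x₁)) y) y :=
    ((hψ.fderiv_right (m := 1) one_add_one_le_infty).differentiableAt (by simp)).hasFDerivAt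
  have h3 : HasFDerivAt (metricForm x₁) (fderiv ℝ (metricForm x₁) (trans x₀ x₁ y))
      (trans x₀ x₁ y) :=
    ((contDiffAt_metricForm (trans_mem_tgt h)).differentiableAt (by simp)).hasFDerivAt
  have h4 : HasFDerivAt (metricForm x₀) (fderiv ℝ (metricForm x₀) y) y :=
    ((contDiffAt_metricForm hy).differentiableAt (by simp)).hasFDerivAt
  have h5 := HasFDerivAt.bil_apply h4 (hasFDerivAt_const v y) (hasFDerivAt_const w y) u
  have h6 := HasFDerivAt.bil_apply (h3.comp y h1) (h2.clm_apply (hasFDerivAt_const v y))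
    (h2.clm_apply (hasFDerivAt_const w y)) u
  have h7 : (fun z => metricForm x₀ z v w) =ᶠ[𝓝 y] fun z => (metricForm x₁ ∘ trans x₀ x₁) z
      (fderiv ℝ (trans x₀ x₁) z v) (fderiv ℝ (trans x₀ x₁) z w) := by
    filter_upwards [tgt_mem_nhds hy, eventually_pt_mem_src hy h] with z hz1 hz2
    exact metricForm_trans hz1 hz2 v w
  rw [h7.fderiv_eq, h6] at h5
  simp only [ContinuousLinearMap.comp_apply, Function.comp_apply, zero_apply,
    map_zero, add_zero, add_apply, ContinuousLinearMap.flip_apply,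
    zero_add] at h5
  exact h5.symm

lemma fderiv_vecVec_trans {X : VField M} (hX : SmoothV X) {x₀ x₁ : M} {y : E3} (hy : y ∈ tgt x₀)
    (h : pt x₀ y ∈ src x₁) (v : E3) :
    fderiv ℝ (vecVec x₁ X) (trans x₀ x₁ y) (fderiv ℝ (trans x₀ x₁) y v) =
      fderiv ℝ (trans x₀ x₁) y (fderiv ℝ (vecVec x₀ X) y v)
      + fderiv ℝ (fderiv ℝ (trans x₀ x₁)) y v (vecVec x₀ X y) := by
  have hψ := contDiffAt_trans hy h
  have h1 : HasFDerivAt (trans x₀ x₁) (fderiv ℝ (trans x₀ x₁) y) y :=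
    (hψ.differentiableAt (by simp)).hasFDerivAt
  have h2 : HasFDerivAt (fderiv ℝ (trans x₀ x₁)) (fderiv ℝ (fderiv ℝ (trans x₀ x₁)) y) y :=
    ((hψ.fderiv_right (m := 1) one_add_one_le_infty).differentiableAt (by simp)).hasFDerivAt
  have h3 : HasFDerivAt (vecVec x₁ X) (fderiv ℝ (vecVec x₁ X) (trans x₀ x₁ y))
      (trans x₀ x₁ y) :=
    ((hX.vecVec (trans_mem_tgt h)).differentiableAt (by simp)).hasFDerivAt
  have h4 : HasFDerivAt (vecVec x₀ X) (fderiv ℝ (vecVec x₀ X) y) y :=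
    ((hX.vecVec hy).differentiableAt (by simp)).hasFDerivAt
  have h5 := h3.comp y h1
  have h6 := h2.clm_apply h4
  have h7 : (vecVec x₁ X ∘ trans x₀ x₁) =ᶠ[𝓝 y] fun z =>
      fderiv ℝ (trans x₀ x₁) z (vecVec x₀ X z) := by
    filter_upwards [tgt_mem_nhds hy, eventually_pt_mem_src hy h] with z hz1 hz2
    exact vecVec_trans X hz1 hz2
  have h8 := congrArg (fun L => L v) (h5.unique (h6.congr_of_eventuallyEq h7))
  simpa [add_comm, add_left_comm, add_assoc] using h8

/-- Koszul's expression does not depend on the chart. -/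
lemma koszul_trans {X : VField M} (hX : SmoothV X) {x₀ x₁ : M} {y : E3} (hy : y ∈ tgt x₀)
    (h : pt x₀ y ∈ src x₁) (v w : E3) :
    koszul x₀ X y v w = koszul x₁ X (trans x₀ x₁ y) (fderiv ℝ (trans x₀ x₁) y v)
      (fderiv ℝ (trans x₀ x₁) y w) := by
  -- By symmetry of the second derivative `D²ψ` of the transition map, the three metric derivatives
  -- together contribute `g(D²ψ(v, X), w)`, which is exactly what the derivative of the components
  -- of `X` takes away.
  have hs : IsSymmSndFDerivAt ℝ (trans x₀ x₁) y :=
    (contDiffAt_trans hy h).isSymmSndFDerivAt (by simpa using two_le_infty)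
  unfold koszul
  rw [fderiv_metricForm_trans hy h, fderiv_metricForm_trans hy h, fderiv_metricForm_trans hy h,
    vecVec_trans X hy h, fderiv_vecVec_trans hX hy h, metricForm_trans hy h, map_add,
    add_apply, hs.eq w, hs.eq w, hs.eq v (vecVec x₀ X y),
    metricForm_symm x₁ _ _ (fderiv ℝ (fderiv ℝ (trans x₀ x₁)) y (vecVec x₀ X y) w),
    metricForm_symm x₁ _ _ (fderiv ℝ (fderiv ℝ (trans x₀ x₁)) y v w)]
  ring

/-- The lowered Christoffel symbols `g(∇_{∂ᵢ}∂ₗ, ∂ⱼ)`. -/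
def christoffelLow (x₀ : M) (y : E3) (j i l : Fin 3) : ℝ :=
  (1 / 2) * (pd i (fun z => metricMat x₀ z l j) y + pd l (fun z => metricMat x₀ z i j) y
    - pd j (fun z => metricMat x₀ z i l) y)

omit [IsContMDiffRiemannianBundle (𝓡 3) ∞ E3 (fun x : M => TangentSpace (𝓡 3) x)] in
lemma sum_metricMat_christoffel {x₀ : M} {y : E3} (hy : y ∈ tgt x₀) (j i l : Fin 3) :
    ∑ k, metricMat x₀ y j k * christoffel x₀ k i l y = christoffelLow x₀ y j i l := by
  have h := fun m => congrFun (congrFun (metricMat_mul_metricInv hy) j) m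
  simp only [Matrix.mul_apply] at h
  have e : ∀ k, metricMat x₀ y j k * christoffel x₀ k i l y = ∑ m,
      metricMat x₀ y j k * metricInv x₀ y k m * christoffelLow x₀ y m i l := by
    intro k
    simp only [christoffel, christoffelLow, Finset.mul_sum]
    exact Finset.sum_congr rfl fun m _ => by ring
  simp only [e]
  rw [Finset.sum_comm]
  simp only [← Finset.sum_mul, h, Matrix.one_apply, ite_mul, one_mul, zero_mul,
    Finset.sum_ite_eq, Finset.mem_univ, if_true]

/-- The components `⟨∇ᵢX, ∂ⱼ⟩`. -/
def covLow (x₀ : M) (X : VField M) (y : E3) (i j : Fin 3) : ℝ :=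
  ∑ k, metricMat x₀ y j k * covVecComp x₀ X y i k

lemma pd_metricMat {x₀ : M} {y : E3} (hy : y ∈ tgt x₀) (i j l : Fin 3) :
    pd i (fun z => metricMat x₀ z j l) y = fderiv ℝ (metricForm x₀) y (EuclideanSpace.single i 1)
      (EuclideanSpace.single j 1) (EuclideanSpace.single l 1) := by
  have h4 : HasFDerivAt (metricForm x₀) (fderiv ℝ (metricForm x₀) y) y :=
    ((contDiffAt_metricForm hy).differentiableAt (by simp)).hasFDerivAt
  have h5 := HasFDerivAt.bil_apply h4 (hasFDerivAt_const (EuclideanSpace.single j (1:ℝ)) y)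
    (hasFDerivAt_const (EuclideanSpace.single l (1:ℝ)) y) (EuclideanSpace.single i 1)
  simp only [metricForm_single] at h5
  rw [pd, h5]
  simp only [zero_apply, map_zero, add_zero]

omit [RiemannianBundle (fun x : M => TangentSpace (𝓡 3) x)]
  [IsContMDiffRiemannianBundle (𝓡 3) ∞ E3 (fun x : M => TangentSpace (𝓡 3) x)] in
lemma pd_vecComp {X : VField M} (hX : SmoothV X) {x₀ : M} {y : E3} (hy : y ∈ tgt x₀)
    (i k : Fin 3) :
    pd i (fun z => vecComp x₀ X z k) y =
      fderiv ℝ (vecVec x₀ X) y (EuclideanSpace.single i 1) k := by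
  have h4 : HasFDerivAt (vecVec x₀ X) (fderiv ℝ (vecVec x₀ X) y) y :=
    ((hX.vecVec hy).differentiableAt (by simp)).hasFDerivAt
  have h5 := ((EuclideanSpace.proj k : E3 →L[ℝ] ℝ).hasFDerivAt (x := vecVec x₀ X y)).comp y h4
  have h6 : fderiv ℝ (fun z => vecComp x₀ X z k) y = _ := h5.fderiv
  rw [pd, h6]
  rfl

omit [IsContMDiffRiemannianBundle (𝓡 3) ∞ E3 (fun x : M => TangentSpace (𝓡 3) x)] in
lemma covLow_eq {x₀ : M} (X : VField M) {y : E3} (hy : y ∈ tgt x₀) (i j : Fin 3) :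
    covLow x₀ X y i j = ∑ k, metricMat x₀ y j k * pd i (fun z => vecComp x₀ X z k) y
      + ∑ l, christoffelLow x₀ y j i l * vecComp x₀ X y l := by
  simp only [covLow, covVecComp, mul_add, Finset.sum_add_distrib, Finset.mul_sum, ← mul_assoc]
  congr 1
  rw [Finset.sum_comm]
  simp only [← Finset.sum_mul, sum_metricMat_christoffel hy]

/-- This identifies the chart-independent expression with the one built from Christoffel symbols,
with its upper index lowered. -/
lemma koszul_single {X : VField M} (hX : SmoothV X) {x₀ : M} {y : E3} (hy : y ∈ tgt x₀)
    (i j : Fin 3) :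
    koszul x₀ X y (EuclideanSpace.single i 1) (EuclideanSpace.single j 1) = covLow x₀ X y i j := by
  rw [covLow_eq X hy, koszul]
  congr 1
  · rw [single_sum (fderiv ℝ (vecVec x₀ X) y (EuclideanSpace.single i 1)), map_sum,
      sum_apply]
    refine Finset.sum_congr rfl fun k _ => ?_
    rw [map_smul, smul_apply, metricForm_single, metricMat_symm,
      pd_vecComp hX hy, smul_eq_mul, mul_comm]
  · have e := single_sum (vecVec x₀ X y)
    simp only [christoffelLow, pd_metricMat hy]
    rw [e]
    simp only [map_sum, map_smul, sum_apply, smul_apply,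
      smul_eq_mul, vecVec_apply]
    rw [← Finset.sum_add_distrib, ← Finset.sum_sub_distrib, Finset.mul_sum]
    refine Finset.sum_congr rfl fun l _ => ?_
    have h1 := pd_metricMat hy j l i
    have h2 := pd_metricMat hy j i l
    have h3 : pd j (fun z => metricMat x₀ z l i) y = pd j (fun z => metricMat x₀ z i l) y := by
      congr 1; ext z; exact metricMat_symm _ _ _ _
    rw [← h1, ← h2, h3]
    ring

/-- The covariant derivative, computed in the chart around `x₀`. -/
def covChart (x₀ : M) (X : VField M) (q : M) : TangentSpace (𝓡 3) q →L[ℝ] TangentSpace (𝓡 3) q :=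
  ∑ i, ∑ k, covVecComp x₀ X (crd x₀ q) i k • (coordCovec x₀ i q).smulRight (coordVec x₀ k q)

omit [IsContMDiffRiemannianBundle (𝓡 3) ∞ E3 (fun x : M => TangentSpace (𝓡 3) x)] in
lemma covChart_coordVec {x₀ q : M} (hq : q ∈ src x₀) (X : VField M) (i : Fin 3) :
    covChart x₀ X q (coordVec x₀ i q) =
      ∑ k, covVecComp x₀ X (crd x₀ q) i k • coordVec x₀ k q := by
  simp only [covChart, sum_apply, smul_apply,
    ContinuousLinearMap.smulRight_apply, coordCovec_coordVec hq]
  rw [Finset.sum_comm]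
  refine Finset.sum_congr rfl fun k _ => ?_
  simp

lemma inner_covChart_frame {X : VField M} (hX : SmoothV X) {x₀ q : M} (hq : q ∈ src x₀)
    (v w : E3) :
    inner ℝ (covChart x₀ X q (frame x₀ q v)) (frame x₀ q w) = koszul x₀ X (crd x₀ q) v w := by
  have hy := crd_mem_tgt hq
  have key : ∀ i j, inner ℝ (covChart x₀ X q (coordVec x₀ i q)) (coordVec x₀ j q)
      = covLow x₀ X (crd x₀ q) i j := by
    intro i j
    rw [covChart_coordVec hq, sum_inner]
    refine Finset.sum_congr rfl fun k _ => ?_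
    rw [inner_smul_left, metricMat, pt_crd hq, real_inner_comm]
    simp [mul_comm]
  have hl : koszul x₀ X (crd x₀ q) v w = ∑ i, ∑ j, v i * w j *
      koszul x₀ X (crd x₀ q) (EuclideanSpace.single i 1) (EuclideanSpace.single j 1) := by
    conv_lhs => rw [single_sum v, single_sum w]
    simp only [koszul, map_sum, map_smul, sum_apply,
      smul_apply, smul_eq_mul]
    simp only [Fin.sum_univ_three]
    ring
  rw [hl, frame_eq_sum, frame_eq_sum, map_sum, sum_inner]
  refine Finset.sum_congr rfl fun i _ => ?_
  rw [inner_sum]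
  refine Finset.sum_congr rfl fun j _ => ?_
  rw [map_smul, inner_smul_left, inner_smul_right, key, koszul_single hX hy]
  simp
  ring

/-- The covariant derivative does not depend on the chart. -/
lemma covVec_eq_covChart {X : VField M} (hX : SmoothV X) {x₀ q : M} (hq : q ∈ src x₀) :
    covVec X q = covChart x₀ X q := by
  have h0 : covVec X q = covChart q X q := rfl
  have hp : pt x₀ (crd x₀ q) = q := pt_crd hq
  have ht : trans x₀ q (crd x₀ q) = crd q q := by unfold trans; rw [hp]
  have hy := crd_mem_tgt hq
  have hc : ∀ a : TangentSpace (𝓡 3) q, coframe q q a =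
      fderiv ℝ (trans x₀ q) (crd x₀ q) (coframe x₀ q a) := by
    have := fun a => coframe_trans (x₁ := q) hy (by rw [hp]; exact mem_src_self q) a
    rw [hp] at this
    exact this
  rw [h0]
  ext1 a
  refine ext_inner_right ℝ fun b => ?_
  -- Both connections, tested against an arbitrary vector `b`, are Koszul expressions, one in the
  -- chart around `q` and one in the chart around `x₀`.
  have h1 := inner_covChart_frame hX (mem_src_self q) (coframe q q a) (coframe q q b)
  have h2 := inner_covChart_frame hX hq (coframe x₀ q a) (coframe x₀ q b)
  rw [frame_coframe (mem_src_self q), frame_coframe (mem_src_self q)] at h1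
  rw [frame_coframe hq, frame_coframe hq] at h2
  rw [h1, h2, koszul_trans hX hy (by rw [hp]; exact mem_src_self q), ht, hc, hc]

/-- The definition of `covVec` uses a different chart at each point. This formula holds throughout
one chart and can therefore be differentiated. -/
lemma covVec_coordVec {X : VField M} (hX : SmoothV X) {x₀ : M} {y : E3} (hy : y ∈ tgt x₀)
    (i : Fin 3) :
    covVec X (pt x₀ y) (coordVec x₀ i (pt x₀ y)) =
      ∑ k, covVecComp x₀ X y i k • coordVec x₀ k (pt x₀ y) := by
  rw [covVec_eq_covChart hX (pt_mem_src hy), covChart_coordVec (pt_mem_src hy), crd_pt hy]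

lemma inner_covVec_coordVec {X : VField M} (hX : SmoothV X) {x₀ : M} {y : E3} (hy : y ∈ tgt x₀)
    (i j : Fin 3) :
    inner ℝ (covVec X (pt x₀ y) (coordVec x₀ i (pt x₀ y))) (coordVec x₀ j (pt x₀ y)) =
      covLow x₀ X y i j := by
  rw [covVec_coordVec hX hy, sum_inner]
  refine Finset.sum_congr rfl fun k _ => ?_
  rw [inner_smul_left, metricMat, real_inner_comm]
  simp [mul_comm]

end Koszul

/-! ### Rules for partial derivatives and determinants. -/

section PartialDerivatives

variable {f g : E3 → ℝ} {y : E3}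

lemma pd_add (i : Fin 3) (hf : DifferentiableAt ℝ f y) (hg : DifferentiableAt ℝ g y) :
    pd i (fun z => f z + g z) y = pd i f y + pd i g y := by
  simp [pd, fderiv_fun_add hf hg]

lemma pd_sub (i : Fin 3) (hf : DifferentiableAt ℝ f y) (hg : DifferentiableAt ℝ g y) :
    pd i (fun z => f z - g z) y = pd i f y - pd i g y := by
  simp [pd, fderiv_fun_sub hf hg]

lemma pd_const (i : Fin 3) (c : ℝ) : pd i (fun _ => c) y = 0 := by
  simp [pd]

lemma pd_mul (i : Fin 3) (hf : DifferentiableAt ℝ f y) (hg : DifferentiableAt ℝ g y) :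
    pd i (fun z => f z * g z) y = pd i f y * g y + f y * pd i g y := by
  simp [pd, fderiv_fun_mul hf hg]
  ring

lemma pd_const_mul (i : Fin 3) (c : ℝ) (hf : DifferentiableAt ℝ f y) :
    pd i (fun z => c * f z) y = c * pd i f y := by
  simp [pd, fderiv_const_mul hf]

lemma pd_sum (i : Fin 3) {ι : Type*} (s : Finset ι) {F : ι → E3 → ℝ}
    (h : ∀ a ∈ s, DifferentiableAt ℝ (F a) y) :
    pd i (fun z => ∑ a ∈ s, F a z) y = ∑ a ∈ s, pd i (F a) y := by
  simp [pd, fderiv_fun_sum h]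

lemma pd_congr (i : Fin 3) (h : f =ᶠ[𝓝 y] g) : pd i f y = pd i g y := by
  simp [pd, h.fderiv_eq]

lemma pd_comm (i j : Fin 3) (hf : ContDiffAt ℝ ∞ f y) :
    pd i (pd j f) y = pd j (pd i f) y := by
  have hs : IsSymmSndFDerivAt ℝ f y := hf.isSymmSndFDerivAt (by simpa using two_le_infty)
  have h2 : HasFDerivAt (fderiv ℝ f) (fderiv ℝ (fderiv ℝ f) y) y :=
    ((hf.fderiv_right (m := 1) one_add_one_le_infty).differentiableAt (by simp)).hasFDerivAt
  have key : ∀ i j, pd i (pd j f) y =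
      fderiv ℝ (fderiv ℝ f) y (EuclideanSpace.single i 1) (EuclideanSpace.single j 1) := by
    intro i j
    have := (h2.clm_apply (hasFDerivAt_const (EuclideanSpace.single j (1:ℝ)) y)).fderiv
    change fderiv ℝ (fun z => fderiv ℝ f z (EuclideanSpace.single j 1)) y _ = _
    rw [this]
    simp
  rw [key, key, hs.eq]

lemma contDiffAt_pd (i : Fin 3) (hf : ContDiffAt ℝ ∞ f y) : ContDiffAt ℝ ∞ (pd i f) y :=
  (hf.fderiv_right (m := ∞) (by simp)).clm_apply contDiffAt_const

lemma pd_eq_sum (f : E3 → ℝ) (y v : E3) : fderiv ℝ f y v = ∑ i, v i * pd i f y := by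
  conv_lhs => rw [single_sum v, map_sum]
  simp [pd]

/-- Jacobi's formula for the derivative of a determinant. -/
lemma pd_det {A : E3 → Matrix (Fin 3) (Fin 3) ℝ} (j : Fin 3)
    (hA : ∀ k l, DifferentiableAt ℝ (fun z => A z k l) y) :
    pd j (fun z => (A z).det) y =
      ∑ k, ∑ l, (A y).adjugate l k * pd j (fun z => A z k l) y := by
  have h := fun k l => (hA k l).hasFDerivAt
  simp only [Matrix.det_fin_three, Matrix.adjugate_fin_three]
  have h1 := ((((((h 0 0).mul (h 1 1)).mul (h 2 2)).sub (((h 0 0).mul (h 1 2)).mul (h 2 1))).sub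
    (((h 0 1).mul (h 1 0)).mul (h 2 2))).add (((h 0 1).mul (h 1 2)).mul (h 2 0))).add
    (((h 0 2).mul (h 1 0)).mul (h 2 1)) |>.sub (((h 0 2).mul (h 1 1)).mul (h 2 0))
  have h2 := congrArg (fun L => L (EuclideanSpace.single j (1:ℝ))) h1.fderiv
  refine Eq.trans h2 ?_
  simp [Fin.sum_univ_three, pd]
  ring

end PartialDerivatives

/-! ### Matrix identities behind the Hodge star. -/

section Algebra

/-- The vector with components `β₁₂, β₂₀, β₀₁` of an antisymmetric matrix. -/
def dualVec (b : Fin 3 → Fin 3 → ℝ) (n : Fin 3) : ℝ := ![b 1 2, b 2 0, b 0 1] n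

/-- As `h = g⁻¹`, one has `adj h = det h · g` and `det g · det h = 1`. This eliminates `g` in favour
of cofactors of `h`, after which identities become polynomial. -/
lemma eq_det_mul_adjugate {g h : Matrix (Fin 3) (Fin 3) ℝ} (hgh : g * h = 1) (i j : Fin 3) :
    g i j = g.det * h.adjugate i j := by
  have h1 : g * (h * h.adjugate) = h.adjugate := by rw [← Matrix.mul_assoc, hgh, Matrix.one_mul]
  rw [Matrix.mul_adjugate] at h1
  have h2 : g.det * h.det = 1 := by rw [← Matrix.det_mul, hgh, Matrix.det_one]
  have h3 := congrFun (congrFun h1 i) j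
  simp only [Matrix.mul_smul, Matrix.mul_one, Matrix.smul_apply, smul_eq_mul] at h3
  rw [← h3, ← mul_assoc, h2, one_mul]

/-- Raising both indices of `b` and contracting with `eps` produces the cofactors of `h`, hence `g`
up to the factor `det g = v²`. So the star of a two-form is the flat of the vector with components
`dualVec b / v`. -/
lemma star_sum_two {g h : Matrix (Fin 3) (Fin 3) ℝ} (hgh : g * h = 1) (hs : ∀ i j, h i j = h j i)
    {v : ℝ} (hv : v ≠ 0) (hdet : v ^ 2 = g.det) {b : Fin 3 → Fin 3 → ℝ}
    (hb : ∀ i j, b i j = - b j i) (k : Fin 3) :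
    (1 / 2) * ∑ i, ∑ j, ∑ l, ∑ m, h i l * h j m * b l m * (eps i j k * v) =
      ∑ n, g k n * (dualVec b n / v) := by
  have e : ∀ n, g k n * (dualVec b n / v) = v * h.adjugate k n * dualVec b n := by
    intro n
    rw [eq_det_mul_adjugate hgh, ← hdet]
    field_simp
  simp only [e]
  have b00 : b 0 0 = 0 := by linarith [hb 0 0]
  have b11 : b 1 1 = 0 := by linarith [hb 1 1]
  have b22 : b 2 2 = 0 := by linarith [hb 2 2]
  have b10 := hb 1 0
  have b21 := hb 2 1
  have b02 := hb 0 2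
  have s10 := hs 1 0
  have s21 := hs 2 1
  have s20 := hs 2 0
  simp only [Fin.sum_univ_three, Matrix.adjugate_fin_three, dualVec]
  fin_cases k <;>
  · simp [eps, b00, b11, b22, b10, b21, b02, s10, s21, s20]
    ring

lemma sum_eps_three (h : Matrix (Fin 3) (Fin 3) ℝ) (i j k : Fin 3) :
    ∑ l, ∑ m, ∑ n, h i l * h j m * h k n * eps l m n =
      h i 0 * (h j 1 * h k 2 - h j 2 * h k 1) - h i 1 * (h j 0 * h k 2 - h j 2 * h k 0)
        + h i 2 * (h j 0 * h k 1 - h j 1 * h k 0) := by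
  simp [Fin.sum_univ_three, eps]
  ring

/-- The contraction of three copies of `h` with two Levi-Civita symbols is `6 det h`, which the
factor `1/6` normalizes. -/
lemma star_sum_three (h : Matrix (Fin 3) (Fin 3) ℝ) (s v : ℝ) :
    (1 / 6) * ∑ i, ∑ j, ∑ k, ∑ l, ∑ m, ∑ n, h i l * h j m * h k n * (eps l m n * s) *
      (eps i j k * v) = h.det * s * v := by
  have e : ∀ i j k, ∑ l, ∑ m, ∑ n, h i l * h j m * h k n * (eps l m n * s) * (eps i j k * v) =
      (∑ l, ∑ m, ∑ n, h i l * h j m * h k n * eps l m n) * (s * v * eps i j k) := by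
    intro i j k
    simp only [Finset.sum_mul]
    refine Finset.sum_congr rfl fun l _ => Finset.sum_congr rfl fun m _ =>
      Finset.sum_congr rfl fun n _ => by ring
  simp only [e, sum_eps_three]
  simp [Fin.sum_univ_three, eps, Matrix.det_fin_three]
  ring

end Algebra

/-! ### The volume form in coordinates and the smoothness of its density. -/

section Orientation

variable {M : Type*} [EMetricSpace M] [ChartedSpace E3 M] [IsManifold (𝓡 3) ∞ M]
variable [RiemannianBundle (fun x : M => TangentSpace (𝓡 3) x)]

lemma volumeForm_eq (o : TangentOrientation M) {x₀ q : M} (hq : q ∈ src x₀)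
    (a : Fin 3 → TangentSpace (𝓡 3) q) :
    (o q).volumeForm a = volComp o x₀ q 0 1 2 *
      Matrix.det (Matrix.of fun i m => coordCovec x₀ i q (a m)) := by
  let b : OrthonormalBasis (Fin 3) ℝ (TangentSpace (𝓡 3) q) :=
    (o q).finOrthonormalBasis (by norm_num) Fact.out
  have hb : (o q).volumeForm = b.toBasis.det := (o q).volumeForm_robust b
    ((o q).finOrthonormalBasis_orientation _ _)
  have h1 : volComp o x₀ q 0 1 2 = (frameMat b x₀).det := by
    simp only [volComp, hb, Module.Basis.det_apply]
    congr 1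
    ext a i
    simp only [Module.Basis.toMatrix_apply, frameMat, OrthonormalBasis.coe_toBasis_repr_apply,
      OrthonormalBasis.repr_apply_apply]
    fin_cases i <;> rfl
  rw [h1, hb, Module.Basis.det_apply, ← Matrix.det_mul]
  congr 1
  ext c m
  simp only [Module.Basis.toMatrix_apply, frameMat, OrthonormalBasis.coe_toBasis_repr_apply,
      OrthonormalBasis.repr_apply_apply, Matrix.mul_apply, Matrix.of_apply]
  conv_lhs => rw [← sum_coordCovec_smul hq (a m), inner_sum]
  refine Finset.sum_congr rfl fun i _ => ?_
  rw [inner_smul_right, mul_comm]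

lemma volComp_ne_zero (o : TangentOrientation M) {x₀ : M} {y : E3} (hy : y ∈ tgt x₀) :
    volComp o x₀ (pt x₀ y) 0 1 2 ≠ 0 := by
  have h := volComp_sq o x₀ y
  have h2 := det_metricMat_pos hy
  intro h0
  rw [h0] at h
  simp at h
  exact h2.ne h

lemma star2_eq (o : TangentOrientation M) {x₀ : M} {y : E3} (hy : y ∈ tgt x₀)
    {b : E3 → Fin 3 → Fin 3 → ℝ} (hb : ∀ i j, b y i j = - b y j i) (k : Fin 3) :
    star2 o x₀ b y k = ∑ n, metricMat x₀ y k n *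
      (dualVec (b y) n / volComp o x₀ (pt x₀ y) 0 1 2) := by
  rw [← star_sum_two (metricMat_mul_metricInv hy) (metricInv_symm x₀ y) (volComp_ne_zero o hy)
    (volComp_sq o x₀ y) hb]
  simp only [star2]
  simp_rw [volComp_eq_eps o x₀ (pt x₀ y) _ _ k]

variable [IsContMDiffRiemannianBundle (𝓡 3) ∞ E3 (fun x : M => TangentSpace (𝓡 3) x)]

lemma contDiffAt_det_metricMat {x₀ : M} {y : E3} (hy : y ∈ tgt x₀) :
    ContDiffAt ℝ ∞ (fun z => (metricMat x₀ z).det) y := by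
  have h := fun i j => contDiffAt_metricMat hy i j
  simp only [Matrix.det_fin_three]
  exact ((((((h 0 0).mul (h 1 1)).mul (h 2 2)).sub (((h 0 0).mul (h 1 2)).mul (h 2 1))).sub
    (((h 0 1).mul (h 1 0)).mul (h 2 2))).add (((h 0 1).mul (h 1 2)).mul (h 2 0))).add
    (((h 0 2).mul (h 1 0)).mul (h 2 1)) |>.sub (((h 0 2).mul (h 1 1)).mul (h 2 0))

lemma contDiffAt_sqrt_det {x₀ : M} {y : E3} (hy : y ∈ tgt x₀) :
    ContDiffAt ℝ ∞ (fun z => √(metricMat x₀ z).det) y :=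
  (contDiffAt_det_metricMat hy).sqrt (det_metricMat_pos hy).ne'

lemma contDiffAt_metricInv {x₀ : M} {y : E3} (hy : y ∈ tgt x₀) (i j : Fin 3) :
    ContDiffAt ℝ ∞ (fun z => metricInv x₀ z i j) y := by
  have h : ∀ z, metricInv x₀ z i j = (metricMat x₀ z).det⁻¹ * (metricMat x₀ z).adjugate i j := by
    intro z
    simp [metricInv, Matrix.inv_def]
  simp only [h]
  refine ((contDiffAt_det_metricMat hy).inv (det_metricMat_pos hy).ne').mul ?_
  have h := fun i j => contDiffAt_metricMat hy i j
  -- The entries of the adjugate come in two sign patterns, one for each parity of the position.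
  have key : ∀ a b c d e f a' b' , ContDiffAt ℝ ∞ (fun z => metricMat x₀ z a b * metricMat x₀ z c d
    - metricMat x₀ z e f * metricMat x₀ z a' b') y := fun a b c d e f a' b' =>
      ((h a b).mul (h c d)).sub ((h e f).mul (h a' b'))
  have key' : ∀ a b c d e f a' b' , ContDiffAt ℝ ∞ (fun z => -(metricMat x₀ z a b *
    metricMat x₀ z c d) + metricMat x₀ z e f * metricMat x₀ z a' b') y :=
      fun a b c d e f a' b' => ((h a b).mul (h c d)).neg.add ((h e f).mul (h a' b'))
  simp only [Matrix.adjugate_fin_three]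
  fin_cases i <;> fin_cases j <;> simp <;> first | exact key _ _ _ _ _ _ _ _ | exact key' _ _ _ _ _ _ _ _

/-- An orientation is only required to be continuous. Since `volComp` does not vanish, its sign is
then locally constant, so near `y` it is `√(det g)` or its negative and inherits smoothness from the
metric. -/
lemma contDiffAt_volComp {o : TangentOrientation M} (ho : IsOrientation o) {x₀ : M} {y : E3}
    (hy : y ∈ tgt x₀) : ContDiffAt ℝ ∞ (fun z => volComp o x₀ (pt x₀ z) 0 1 2) y := by
  have hc : ContinuousAt (fun z => volComp o x₀ (pt x₀ z) 0 1 2) y :=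
    ((ho x₀).comp (continuousOn_pt x₀) (fun z hz => pt_mem_src hz)).continuousAt (tgt_mem_nhds hy)
  have hs : ∀ z, √(metricMat x₀ z).det = |volComp o x₀ (pt x₀ z) 0 1 2| := by
    intro z
    rw [← volComp_sq o, Real.sqrt_sq_eq_abs]
  rcases lt_or_gt_of_ne (volComp_ne_zero o hy) with h | h
  · refine (contDiffAt_sqrt_det hy).neg.congr_of_eventuallyEq ?_
    filter_upwards [hc.eventually (gt_mem_nhds h)] with z hz
    rw [hs, abs_of_neg hz, neg_neg]
  · refine (contDiffAt_sqrt_det hy).congr_of_eventuallyEq ?_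
    filter_upwards [hc.eventually (lt_mem_nhds h)] with z hz
    rw [hs, abs_of_pos hz]

end Orientation

/-! ### Musical isomorphisms, torsion-freeness and the curl in an arbitrary chart. -/

section Fields

variable {M : Type*} [EMetricSpace M] [ChartedSpace E3 M] [IsManifold (𝓡 3) ∞ M]
variable [RiemannianBundle (fun x : M => TangentSpace (𝓡 3) x)]

@[simp] lemma sharp_flat (X : VField M) : sharp (flat X) = X := by
  ext1 x
  exact (InnerProductSpace.toDual ℝ (TangentSpace (𝓡 3) x)).symm_apply_apply (X x)

@[simp] lemma flat_sharp (α : OneForm M) : flat (sharp α) = α := by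
  ext1 x
  exact (InnerProductSpace.toDual ℝ (TangentSpace (𝓡 3) x)).apply_symm_apply (α x)

lemma inner_sharp (α : OneForm M) (x : M) (v : TangentSpace (𝓡 3) x) :
    inner ℝ (sharp α x) v = α x v :=
  InnerProductSpace.toDual_symm_apply

lemma norm_sharp (α : OneForm M) (x : M) : ‖sharp α x‖ = ‖α x‖ :=
  (InnerProductSpace.toDual ℝ (TangentSpace (𝓡 3) x)).symm.norm_map (α x)

/-- The curl of a vector field: the vorticity as a vector field. -/
def curl (o : TangentOrientation M) (X : VField M) : VField M := sharp (vorticity o X)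

lemma flat_curl (o : TangentOrientation M) (X : VField M) : flat (curl o X) = vorticity o X :=
  flat_sharp _

lemma formComp_flat {x₀ : M} (X : VField M) {y : E3} (hy : y ∈ tgt x₀) (j : Fin 3) :
    formComp x₀ (flat X) y j = ∑ k, metricMat x₀ y j k * vecComp x₀ X y k := by
  change inner ℝ (X (pt x₀ y)) (coordVec x₀ j (pt x₀ y)) = _
  conv_lhs => rw [← sum_coordCovec_smul (pt_mem_src hy) (X (pt x₀ y)), sum_inner]
  refine Finset.sum_congr rfl fun k _ => ?_
  rw [inner_smul_left, metricMat, real_inner_comm]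
  simp [vecComp, mul_comm]

lemma sum_metricInv_formComp {x₀ : M} (X : VField M) {y : E3} (hy : y ∈ tgt x₀) (i : Fin 3) :
    ∑ l, metricInv x₀ y i l * formComp x₀ (flat X) y l = vecComp x₀ X y i := by
  have h := fun m => congrFun (congrFun (metricInv_mul_metricMat hy) i) m
  simp only [Matrix.mul_apply] at h
  simp only [formComp_flat X hy, Finset.mul_sum, ← mul_assoc]
  rw [Finset.sum_comm]
  simp only [← Finset.sum_mul, h, Matrix.one_apply, ite_mul, one_mul, zero_mul,
    Finset.sum_ite_eq, Finset.mem_univ, if_true]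

lemma inner_eq_sum {x₀ : M} (X Y : VField M) {y : E3} (hy : y ∈ tgt x₀) :
    inner ℝ (X (pt x₀ y)) (Y (pt x₀ y)) =
      ∑ j, (∑ k, metricMat x₀ y j k * vecComp x₀ X y k) * vecComp x₀ Y y j := by
  conv_lhs => rw [← sum_coordCovec_smul (pt_mem_src hy) (Y (pt x₀ y)), inner_sum]
  refine Finset.sum_congr rfl fun j _ => ?_
  rw [inner_smul_right, ← formComp_flat X hy, mul_comm]
  rfl

variable [IsContMDiffRiemannianBundle (𝓡 3) ∞ E3 (fun x : M => TangentSpace (𝓡 3) x)]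

lemma SmoothV.diffAt {X : VField M} (hX : SmoothV X) {x₀ : M} {y : E3} (hy : y ∈ tgt x₀)
    (i : Fin 3) : DifferentiableAt ℝ (fun y => vecComp x₀ X y i) y :=
  (hX.contDiffAt hy i).differentiableAt (by simp)

lemma diffAt_metricMat {x₀ : M} {y : E3} (hy : y ∈ tgt x₀) (i j : Fin 3) :
    DifferentiableAt ℝ (fun y => metricMat x₀ y i j) y :=
  (contDiffAt_metricMat hy i j).differentiableAt (by simp)

lemma pd_formComp_flat {X : VField M} (hX : SmoothV X) {x₀ : M} {y : E3} (hy : y ∈ tgt x₀)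
    (i j : Fin 3) :
    pd i (fun z => formComp x₀ (flat X) z j) y =
      ∑ k, (pd i (fun z => metricMat x₀ z j k) y * vecComp x₀ X y k +
        metricMat x₀ y j k * pd i (fun z => vecComp x₀ X z k) y) := by
  have h : (fun z => formComp x₀ (flat X) z j) =ᶠ[𝓝 y]
      fun z => ∑ k, metricMat x₀ z j k * vecComp x₀ X z k := by
    filter_upwards [tgt_mem_nhds hy] with z hz
    exact formComp_flat X hz j
  rw [pd_congr i h, pd_sum]
  · exact Finset.sum_congr rfl fun k _ => pd_mul i (diffAt_metricMat hy j k) (hX.diffAt hy k)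
  · exact fun k _ => (diffAt_metricMat hy j k).mul (hX.diffAt hy k)

lemma pd_metricMat_symm (x₀ : M) (y : E3) (i j k : Fin 3) :
    pd i (fun z => metricMat x₀ z j k) y = pd i (fun z => metricMat x₀ z k j) y := by
  congr 1
  ext z
  exact metricMat_symm _ _ _ _

/-- The Levi-Civita connection is torsion free: `d(flat X)` is the antisymmetric part of `∇X`. -/
lemma extD1_flat {X : VField M} (hX : SmoothV X) {x₀ : M} {y : E3} (hy : y ∈ tgt x₀)
    (i j : Fin 3) :
    extD1 (formComp x₀ (flat X)) y i j = covLow x₀ X y i j - covLow x₀ X y j i := by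
  rw [extD1, pd_formComp_flat hX hy, pd_formComp_flat hX hy, covLow_eq X hy, covLow_eq X hy]
  simp only [christoffelLow, Finset.sum_add_distrib]
  have e : ∀ A B C D E F : ℝ, C - D = E - F → C + A - (D + B) = A + E - (B + F) := by
    intros; linarith
  apply e
  -- With lowered symbols written as `Γ_{j,ik}`, what remains is `Γ_{j,ik} - Γ_{i,jk} = ∂ᵢgⱼₖ -
  -- ∂ⱼgᵢₖ`.
  rw [← Finset.sum_sub_distrib, ← Finset.sum_sub_distrib]
  refine Finset.sum_congr rfl fun k _ => ?_
  rw [pd_metricMat_symm x₀ y i j k, pd_metricMat_symm x₀ y j i k, pd_metricMat_symm x₀ y k i j]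
  ring

/-- The Levi-Civita connection commutes with the musical isomorphisms. -/
lemma covFormComp_flat {X : VField M} (hX : SmoothV X) {x₀ : M} {y : E3} (hy : y ∈ tgt x₀)
    (i j : Fin 3) : covFormComp x₀ (flat X) y i j = covLow x₀ X y i j := by
  rw [covFormComp, pd_formComp_flat hX hy, covLow_eq X hy]
  have h : ∑ k, christoffel x₀ k i j y * formComp x₀ (flat X) y k =
      ∑ l, christoffelLow x₀ y l i j * vecComp x₀ X y l := by
    simp only [formComp_flat X hy, Finset.mul_sum]
    rw [Finset.sum_comm]
    refine Finset.sum_congr rfl fun l _ => ?_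
    rw [← sum_metricMat_christoffel hy, Finset.sum_mul]
    refine Finset.sum_congr rfl fun k _ => ?_
    rw [metricMat_symm x₀ y k l]
    ring
  rw [h, Finset.sum_add_distrib]
  have e : ∀ A B C D : ℝ, B - C = D → B + A - C = A + D := by intros; linarith
  apply e
  rw [← Finset.sum_sub_distrib]
  refine Finset.sum_congr rfl fun k _ => ?_
  simp only [christoffelLow]
  rw [pd_metricMat_symm x₀ y i j k, pd_metricMat_symm x₀ y j i k]
  ring

omit [IsContMDiffRiemannianBundle (𝓡 3) ∞ E3 (fun x : M => TangentSpace (𝓡 3) x)] in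
lemma inner_clm_eq_sum {x₀ q : M} (hq : q ∈ src x₀)
    (L : TangentSpace (𝓡 3) q →L[ℝ] TangentSpace (𝓡 3) q) (a b : TangentSpace (𝓡 3) q) :
    inner ℝ (L a) b = ∑ i, ∑ j, coordCovec x₀ i q a * coordCovec x₀ j q b *
      inner ℝ (L (coordVec x₀ i q)) (coordVec x₀ j q) := by
  conv_lhs => rw [← sum_coordCovec_smul hq a, ← sum_coordCovec_smul hq b]
  rw [map_sum, sum_inner]
  refine Finset.sum_congr rfl fun i _ => ?_
  rw [inner_sum]
  refine Finset.sum_congr rfl fun j _ => ?_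
  rw [map_smul, inner_smul_left, inner_smul_right]
  simp
  ring

omit [IsContMDiffRiemannianBundle (𝓡 3) ∞ E3 (fun x : M => TangentSpace (𝓡 3) x)] in
lemma metricMat_ctr (x : M) (i j : Fin 3) :
    metricMat x (ctr x) i j = inner ℝ (coordVec x i x) (coordVec x j x) := by
  unfold metricMat
  rw [pt_ctr]

lemma covForm_flat {X : VField M} (hX : SmoothV X) (x : M) (v w : TangentSpace (𝓡 3) x) :
    covForm (flat X) x v w = inner ℝ (covVec X x v) w := by
  have hx := mem_src_self x
  have h : ∀ i j, inner ℝ (covVec X x (coordVec x i x)) (coordVec x j x) =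
      covLow x X (ctr x) i j := by
    intro i j
    have := inner_covVec_coordVec hX (ctr_mem_tgt x) i j
    rwa [pt_ctr] at this
  rw [inner_clm_eq_sum hx]
  simp only [h, covForm, sum_apply, smul_apply,
    ContinuousLinearMap.smulRight_apply, covFormComp_flat hX (ctr_mem_tgt x), smul_eq_mul]
  refine Finset.sum_congr rfl fun i _ => Finset.sum_congr rfl fun j _ => ?_
  ring

lemma norm_covForm_flat {X : VField M} (hX : SmoothV X) (x : M) (v : TangentSpace (𝓡 3) x) :
    ‖covForm (flat X) x v‖ = ‖covVec X x v‖ := by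
  have : covForm (flat X) x v = innerSL ℝ (covVec X x v) := by
    ext w
    exact covForm_flat hX x v w
  rw [this, innerSL_apply_norm]

/-- The antisymmetric part of `∇X`. -/
def rot (X : VField M) (x : M) (a b : TangentSpace (𝓡 3) x) : ℝ :=
  inner ℝ (covVec X x a) b - inner ℝ (covVec X x b) a

/-- Since `rot` is built from the connection, it is already independent of the chart. It thereby
carries `d(flat X)` from one chart to another without a separate change of variables for `d`. -/
lemma rot_coordVec {X : VField M} (hX : SmoothV X) {x₀ : M} {y : E3} (hy : y ∈ tgt x₀)
    (i j : Fin 3) :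
    rot X (pt x₀ y) (coordVec x₀ i (pt x₀ y)) (coordVec x₀ j (pt x₀ y)) =
      extD1 (formComp x₀ (flat X)) y i j := by
  rw [rot, inner_covVec_coordVec hX hy, inner_covVec_coordVec hX hy, extD1_flat hX hy]

lemma rot_eq_sum {X : VField M} {x₀ : M} {y : E3} (hy : y ∈ tgt x₀)
    (a b : TangentSpace (𝓡 3) (pt x₀ y)) :
    rot X (pt x₀ y) a b = ∑ i, ∑ j, coordCovec x₀ i (pt x₀ y) a * coordCovec x₀ j (pt x₀ y) b *
      rot X (pt x₀ y) (coordVec x₀ i (pt x₀ y)) (coordVec x₀ j (pt x₀ y)) := by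
  have h := pt_mem_src hy
  have e := inner_clm_eq_sum h (covVec X (pt x₀ y))
  rw [rot, e a b, e b a, Finset.sum_comm (f := fun i j => coordCovec x₀ i (pt x₀ y) b * _ * _),
    ← Finset.sum_sub_distrib]
  refine Finset.sum_congr rfl fun i _ => ?_
  rw [← Finset.sum_sub_distrib]
  refine Finset.sum_congr rfl fun j _ => ?_
  rw [rot]
  ring

lemma extD1_antisymm (a : E3 → Fin 3 → ℝ) (y : E3) (i j : Fin 3) :
    extD1 a y i j = - extD1 a y j i := by
  simp [extD1]

lemma coordCovec_sum_smul {x₀ q : M} (hq : q ∈ src x₀) (c : Fin 3 → ℝ) (n : Fin 3) :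
    coordCovec x₀ n q (∑ k, c k • coordVec x₀ k q) = c n := by
  simp [map_sum, coordCovec_coordVec hq]

lemma sharp_eq_sum {x₀ q : M} (hq : q ∈ src x₀) (α : OneForm M) (c : Fin 3 → ℝ)
    (h : ∀ k, α q (coordVec x₀ k q) = ∑ n, inner ℝ (coordVec x₀ k q) (coordVec x₀ n q) * c n) :
    sharp α q = ∑ n, c n • coordVec x₀ n q := by
  refine ext_inner_right ℝ fun v => ?_
  rw [inner_sharp]
  have : innerSL ℝ (∑ n, c n • coordVec x₀ n q) = α q := by
    refine form_ext hq fun k => ?_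
    rw [innerSL_apply_apply, h, sum_inner]
    refine Finset.sum_congr rfl fun n _ => ?_
    rw [inner_smul_left, real_inner_comm]
    simp [mul_comm]
  rw [← this, innerSL_apply_apply]

lemma curl_self (o : TangentOrientation M) {X : VField M} (x : M) :
    curl o X x = ∑ n, (dualVec (extD1 (formComp x (flat X)) (ctr x)) n /
      volComp o x x 0 1 2) • coordVec x n x := by
  refine sharp_eq_sum (mem_src_self x) _ _ fun k => ?_
  simp only [vorticity, sum_apply, smul_apply,
    coordCovec_coordVec (mem_src_self x), smul_eq_mul]
  rw [Finset.sum_eq_single k (by intro b _ hb; simp [hb]) (by simp)]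
  simp only [if_true, mul_one]
  rw [star2_eq o (ctr_mem_tgt x) (extD1_antisymm _ _)]
  simp only [metricMat_ctr]
  rw [pt_ctr]

/-- The defining property of the curl: `d(flat X) = ι_{curl X} vol`. -/
lemma rot_eq_volumeForm (o : TangentOrientation M) {X : VField M} (hX : SmoothV X) (x : M)
    (a b : TangentSpace (𝓡 3) x) : rot X x a b = (o x).volumeForm ![curl o X x, a, b] := by
  have hx := mem_src_self x
  have hd := rot_coordVec hX (ctr_mem_tgt x)
  have h := rot_eq_sum (X := X) (ctr_mem_tgt x)
  have hv := volComp_ne_zero o (ctr_mem_tgt x)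
  rw [pt_ctr] at h hd hv
  rw [h, volumeForm_eq o hx, Matrix.det_fin_three]
  simp only [Matrix.of_apply, Matrix.cons_val_zero, Matrix.cons_val_one, Matrix.cons_val,
    curl_self o x, coordCovec_sum_smul hx, hd]
  simp only [Fin.sum_univ_three, dualVec, Matrix.cons_val_zero, Matrix.cons_val_one,
    Matrix.cons_val]
  have an := extD1_antisymm (formComp x (flat X)) (ctr x)
  have b00 : extD1 (formComp x (flat X)) (ctr x) 0 0 = 0 := by linarith [an 0 0]
  have b11 : extD1 (formComp x (flat X)) (ctr x) 1 1 = 0 := by linarith [an 1 1]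
  have b22 : extD1 (formComp x (flat X)) (ctr x) 2 2 = 0 := by linarith [an 2 2]
  rw [b00, b11, b22, an 1 0, an 2 1, an 0 2]
  field_simp
  ring

/-- Both sides of `rot_eq_volumeForm` are chart-free. Evaluated on the coordinate vectors around
`x₀` they determine the curl in that chart, although `vorticity` is defined through the chart
centred at each point. -/
lemma vecComp_curl (o : TangentOrientation M) {X : VField M} (hX : SmoothV X) {x₀ : M} {y : E3}
    (hy : y ∈ tgt x₀) (n : Fin 3) :
    vecComp x₀ (curl o X) y n = dualVec (extD1 (formComp x₀ (flat X)) y) n /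
      volComp o x₀ (pt x₀ y) 0 1 2 := by
  have hx := pt_mem_src hy
  have hv := volComp_ne_zero o hy
  rw [eq_div_iff hv]
  have key : ∀ i j, extD1 (formComp x₀ (flat X)) y i j = _ := fun i j =>
    (rot_coordVec hX hy i j).symm.trans ((rot_eq_volumeForm o hX _ _ _).trans
      (volumeForm_eq o hx _))
  simp only [Matrix.det_fin_three, Matrix.of_apply, Matrix.cons_val_zero, Matrix.cons_val_one,
    Matrix.cons_val, coordCovec_coordVec hx] at key
  simp only [vecComp, dualVec, key]
  fin_cases n <;> simp <;> ring

/-- With this formula valid throughout a chart, a second exterior derivative can be taken, as the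
Hodge Laplacian requires. -/
lemma formComp_vorticity (o : TangentOrientation M) {X : VField M} (hX : SmoothV X) {x₀ : M}
    {y : E3} (hy : y ∈ tgt x₀) (n : Fin 3) :
    formComp x₀ (vorticity o X) y n = star2 o x₀ (extD1 (formComp x₀ (flat X))) y n := by
  rw [← flat_curl, formComp_flat _ hy, star2_eq o hy (extD1_antisymm _ _)]
  simp only [vecComp_curl o hX hy]

lemma SmoothV.contDiffAt_formComp {X : VField M} (hX : SmoothV X) {x₀ : M} {y : E3}
    (hy : y ∈ tgt x₀) (j : Fin 3) : ContDiffAt ℝ ∞ (fun z => formComp x₀ (flat X) z j) y := by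
  have h : (fun z => formComp x₀ (flat X) z j) =ᶠ[𝓝 y]
      fun z => ∑ k, metricMat x₀ z j k * vecComp x₀ X z k := by
    filter_upwards [tgt_mem_nhds hy] with z hz
    exact formComp_flat X hz j
  refine ContDiffAt.congr_of_eventuallyEq ?_ h
  exact ContDiffAt.sum fun k _ => (contDiffAt_metricMat hy j k).mul (hX.contDiffAt hy k)

lemma SmoothV.contDiffAt_extD1 {X : VField M} (hX : SmoothV X) {x₀ : M} {y : E3}
    (hy : y ∈ tgt x₀) (i j : Fin 3) :
    ContDiffAt ℝ ∞ (fun z => extD1 (formComp x₀ (flat X)) z i j) y :=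
  (contDiffAt_pd i (hX.contDiffAt_formComp hy j)).sub (contDiffAt_pd j (hX.contDiffAt_formComp hy i))

lemma SmoothV.curl {o : TangentOrientation M} (ho : IsOrientation o) {X : VField M}
    (hX : SmoothV X) : SmoothV (curl o X) := by
  intro x₀ n y hy
  apply ContDiffAt.contDiffWithinAt
  have h : (fun z => vecComp x₀ (VorticityEnergy.curl o X) z n) =ᶠ[𝓝 y] fun z =>
      dualVec (extD1 (formComp x₀ (flat X)) z) n / volComp o x₀ (pt x₀ z) 0 1 2 := by
    filter_upwards [tgt_mem_nhds hy] with z hz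
    exact vecComp_curl o hX hz n
  refine ContDiffAt.congr_of_eventuallyEq ?_ h
  refine ContDiffAt.div ?_ (contDiffAt_volComp ho hy) (volComp_ne_zero o hy)
  fin_cases n
  · exact hX.contDiffAt_extD1 hy 1 2
  · exact hX.contDiffAt_extD1 hy 2 0
  · exact hX.contDiffAt_extD1 hy 0 1

end Fields

/-! ### The differential of a function in an arbitrary chart. -/

section Scalars

variable {M : Type*} [EMetricSpace M] [ChartedSpace E3 M] [IsManifold (𝓡 3) ∞ M]

lemma SmoothF.contDiffAt {f : M → ℝ} (hf : SmoothF f) {x₀ : M} {y : E3} (hy : y ∈ tgt x₀) :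
    ContDiffAt ℝ ∞ (fun z => f (pt x₀ z)) y :=
  (hf x₀).contDiffAt (tgt_mem_nhds hy)

lemma differential_apply (f : M → ℝ) (q : M) (v : TangentSpace (𝓡 3) q) :
    differential f q v = fderiv ℝ (fun z => f (pt q z)) (ctr q) (coframe q q v) := by
  rw [pd_eq_sum]
  simp only [differential, sum_apply, smul_apply,
    smul_eq_mul, extD0, coordCovec_eq]
  exact Finset.sum_congr rfl fun i _ => mul_comm _ _

/-- The differential of a function does not depend on the chart. -/
lemma differential_coordVec {f : M → ℝ} (hf : SmoothF f) {x₀ : M} {y : E3} (hy : y ∈ tgt x₀)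
    (i : Fin 3) :
    differential f (pt x₀ y) (coordVec x₀ i (pt x₀ y)) = pd i (fun z => f (pt x₀ z)) y := by
  set q := pt x₀ y with hq
  have hq' : pt x₀ y ∈ src q := mem_src_self q
  rw [differential_apply, coordVec_eq, hq, coframe_frame_trans hy hq', ← hq]
  have h1 : (fun z => f (pt x₀ z)) =ᶠ[𝓝 y] (fun z => f (pt q z)) ∘ trans x₀ q := by
    filter_upwards [tgt_mem_nhds hy, eventually_pt_mem_src hy hq'] with z hz1 hz2
    simp only [Function.comp_apply, pt_trans hz2]
  have h2 : trans x₀ q y = ctr q := rfl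
  rw [pd, h1.fderiv_eq, fderiv_comp, h2]
  · rfl
  · rw [h2]
    exact (hf.contDiffAt (ctr_mem_tgt q)).differentiableAt (by simp)
  · exact (contDiffAt_trans hy hq').differentiableAt (by simp)

end Scalars

/-! ### The divergence, the codifferential and the Hodge Laplacian. -/

section Divergence

variable {M : Type*} [EMetricSpace M] [ChartedSpace E3 M] [IsManifold (𝓡 3) ∞ M]
variable [RiemannianBundle (fun x : M => TangentSpace (𝓡 3) x)]
variable [IsContMDiffRiemannianBundle (𝓡 3) ∞ E3 (fun x : M => TangentSpace (𝓡 3) x)]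

lemma sum_metricInv_covLow {x₀ : M} (X : VField M) {y : E3} (hy : y ∈ tgt x₀) (i k : Fin 3) :
    ∑ j, metricInv x₀ y k j * covLow x₀ X y i j = covVecComp x₀ X y i k := by
  have h := fun m => congrFun (congrFun (metricInv_mul_metricMat hy) k) m
  simp only [Matrix.mul_apply] at h
  simp only [covLow, Finset.mul_sum, ← mul_assoc]
  rw [Finset.sum_comm]
  simp only [← Finset.sum_mul, h, Matrix.one_apply, ite_mul, one_mul, zero_mul,
    Finset.sum_ite_eq, Finset.mem_univ, if_true]

/-- The trace of the covariant derivative, in an arbitrary chart. -/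
lemma trace_covVec {X : VField M} (hX : SmoothV X) {x₀ : M} {y : E3} (hy : y ∈ tgt x₀) :
    ∑ a, inner ℝ (covVec X (pt x₀ y) (onb (pt x₀ y) a)) (onb (pt x₀ y) a) =
      ∑ i, covVecComp x₀ X y i i := by
  have h := sum_onb_eq hy (onb (pt x₀ y)) (LinearMap.mk₂ ℝ
    (fun a b => inner ℝ (covVec X (pt x₀ y) a) b)
    (by intros; simp [inner_add_left]) (by intros; simp [inner_smul_left])
    (by intros; simp [inner_add_right]) (by intros; simp [inner_smul_right]))
  simp only [LinearMap.mk₂_apply] at h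
  rw [h]
  refine Finset.sum_congr rfl fun i _ => ?_
  simp only [inner_covVec_coordVec hX hy, sum_metricInv_covLow X hy]

/-- The divergence, in an arbitrary chart. -/
lemma divergence_eq {X : VField M} (hX : SmoothV X) {x₀ : M} {y : E3} (hy : y ∈ tgt x₀) :
    divergence X (pt x₀ y) = ∑ i, covVecComp x₀ X y i i := by
  rw [← trace_covVec hX hy]
  have := trace_covVec hX (ctr_mem_tgt (pt x₀ y))
  rw [pt_ctr] at this
  exact this.symm

lemma christoffel_symm (x₀ : M) (y : E3) (k i j : Fin 3) :
    christoffel x₀ k i j y = christoffel x₀ k j i y := by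
  unfold christoffel
  congr 1
  refine Finset.sum_congr rfl fun l _ => ?_
  rw [pd_metricMat_symm x₀ y l i j]
  ring

/-- The contracted Christoffel symbols are the logarithmic derivatives of the volume density. -/
lemma sum_christoffel {x₀ : M} {y : E3} (hy : y ∈ tgt x₀) {w : E3 → ℝ}
    (hw : ∀ᶠ z in 𝓝 y, w z ^ 2 = (metricMat x₀ z).det) (hd : DifferentiableAt ℝ w y) (j : Fin 3) :
    w y * ∑ i, christoffel x₀ i i j y = pd j w y := by
  have h0 := hw.self_of_nhds
  have hpos := det_metricMat_pos hy
  have hw0 : w y ≠ 0 := by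
    intro h
    rw [h] at h0
    simp at h0
    exact hpos.ne h0
  -- Only `w² = det g` near the point is assumed, so that the result serves both the signed density
  -- `volComp` and the positive `density`. Jacobi's formula differentiates this relation.
  have h1 : pd j (fun z => w z * w z) y = pd j (fun z => (metricMat x₀ z).det) y := by
    apply pd_congr
    filter_upwards [hw] with z hz
    rw [← sq, hz]
  rw [pd_mul j hd hd, pd_det j (fun k l => diffAt_metricMat hy k l)] at h1
  have h2 : ∀ k l, (metricMat x₀ y).adjugate l k = w y ^ 2 * metricInv x₀ y l k := by
    intro k l
    rw [h0, metricInv, Matrix.inv_def]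
    simp [hpos.ne']
  simp only [h2] at h1
  have s := metricInv_symm x₀ y
  have h3 : ∑ i, christoffel x₀ i i j y =
      (1 / 2) * ∑ k, ∑ l, metricInv x₀ y l k * pd j (fun z => metricMat x₀ z k l) y := by
    simp only [christoffel, ← Finset.mul_sum]
    congr 1
    have m := pd_metricMat_symm x₀ y
    simp only [Fin.sum_univ_three]
    rw [s 1 0, s 2 0, s 2 1, m j 1 0, m j 2 0, m j 2 1, m 0 j 0, m 0 j 1, m 0 j 2, m 1 j 0, m 1 j 1,
      m 1 j 2, m 2 j 0, m 2 j 1, m 2 j 2]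
    ring
  have h4 : pd j w y * w y + w y * pd j w y = 2 * w y ^ 2 * ∑ i, christoffel x₀ i i j y := by
    rw [h1, h3]
    simp only [Finset.mul_sum]
    refine Finset.sum_congr rfl fun k _ => Finset.sum_congr rfl fun l _ => ?_
    ring
  have h5 : 2 * w y * (pd j w y) = 2 * w y * (w y * ∑ i, christoffel x₀ i i j y) := by
    linarith
  exact (mul_left_cancel₀ (by simpa using hw0) h5).symm

/-- The divergence as the divergence of the density `w X`, where `w² = det g`. -/
lemma mul_sum_covVecComp {X : VField M} (hX : SmoothV X) {x₀ : M} {y : E3} (hy : y ∈ tgt x₀)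
    {w : E3 → ℝ} (hw : ∀ᶠ z in 𝓝 y, w z ^ 2 = (metricMat x₀ z).det)
    (hd : DifferentiableAt ℝ w y) :
    w y * ∑ i, covVecComp x₀ X y i i = ∑ i, pd i (fun z => w z * vecComp x₀ X z i) y := by
  have h : ∀ i, pd i (fun z => w z * vecComp x₀ X z i) y =
      w y * (∑ j, christoffel x₀ j j i y) * vecComp x₀ X y i +
        w y * pd i (fun z => vecComp x₀ X z i) y := by
    intro i
    rw [pd_mul i hd (hX.diffAt hy i), sum_christoffel hy hw hd]
  simp only [h, covVecComp, Finset.sum_add_distrib, mul_add, Finset.mul_sum, Finset.sum_mul]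
  rw [add_comm]
  congr 1
  rw [Finset.sum_comm]
  refine Finset.sum_congr rfl fun i _ => Finset.sum_congr rfl fun j _ => ?_
  ring

variable {o : TangentOrientation M} (ho : IsOrientation o)
include ho

lemma diffAt_volComp {x₀ : M} {y : E3} (hy : y ∈ tgt x₀) :
    DifferentiableAt ℝ (fun z => volComp o x₀ (pt x₀ z) 0 1 2) y :=
  (contDiffAt_volComp ho hy).differentiableAt (by simp)

lemma volComp_mul_divergence {X : VField M} (hX : SmoothV X) {x₀ : M} {y : E3} (hy : y ∈ tgt x₀) :
    volComp o x₀ (pt x₀ y) 0 1 2 * divergence X (pt x₀ y) =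
      ∑ i, pd i (fun z => volComp o x₀ (pt x₀ z) 0 1 2 * vecComp x₀ X z i) y := by
  rw [divergence_eq hX hy, ← mul_sum_covVecComp hX hy
    (Filter.Eventually.of_forall fun z => volComp_sq o x₀ z) (diffAt_volComp ho hy)]

/-- The two-form `*(flat X)` has entries `εᵢⱼₖ v Xⁱ` with `v = volComp`. Its exterior derivative is
`εᵢⱼₖ ∂ₘ(v Xᵐ) = εᵢⱼₖ v div X`, and starring this three-form multiplies by `v / det g`; the
densities cancel by `v² = det g`. -/
lemma codiff1_eq {X : VField M} (hX : SmoothV X) {x₀ : M} {y : E3} (hy : y ∈ tgt x₀) :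
    codiff1 o x₀ (formComp x₀ (flat X)) y = - divergence X (pt x₀ y) := by
  set v := volComp o x₀ (pt x₀ y) 0 1 2 with hv
  have hv0 := volComp_ne_zero o hy
  set w : Fin 3 → E3 → ℝ := fun i z => volComp o x₀ (pt x₀ z) 0 1 2 * vecComp x₀ X z i with hw
  have hwd : ∀ i, DifferentiableAt ℝ (w i) y := fun i => (diffAt_volComp ho hy).mul (hX.diffAt hy i)
  have h1 : ∀ j k, ∀ᶠ z in 𝓝 y, star1 o x₀ (formComp x₀ (flat X)) z j k =
      ∑ i, eps i j k * w i z := by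
    intro j k
    filter_upwards [tgt_mem_nhds hy] with z hz
    simp only [star1, hw]
    refine Finset.sum_congr rfl fun i _ => ?_
    rw [← Finset.sum_mul, sum_metricInv_formComp X hz, volComp_eq_eps]
    ring
  have h2 : ∀ i j k, pd i (fun z => star1 o x₀ (formComp x₀ (flat X)) z j k) y =
      ∑ m, eps m j k * pd i (w m) y := by
    intro i j k
    rw [pd_congr i (h1 j k), pd_sum i _ (fun m _ => (hwd m).const_mul _)]
    exact Finset.sum_congr rfl fun m _ => pd_const_mul i _ (hwd m)
  set s := ∑ i, pd i (w i) y with hs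
  have h3 : ∀ i j k, extD2 (star1 o x₀ (formComp x₀ (flat X))) y i j k = eps i j k * s := by
    intro i j k
    simp only [extD2, h2, hs, Fin.sum_univ_three]
    fin_cases i <;> fin_cases j <;> fin_cases k <;> simp [eps] <;> ring
  have h4 : v * divergence X (pt x₀ y) = s := volComp_mul_divergence ho hX hy
  have h5 : codiff1 o x₀ (formComp x₀ (flat X)) y = - ((metricInv x₀ y).det * s * v) := by
    rw [← star_sum_three, codiff1, star3]
    have e : ∀ i j k, volComp o x₀ (pt x₀ y) i j k = eps i j k * v :=
      fun i j k => volComp_eq_eps o x₀ (pt x₀ y) i j k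
    simp only [h3, e]
  have h6 : (metricInv x₀ y).det * (metricMat x₀ y).det = 1 := by
    rw [← Matrix.det_mul, metricInv_mul_metricMat hy, Matrix.det_one]
  rw [h5, ← h4]
  rw [← volComp_sq o] at h6
  congr 1
  linear_combination (divergence X (pt x₀ y)) * h6

/-- The de Rham-Hodge Laplacian of a divergence-free vector field is its double curl. -/
lemma hodgeVec_eq {X : VField M} (hX : SmoothV X) (hdiv : ∀ x, divergence X x = 0) :
    hodgeVec o X = curl o (curl o X) := by
  unfold hodgeVec curl
  congr 1
  ext1 x
  rw [hodgeForm, vorticity]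
  refine Finset.sum_congr rfl fun i _ => ?_
  congr 1
  -- The divergence vanishes near `x` and not just at `x`, so the derivative of the codifferential
  -- vanishes too.
  have h1 : extD0 (codiff1 o x (formComp x (flat X))) (ctr x) i = 0 := by
    rw [extD0, pd_congr i (g := fun _ => 0), pd_const]
    filter_upwards [tgt_mem_nhds (ctr_mem_tgt x)] with z hz
    rw [codiff1_eq ho hX hz, hdiv, neg_zero]
  rw [h1, zero_add, codiff2]
  -- The inner `*d` is the vorticity on a whole neighbourhood, so the outer `*d` computes the curl
  -- once more.
  have h2 : ∀ j, (fun z => star2 o x (extD1 (formComp x (flat X))) z j) =ᶠ[𝓝 (ctr x)]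
      fun z => formComp x (flat (sharp (vorticity o X))) z j := by
    intro j
    filter_upwards [tgt_mem_nhds (ctr_mem_tgt x)] with z hz
    rw [flat_sharp, formComp_vorticity o hX hz]
  have h3 : ∀ l m, extD1 (star2 o x (extD1 (formComp x (flat X)))) (ctr x) l m =
      extD1 (formComp x (flat (sharp (vorticity o X)))) (ctr x) l m := by
    intro l m
    simp only [extD1] at h2 ⊢
    rw [pd_congr _ (h2 m), pd_congr _ (h2 l)]
  unfold star2 at h3 ⊢
  simp only [h3]

end Divergence

/-! ### Smoothness of the operations, and the decomposition of `∇_X X`. -/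

section Operations

variable {M : Type*} [EMetricSpace M] [ChartedSpace E3 M] [IsManifold (𝓡 3) ∞ M]

lemma SmoothV.add {X Y : VField M} (hX : SmoothV X) (hY : SmoothV Y) :
    SmoothV (fun x => X x + Y x) := fun x₀ i => by
  simp only [vecComp, map_add]
  exact (hX x₀ i).add (hY x₀ i)

lemma SmoothV.sub {X Y : VField M} (hX : SmoothV X) (hY : SmoothV Y) :
    SmoothV (fun x => X x - Y x) := fun x₀ i => by
  simp only [vecComp, map_sub]
  exact (hX x₀ i).sub (hY x₀ i)

lemma SmoothV.smul {f : M → ℝ} {X : VField M} (hf : SmoothF f) (hX : SmoothV X) :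
    SmoothV (fun x => f x • X x) := fun x₀ i => by
  simp only [vecComp, map_smul, smul_eq_mul]
  exact (hf x₀).mul (hX x₀ i)

lemma SmoothF.const (c : ℝ) : SmoothF (fun _ : M => c) := fun _ => contDiffOn_const

lemma SmoothV.const_smul (c : ℝ) {X : VField M} (hX : SmoothV X) :
    SmoothV (fun x => c • X x) := SmoothV.smul (SmoothF.const c) hX

lemma SmoothF.mul {f g : M → ℝ} (hf : SmoothF f) (hg : SmoothF g) :
    SmoothF (fun x => f x * g x) := fun x₀ => (hf x₀).mul (hg x₀)

variable [RiemannianBundle (fun x : M => TangentSpace (𝓡 3) x)]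
variable [IsContMDiffRiemannianBundle (𝓡 3) ∞ E3 (fun x : M => TangentSpace (𝓡 3) x)]

/-- A vector field is smooth if its covariant components are. -/
lemma smoothV_of_formComp {X : VField M}
    (h : ∀ x₀ j, ContDiffOn ℝ ∞ (fun y => formComp x₀ (flat X) y j) (tgt x₀)) : SmoothV X := by
  intro x₀ i
  have : ContDiffOn ℝ ∞ (fun y => ∑ l, metricInv x₀ y i l * formComp x₀ (flat X) y l) (tgt x₀) :=
    ContDiffOn.sum fun l _ =>
      ContDiffOn.mul (fun y hy => (contDiffAt_metricInv hy i l).contDiffWithinAt) (h x₀ l)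
  exact this.congr fun y hy => (sum_metricInv_formComp X hy i).symm

lemma SmoothV.inner {X Y : VField M} (hX : SmoothV X) (hY : SmoothV Y) :
    SmoothF (fun x => Inner.inner ℝ (X x) (Y x)) := by
  intro x₀
  have : ContDiffOn ℝ ∞ (fun y => ∑ j, (∑ k, metricMat x₀ y j k * vecComp x₀ X y k) *
      vecComp x₀ Y y j) (tgt x₀) :=
    ContDiffOn.sum fun j _ => (ContDiffOn.sum fun k _ =>
      (contDiffOn_metricMat x₀ j k).mul (hX x₀ k)).mul (hY x₀ j)
  exact this.congr fun y hy => inner_eq_sum X Y hy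

lemma contDiffAt_christoffel {x₀ : M} {y : E3} (hy : y ∈ tgt x₀) (k i j : Fin 3) :
    ContDiffAt ℝ ∞ (christoffel x₀ k i j) y := by
  unfold christoffel
  refine contDiffAt_const.mul (ContDiffAt.sum fun l _ => (contDiffAt_metricInv hy k l).mul ?_)
  exact ((contDiffAt_pd i (contDiffAt_metricMat hy j l)).add
    (contDiffAt_pd j (contDiffAt_metricMat hy i l))).sub
      (contDiffAt_pd l (contDiffAt_metricMat hy i j))

lemma SmoothV.contDiffAt_covVecComp {X : VField M} (hX : SmoothV X) {x₀ : M} {y : E3}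
    (hy : y ∈ tgt x₀) (i k : Fin 3) : ContDiffAt ℝ ∞ (fun z => covVecComp x₀ X z i k) y :=
  (contDiffAt_pd i (hX.contDiffAt hy k)).add (ContDiffAt.sum fun j _ =>
    (contDiffAt_christoffel hy k i j).mul (hX.contDiffAt hy j))

/-- The covariant derivative `∇_Y X`. -/
def adv (X Y : VField M) : VField M := fun x => covVec X x (Y x)

lemma vecComp_adv {X : VField M} (hX : SmoothV X) (Y : VField M) {x₀ : M} {y : E3}
    (hy : y ∈ tgt x₀) (k : Fin 3) :
    vecComp x₀ (adv X Y) y k = ∑ i, vecComp x₀ Y y i * covVecComp x₀ X y i k := by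
  have h := pt_mem_src hy
  change coordCovec x₀ k (pt x₀ y) (covVec X (pt x₀ y) (Y (pt x₀ y))) = _
  conv_lhs => rw [← sum_coordCovec_smul h (Y (pt x₀ y))]
  simp only [map_sum, map_smul, smul_eq_mul]
  refine Finset.sum_congr rfl fun i _ => ?_
  rw [covVec_coordVec hX hy, coordCovec_sum_smul h]
  rfl

lemma SmoothV.adv {X Y : VField M} (hX : SmoothV X) (hY : SmoothV Y) : SmoothV (adv X Y) := by
  intro x₀ k
  have : ContDiffOn ℝ ∞ (fun y => ∑ i, vecComp x₀ Y y i * covVecComp x₀ X y i k) (tgt x₀) :=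
    ContDiffOn.sum fun i _ => (hY x₀ i).mul
      fun y hy => (hX.contDiffAt_covVecComp hy i k).contDiffWithinAt
  exact this.congr fun y hy => vecComp_adv hX Y hy k

lemma formComp_gradient {f : M → ℝ} (hf : SmoothF f) {x₀ : M} {y : E3} (hy : y ∈ tgt x₀)
    (i : Fin 3) : formComp x₀ (flat (gradient f)) y i = pd i (fun z => f (pt x₀ z)) y := by
  rw [gradient, flat_sharp, formComp, differential_coordVec hf hy]

lemma SmoothF.gradient {f : M → ℝ} (hf : SmoothF f) : SmoothV (gradient f) := by
  refine smoothV_of_formComp fun x₀ j => ?_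
  refine ContDiffOn.congr (f := fun y => pd j (fun z => f (pt x₀ z)) y) ?_
    fun y hy => formComp_gradient hf hy j
  exact fun y hy => (contDiffAt_pd j (hf.contDiffAt hy)).contDiffWithinAt

/-- The vector field `v ↦ d(flat X)(Y, v)`, raised; it is `curl X × Y`. -/
def cross (X Y : VField M) : VField M :=
  fun x => covVec X x (Y x) - ContinuousLinearMap.adjoint (covVec X x) (Y x)

lemma inner_cross (X Y : VField M) (x : M) (b : TangentSpace (𝓡 3) x) :
    inner ℝ (cross X Y x) b = rot X x (Y x) b := by
  rw [cross, inner_sub_left, ContinuousLinearMap.adjoint_inner_left, rot,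
    real_inner_comm (Y x) (covVec X x b)]

lemma formComp_cross {X : VField M} (hX : SmoothV X) (Y : VField M) {x₀ : M} {y : E3}
    (hy : y ∈ tgt x₀) (j : Fin 3) :
    formComp x₀ (flat (cross X Y)) y j =
      ∑ i, vecComp x₀ Y y i * extD1 (formComp x₀ (flat X)) y i j := by
  have h := pt_mem_src hy
  change inner ℝ (cross X Y (pt x₀ y)) (coordVec x₀ j (pt x₀ y)) = _
  rw [inner_cross, rot_eq_sum hy]
  refine Finset.sum_congr rfl fun i _ => ?_
  rw [Finset.sum_eq_single j]
  · rw [rot_coordVec hX hy, coordCovec_coordVec h]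
    simp [vecComp]
  · intro b _ hb
    simp [coordCovec_coordVec h, hb]
  · simp

lemma SmoothV.cross {X Y : VField M} (hX : SmoothV X) (hY : SmoothV Y) : SmoothV (cross X Y) := by
  refine smoothV_of_formComp fun x₀ j => ?_
  have : ContDiffOn ℝ ∞ (fun y => ∑ i, vecComp x₀ Y y i *
      extD1 (formComp x₀ (flat X)) y i j) (tgt x₀) :=
    ContDiffOn.sum fun i _ => (hY x₀ i).mul
      fun y hy => (hX.contDiffAt_extD1 hy i j).contDiffWithinAt
  exact this.congr fun y hy => formComp_cross hX Y hy j

/-- Metric compatibility: `½ d|X|² (v) = ⟨∇ᵥX, X⟩`. -/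
lemma gradient_half_normSq {X : VField M} (hX : SmoothV X) (x : M) :
    gradient (fun z => (1 / 2) * inner ℝ (X z) (X z)) x =
      ContinuousLinearMap.adjoint (covVec X x) (X x) := by
  have hf : SmoothF (fun z => (1 / 2) * inner ℝ (X z) (X z)) :=
    (SmoothF.const (1/2)).mul (hX.inner hX)
  have hx := ctr_mem_tgt x
  refine ext_inner_right ℝ fun b => ?_
  rw [ContinuousLinearMap.adjoint_inner_left, gradient, inner_sharp]
  have key : differential (fun z => (1 / 2) * inner ℝ (X z) (X z)) x =
      (innerSL ℝ (X x)).comp (covVec X x) := by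
    refine form_ext (mem_src_self x) fun i => ?_
    have h1 := differential_coordVec hf hx i
    rw [pt_ctr] at h1
    rw [h1, ContinuousLinearMap.comp_apply, innerSL_apply_apply]
    have h2 : inner ℝ (X x) (covVec X x (coordVec x i x)) =
        ∑ j, covLow x X (ctr x) i j * vecComp x X (ctr x) j := by
      have h3 := fun j => inner_covVec_coordVec hX hx i j
      rw [pt_ctr] at h3
      rw [real_inner_comm]
      conv_lhs => rw [← sum_coordCovec_smul (mem_src_self x) (X x), inner_sum]
      refine Finset.sum_congr rfl fun j _ => ?_
      rw [inner_smul_right, h3, vecComp, pt_ctr, mul_comm]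
    rw [h2]
    -- In coordinates this is half the derivative of `gⱼₖ Xʲ Xᵏ`. The part of the lowered
    -- Christoffel symbols that is antisymmetric in the two slots filled by `X` cancels, leaving `½
    -- ∂ᵢgⱼₖ`.
    have h4 : (fun z => (1 / 2) * inner ℝ (X (pt x z)) (X (pt x z))) =ᶠ[𝓝 (ctr x)]
        fun z => (1 / 2) * ∑ j, formComp x (flat X) z j * vecComp x X z j := by
      filter_upwards [tgt_mem_nhds hx] with z hz
      rw [inner_eq_sum X X hz]
      simp only [formComp_flat X hz]
    have d1 := fun j => (hX.contDiffAt_formComp hx j).differentiableAt (by simp : (∞ : WithTop ℕ∞) ≠ 0)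
    have d2 := fun j => hX.diffAt hx j
    rw [pd_congr i h4, pd_const_mul i _ (DifferentiableAt.fun_sum fun j _ => (d1 j).fun_mul (d2 j)),
      pd_sum i _ (fun j _ => (d1 j).fun_mul (d2 j))]
    simp only [pd_mul i (d1 _) (d2 _), pd_formComp_flat hX hx, formComp_flat X hx, covLow_eq X hx,
      christoffelLow]
    have m := pd_metricMat_symm x (ctr x)
    have s := metricMat_symm x (ctr x)
    simp only [Fin.sum_univ_three]
    rw [s 1 0, s 2 0, s 2 1, m i 1 0, m i 2 0, m i 2 1]
    ring
  rw [key, ContinuousLinearMap.comp_apply, innerSL_apply_apply]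

/-- `∇_X X = curl X × X + ½ ∇|X|²`. -/
lemma adv_self {X : VField M} (hX : SmoothV X) (x : M) :
    adv X X x = cross X X x + gradient (fun z => (1 / 2) * inner ℝ (X z) (X z)) x := by
  rw [gradient_half_normSq hX, adv, cross, sub_add_cancel]

end Operations

/-! ### Vector calculus: curl and divergence of gradients, curls and cross products. -/

section Identities

variable {M : Type*} [EMetricSpace M] [ChartedSpace E3 M] [IsManifold (𝓡 3) ∞ M]
variable [RiemannianBundle (fun x : M => TangentSpace (𝓡 3) x)]
variable [IsContMDiffRiemannianBundle (𝓡 3) ∞ E3 (fun x : M => TangentSpace (𝓡 3) x)]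

lemma vec_ext_ctr {x : M} {X Y : VField M}
    (h : ∀ n, vecComp x X (ctr x) n = vecComp x Y (ctr x) n) : X x = Y x := by
  refine vec_ext (mem_src_self x) fun n => ?_
  have := h n
  unfold vecComp at this
  rwa [pt_ctr] at this

lemma inner_eq_sum_ctr (X Y : VField M) (x : M) :
    inner ℝ (X x) (Y x) =
      ∑ j, vecComp x X (ctr x) j * formComp x (flat Y) (ctr x) j := by
  have h := inner_eq_sum X Y (ctr_mem_tgt x)
  rw [pt_ctr] at h
  rw [h]
  simp only [formComp_flat _ (ctr_mem_tgt x)]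
  have s := metricMat_symm x (ctr x)
  simp only [Fin.sum_univ_three]
  rw [s 1 0, s 2 0, s 2 1]
  ring

section Curl

variable {o : TangentOrientation M} (ho : IsOrientation o)

/-- The curl is additive. -/
lemma curl_add {X Y : VField M} (hX : SmoothV X) (hY : SmoothV Y) (x : M) :
    curl o (fun z => X z + Y z) x = curl o X x + curl o Y x := by
  have hx := ctr_mem_tgt x
  refine vec_ext_ctr (Y := fun x => curl o X x + curl o Y x) fun n => ?_
  have e : ∀ i j, extD1 (formComp x (flat fun z => X z + Y z)) (ctr x) i j =
      extD1 (formComp x (flat X)) (ctr x) i j + extD1 (formComp x (flat Y)) (ctr x) i j := by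
    intro i j
    have d1 := fun j => (hX.contDiffAt_formComp hx j).differentiableAt
      (by simp : (∞ : WithTop ℕ∞) ≠ 0)
    have d2 := fun j => (hY.contDiffAt_formComp hx j).differentiableAt
      (by simp : (∞ : WithTop ℕ∞) ≠ 0)
    have h : ∀ j, (fun z => formComp x (flat fun z => X z + Y z) z j) =
        fun z => formComp x (flat X) z j + formComp x (flat Y) z j := by
      intro j
      ext z
      simp [formComp, flat]
    simp only [extD1, h, pd_add _ (d1 _) (d2 _)]
    ring
  have h1 : vecComp x (fun x => curl o X x + curl o Y x) (ctr x) n =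
      vecComp x (curl o X) (ctr x) n + vecComp x (curl o Y) (ctr x) n := by
    simp [vecComp]
  rw [h1, vecComp_curl o (hX.add hY) hx, vecComp_curl o hX hx, vecComp_curl o hY hx, ← add_div]
  congr 1
  fin_cases n <;> simp [dualVec, e]

/-- The curl is homogeneous. -/
lemma curl_const_smul {X : VField M} (hX : SmoothV X) (c : ℝ) (x : M) :
    curl o (fun z => c • X z) x = c • curl o X x := by
  have hx := ctr_mem_tgt x
  refine vec_ext_ctr (Y := fun x => c • curl o X x) fun n => ?_
  have e : ∀ i j, extD1 (formComp x (flat fun z => c • X z)) (ctr x) i j =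
      c * extD1 (formComp x (flat X)) (ctr x) i j := by
    intro i j
    have d1 := fun j => (hX.contDiffAt_formComp hx j).differentiableAt
      (by simp : (∞ : WithTop ℕ∞) ≠ 0)
    have h : ∀ j, (fun z => formComp x (flat fun z => c • X z) z j) =
        fun z => c * formComp x (flat X) z j := by
      intro j
      ext z
      simp [formComp, flat]
    simp only [extD1, h, pd_const_mul _ _ (d1 _)]
    ring
  have h1 : vecComp x (fun x => c • curl o X x) (ctr x) n =
      c * vecComp x (curl o X) (ctr x) n := by
    simp [vecComp]
  rw [h1, vecComp_curl o (hX.const_smul c) hx, vecComp_curl o hX hx, ← mul_div_assoc]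
  congr 1
  fin_cases n <;> simp [dualVec, e]

/-- The curl of a gradient vanishes. -/
lemma curl_gradient {f : M → ℝ} (hf : SmoothF f) (x : M) : curl o (gradient f) x = 0 := by
  have hx := ctr_mem_tgt x
  refine vec_ext_ctr (Y := fun x => 0) fun n => ?_
  have e : ∀ i j, extD1 (formComp x (flat (gradient f))) (ctr x) i j = 0 := by
    intro i j
    have h : ∀ j, (fun z => formComp x (flat (gradient f)) z j) =ᶠ[𝓝 (ctr x)]
        pd j (fun z => f (pt x z)) := by
      intro j
      filter_upwards [tgt_mem_nhds hx] with z hz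
      exact formComp_gradient hf hz j
    rw [extD1, pd_congr _ (h j), pd_congr _ (h i), pd_comm i j (hf.contDiffAt hx), sub_self]
  rw [vecComp_curl o hf.gradient hx]
  fin_cases n <;> simp [dualVec, e, vecComp]

include ho

/-- The divergence of a curl vanishes. -/
lemma divergence_curl {X : VField M} (hX : SmoothV X) (x : M) : divergence (curl o X) x = 0 := by
  have hx := ctr_mem_tgt x
  have h := volComp_mul_divergence ho (hX.curl ho) hx
  have hv := volComp_ne_zero o hx
  -- Multiplication by the density turns the curl back into components of `d(flat X)`, so the claim
  -- is `d² = 0`: the mixed second derivatives cancel in pairs.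
  have h1 : ∀ n, (fun z => volComp o x (pt x z) 0 1 2 * vecComp x (curl o X) z n) =ᶠ[𝓝 (ctr x)]
      fun z => dualVec (extD1 (formComp x (flat X)) z) n := by
    intro n
    filter_upwards [tgt_mem_nhds hx] with z hz
    rw [vecComp_curl o hX hz, mul_div_cancel₀ _ (volComp_ne_zero o hz)]
  simp only [pd_congr _ (h1 _), Fin.sum_univ_three] at h
  have c := fun j => hX.contDiffAt_formComp hx j
  have d := fun i j => (contDiffAt_pd i (c j)).differentiableAt (by simp : (∞ : WithTop ℕ∞) ≠ 0)
  have h2 : ∀ k i j, pd k (fun z => extD1 (formComp x (flat X)) z i j) (ctr x) =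
      pd k (pd i fun z => formComp x (flat X) z j) (ctr x) -
        pd k (pd j fun z => formComp x (flat X) z i) (ctr x) :=
    fun k i j => pd_sub k (d i j) (d j i)
  have e0 : (fun z => dualVec (extD1 (formComp x (flat X)) z) 0) =
    fun z => extD1 (formComp x (flat X)) z 1 2 := rfl
  have e1 : (fun z => dualVec (extD1 (formComp x (flat X)) z) 1) =
    fun z => extD1 (formComp x (flat X)) z 2 0 := rfl
  have e2 : (fun z => dualVec (extD1 (formComp x (flat X)) z) 2) =
    fun z => extD1 (formComp x (flat X)) z 0 1 := rfl
  rw [e0, e1, e2, h2, h2, h2, pd_comm 1 0 (c 2), pd_comm 2 0 (c 1), pd_comm 2 1 (c 0)] at h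
  have h3 : volComp o x (pt x (ctr x)) 0 1 2 * divergence (curl o X) (pt x (ctr x)) = 0 := by
    rw [h]
    ring
  rw [pt_ctr] at h3 hv
  exact (mul_eq_zero.1 h3).resolve_left hv

omit ho in
lemma extD1_eq_vol_mul_curl {X : VField M} (hX : SmoothV X) {x₀ : M} {y : E3} (hy : y ∈ tgt x₀)
    (i j : Fin 3) :
    extD1 (formComp x₀ (flat X)) y i j =
      ∑ n, eps n i j * (volComp o x₀ (pt x₀ y) 0 1 2 * vecComp x₀ (curl o X) y n) := by
  have hv := volComp_ne_zero o hy
  have an := extD1_antisymm (formComp x₀ (flat X)) y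
  have b00 : extD1 (formComp x₀ (flat X)) y 0 0 = 0 := by linarith [an 0 0]
  have b11 : extD1 (formComp x₀ (flat X)) y 1 1 = 0 := by linarith [an 1 1]
  have b22 : extD1 (formComp x₀ (flat X)) y 2 2 = 0 := by linarith [an 2 2]
  simp only [vecComp_curl o hX hy, mul_div_cancel₀ _ hv, Fin.sum_univ_three, dualVec]
  have a10 := an 1 0
  have a21 := an 2 1
  have a02 := an 0 2
  fin_cases i <;> fin_cases j <;> simp [eps, b00, b11, b22, a10, a21, a02]

/-- The curl of a cross product `curl X × Y`. -/
lemma curl_cross {X Y : VField M} (hX : SmoothV X) (hY : SmoothV Y) (x : M) :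
    curl o (cross X Y) x = divergence Y x • curl o X x - divergence (curl o X) x • Y x
      + adv (curl o X) Y x - adv Y (curl o X) x := by
  have hx := ctr_mem_tgt x
  have hW := hX.curl ho
  set W := curl o X with hWdef
  set v : E3 → ℝ := fun z => volComp o x (pt x z) 0 1 2 with hvdef
  have hv : v (ctr x) ≠ 0 := volComp_ne_zero o hx
  have dv : DifferentiableAt ℝ v (ctr x) := diffAt_volComp ho hx
  have dW := fun n => hW.diffAt hx n
  have dY := fun n => hY.diffAt hx n
  refine vec_ext_ctr (Y := fun x => divergence Y x • W x - divergence W x • Y x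
      + adv W Y x - adv Y W x) fun n => ?_
  have hdY := volComp_mul_divergence ho hY hx
  have hdW := volComp_mul_divergence ho hW hx
  rw [pt_ctr] at hdY hdW
  have hv1 : volComp o x x 0 1 2 = v (ctr x) := by rw [hvdef]; simp only [pt_ctr]
  rw [hv1] at hdY hdW
  have p : ∀ i n, pd i (fun z => v z * vecComp x Y z n) (ctr x) =
      pd i v (ctr x) * vecComp x Y (ctr x) n + v (ctr x) * pd i (fun z => vecComp x Y z n) (ctr x) :=
    fun i n => pd_mul i dv (dY n)
  have p' : ∀ i n, pd i (fun z => v z * vecComp x W z n) (ctr x) =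
      pd i v (ctr x) * vecComp x W (ctr x) n + v (ctr x) * pd i (fun z => vecComp x W z n) (ctr x) :=
    fun i n => pd_mul i dv (dW n)
  have rhs : vecComp x (fun x => divergence Y x • W x - divergence W x • Y x
      + adv W Y x - adv Y W x) (ctr x) n = divergence Y x * vecComp x W (ctr x) n -
      divergence W x * vecComp x Y (ctr x) n + ∑ i, vecComp x Y (ctr x) i * covVecComp x W (ctr x) i n
      - ∑ i, vecComp x W (ctr x) i * covVecComp x Y (ctr x) i n := by
    rw [← vecComp_adv hW Y hx, ← vecComp_adv hY W hx]
    simp [vecComp, pt_ctr]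
  -- The symmetric Christoffel symbols cancel in `∇_Y W - ∇_W Y`, which leaves the Lie bracket of
  -- the components.
  have adv_sub : ∑ i, vecComp x Y (ctr x) i * covVecComp x W (ctr x) i n
      - ∑ i, vecComp x W (ctr x) i * covVecComp x Y (ctr x) i n =
      ∑ i, (vecComp x Y (ctr x) i * pd i (fun z => vecComp x W z n) (ctr x) -
        vecComp x W (ctr x) i * pd i (fun z => vecComp x Y z n) (ctr x)) := by
    have c := fun i j => christoffel_symm x (ctr x) n i j
    simp only [covVecComp, Fin.sum_univ_three]
    rw [c 1 0, c 2 0, c 2 1]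
    ring
  rw [rhs, add_sub_assoc, adv_sub, vecComp_curl o (hX.cross hY) hx, div_eq_iff hv]
  -- The form is written with the product `v W` kept together, since `v div Y` and `v div W` are
  -- divergences of `v Y` and `v W`. After clearing `v`, both sides are polynomials in `v`, `W`, `Y`
  -- and their first derivatives.
  have e : ∀ j, (fun z => formComp x (flat (cross X Y)) z j) =ᶠ[𝓝 (ctr x)]
      fun z => ∑ i, vecComp x Y z i * ∑ n, eps n i j * (v z * vecComp x W z n) := by
    intro j
    filter_upwards [tgt_mem_nhds hx] with z hz
    rw [formComp_cross hX Y hz]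
    simp only [extD1_eq_vol_mul_curl (o := o) hX hz]
    rfl
  have d : ∀ i j, DifferentiableAt ℝ (fun z => ∑ n, eps n i j * (v z * vecComp x W z n)) (ctr x) :=
    fun i j => DifferentiableAt.fun_sum fun n _ => (dv.fun_mul (dW n)).const_mul _
  have hpd : ∀ k j, pd k (fun z => formComp x (flat (cross X Y)) z j) (ctr x) =
      ∑ i, (pd k (fun z => vecComp x Y z i) (ctr x) * ∑ n, eps n i j *
        (v (ctr x) * vecComp x W (ctr x) n) + vecComp x Y (ctr x) i * ∑ n, eps n i j *
        (pd k v (ctr x) * vecComp x W (ctr x) n +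
          v (ctr x) * pd k (fun z => vecComp x W z n) (ctr x))) := by
    intro k j
    rw [pd_congr k (e j), pd_sum k _ (fun i _ => (dY i).fun_mul (d i j))]
    refine Finset.sum_congr rfl fun i _ => ?_
    rw [pd_mul k (dY i) (d i j), pd_sum k _ (fun n _ => (dv.fun_mul (dW n)).const_mul _)]
    congr 2
    refine Finset.sum_congr rfl fun n _ => ?_
    rw [pd_const_mul k _ (dv.fun_mul (dW n)), p']
  have hR : (divergence Y x * vecComp x W (ctr x) n - divergence W x * vecComp x Y (ctr x) n +
      ∑ i, (vecComp x Y (ctr x) i * pd i (fun z => vecComp x W z n) (ctr x) -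
        vecComp x W (ctr x) i * pd i (fun z => vecComp x Y z n) (ctr x))) * v (ctr x) =
      (v (ctr x) * divergence Y x) * vecComp x W (ctr x) n -
      (v (ctr x) * divergence W x) * vecComp x Y (ctr x) n +
      v (ctr x) * ∑ i, (vecComp x Y (ctr x) i * pd i (fun z => vecComp x W z n) (ctr x) -
        vecComp x W (ctr x) i * pd i (fun z => vecComp x Y z n) (ctr x)) := by ring
  change _ = (divergence Y x * vecComp x W (ctr x) n - divergence W x * vecComp x Y (ctr x) n +
      ∑ i, (vecComp x Y (ctr x) i * pd i (fun z => vecComp x W z n) (ctr x) -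
        vecComp x W (ctr x) i * pd i (fun z => vecComp x Y z n) (ctr x))) * v (ctr x)
  rw [hR, hdY, hdW]
  change _ = (∑ i, pd i (fun z => v z * vecComp x Y z i) (ctr x)) * vecComp x W (ctr x) n -
      (∑ i, pd i (fun z => v z * vecComp x W z i) (ctr x)) * vecComp x Y (ctr x) n + _
  simp only [p, p']
  fin_cases n <;>
  · simp [dualVec, extD1, hpd, Fin.sum_univ_three, eps]
    ring

/-- The divergence of a cross product `curl X × Y`. -/
lemma divergence_cross {X Y : VField M} (hX : SmoothV X) (hY : SmoothV Y) (x : M) :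
    divergence (cross X Y) x =
      inner ℝ (curl o (curl o X) x) (Y x) - inner ℝ (curl o Y x) (curl o X x) := by
  have hx := ctr_mem_tgt x
  have hW := hX.curl ho
  set W := curl o X with hWdef
  set v : E3 → ℝ := fun z => volComp o x (pt x z) 0 1 2 with hvdef
  have hv : v (ctr x) ≠ 0 := volComp_ne_zero o hx
  set a : Fin 3 → E3 → ℝ := fun n z => formComp x (flat W) z n with ha
  set b : Fin 3 → E3 → ℝ := fun n z => formComp x (flat Y) z n with hb
  have da : ∀ n, DifferentiableAt ℝ (a n) (ctr x) := fun n =>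
    (hW.contDiffAt_formComp hx n).differentiableAt (by simp)
  have db : ∀ n, DifferentiableAt ℝ (b n) (ctr x) := fun n =>
    (hY.contDiffAt_formComp hx n).differentiableAt (by simp)
  -- Times the density, the cross product has components `εᵢⱼₙ aᵢ bⱼ` in terms of covariant
  -- components, so its divergence involves no derivative of the metric.
  have key : ∀ n, (fun z => v z * vecComp x (cross X Y) z n) =ᶠ[𝓝 (ctr x)]
      fun z => ∑ i, ∑ j, eps i j n * (a i z * b j z) := by
    intro n
    filter_upwards [tgt_mem_nhds hx] with z hz
    have hvz := volComp_ne_zero o hz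
    have hg := eq_det_mul_adjugate (metricMat_mul_metricInv hz)
    rw [← sum_metricInv_formComp (cross X Y) hz]
    simp only [formComp_cross hX Y hz, extD1_eq_vol_mul_curl (o := o) hX hz, ha, hb]
    have hW1 := fun i => (sum_metricInv_formComp W hz i).symm
    have hY1 := fun i => (sum_metricInv_formComp Y hz i).symm
    simp only [← hWdef, hW1, hY1]
    have hdet : (metricInv x z).det * volComp o x (pt x z) 0 1 2 ^ 2 = 1 := by
      rw [volComp_sq, ← Matrix.det_mul, metricInv_mul_metricMat hz, Matrix.det_one]
    have s := metricInv_symm x z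
    rw [Matrix.det_fin_three, s 1 0, s 2 0, s 2 1] at hdet
    generalize formComp x (flat W) z = A
    generalize formComp x (flat Y) z = B
    have lhs : v z * ∑ l, metricInv x z n l * ∑ i, (∑ m, metricInv x z i m * B m) *
        ∑ k, eps k i l * (volComp o x (pt x z) 0 1 2 * ∑ m, metricInv x z k m * A m) =
        volComp o x (pt x z) 0 1 2 ^ 2 * ∑ l, metricInv x z n l * ∑ i, (∑ m, metricInv x z i m * B m) *
        ∑ k, eps k i l * (∑ m, metricInv x z k m * A m) := by
      simp only [hvdef, Finset.mul_sum]
      refine Finset.sum_congr rfl fun l _ => Finset.sum_congr rfl fun i _ =>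
        Finset.sum_congr rfl fun k _ => Finset.sum_congr rfl fun m _ => ?_
      ring
    rw [lhs]
    -- The factor `1` is replaced by `v² det(g⁻¹)`; both sides then become the same polynomial in
    -- the inverse metric.
    have rhs : ∑ i, ∑ j, eps i j n * (A i * B j) = (∑ i, ∑ j, eps i j n * (A i * B j)) * 1 := by
      rw [mul_one]
    rw [rhs, ← hdet]
    fin_cases n <;>
    · simp [Fin.sum_univ_three, eps, s 1 0, s 2 0, s 2 1]
      ring
  have hdiv := volComp_mul_divergence ho (hX.cross hY) hx
  change v (ctr x) * divergence (cross X Y) (pt x (ctr x)) =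
    ∑ n, pd n (fun z => v z * vecComp x (cross X Y) z n) (ctr x) at hdiv
  have hpd : ∀ n, pd n (fun z => v z * vecComp x (cross X Y) z n) (ctr x) =
      ∑ i, ∑ j, eps i j n * (pd n (a i) (ctr x) * b j (ctr x) + a i (ctr x) * pd n (b j) (ctr x)) := by
    intro n
    rw [pd_congr n (key n), pd_sum n _ (fun i _ => DifferentiableAt.fun_sum fun j _ =>
      ((da i).fun_mul (db j)).const_mul _)]
    refine Finset.sum_congr rfl fun i _ => ?_
    rw [pd_sum n _ (fun j _ => ((da i).fun_mul (db j)).const_mul _)]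
    refine Finset.sum_congr rfl fun j _ => ?_
    rw [pd_const_mul n _ ((da i).fun_mul (db j)), pd_mul n (da i) (db j)]
  simp only [hpd, pt_ctr] at hdiv
  have hc : ∀ {Z : VField M}, SmoothV Z → ∀ n, v (ctr x) * vecComp x (curl o Z) (ctr x) n =
      dualVec (extD1 (formComp x (flat Z)) (ctr x)) n := by
    intro Z hZ n
    rw [vecComp_curl o hZ hx, mul_div_cancel₀ _ (volComp_ne_zero o hx)]
  apply mul_left_cancel₀ hv
  rw [hdiv, inner_eq_sum_ctr, inner_eq_sum_ctr, mul_sub, Finset.mul_sum, Finset.mul_sum]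
  simp only [← mul_assoc, hc hW, hc hY]
  simp only [Fin.sum_univ_three, dualVec, extD1, eps, ha, hb, Matrix.cons_val_zero,
    Matrix.cons_val_one, Matrix.cons_val]
  ring

end Curl

end Identities

/-! ### Bochner's formula for the vorticity. -/

section Bochner

variable {M : Type*} [EMetricSpace M] [ChartedSpace E3 M] [IsManifold (𝓡 3) ∞ M]
variable [RiemannianBundle (fun x : M => TangentSpace (𝓡 3) x)]
variable [IsContMDiffRiemannianBundle (𝓡 3) ∞ E3 (fun x : M => TangentSpace (𝓡 3) x)]

lemma divergence_add {X Y : VField M} (hX : SmoothV X) (hY : SmoothV Y) (x : M) :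
    divergence (fun z => X z + Y z) x = divergence X x + divergence Y x := by
  have hx := ctr_mem_tgt x
  simp only [divergence, covVecComp]
  have h : ∀ i, pd i (fun z => vecComp x (fun z => X z + Y z) z i) (ctr x) =
      pd i (fun z => vecComp x X z i) (ctr x) + pd i (fun z => vecComp x Y z i) (ctr x) := by
    intro i
    rw [← pd_add i (hX.diffAt hx i) (hY.diffAt hx i)]
    simp [vecComp]
  have h' : ∀ j, vecComp x (fun z => X z + Y z) (ctr x) j =
      vecComp x X (ctr x) j + vecComp x Y (ctr x) j := by simp [vecComp]
  simp only [h, h', mul_add, Finset.sum_add_distrib]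
  ring

lemma divergence_smul {f : M → ℝ} {X : VField M} (hf : SmoothF f) (hX : SmoothV X) (x : M) :
    divergence (fun z => f z • X z) x = f x * divergence X x + inner ℝ (gradient f x) (X x) := by
  have hx := ctr_mem_tgt x
  have df : DifferentiableAt ℝ (fun z => f (pt x z)) (ctr x) :=
    (hf.contDiffAt hx).differentiableAt (by simp)
  have h0 : inner ℝ (gradient f x) (X x) =
      ∑ i, vecComp x X (ctr x) i * pd i (fun z => f (pt x z)) (ctr x) := by
    rw [real_inner_comm, inner_eq_sum_ctr]
    simp only [formComp_gradient hf hx]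
  simp only [divergence, covVecComp]
  have h : ∀ i, pd i (fun z => vecComp x (fun z => f z • X z) z i) (ctr x) =
      pd i (fun z => f (pt x z)) (ctr x) * vecComp x X (ctr x) i +
      f x * pd i (fun z => vecComp x X z i) (ctr x) := by
    intro i
    have := pd_mul i df (hX.diffAt hx i)
    rw [pt_ctr] at this
    rw [← this]
    simp [vecComp]
  have h' : ∀ j, vecComp x (fun z => f z • X z) (ctr x) j = f x * vecComp x X (ctr x) j := by
    intro j
    have : f x = f (pt x (ctr x)) := by rw [pt_ctr]
    rw [this]
    simp [vecComp]
  rw [h0]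
  simp only [h, h', Fin.sum_univ_three]
  ring

lemma gradient_const (c : ℝ) (x : M) : gradient (fun _ : M => c) x = 0 := by
  have : differential (fun _ : M => c) x = 0 := by
    simp [differential, extD0, pd_const]
  simp [gradient, sharp, this]

lemma divergence_const_smul (c : ℝ) {X : VField M} (hX : SmoothV X) (x : M) :
    divergence (fun z => c • X z) x = c * divergence X x := by
  rw [divergence_smul (SmoothF.const c) hX, gradient_const, inner_zero_left, add_zero]

lemma divergence_sub {X Y : VField M} (hX : SmoothV X) (hY : SmoothV Y) (x : M) :
    divergence (fun z => X z - Y z) x = divergence X x - divergence Y x := by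
  have h := divergence_add hX (hY.const_smul (-1)) x
  rw [divergence_const_smul _ hY] at h
  simp only [neg_smul, one_smul, ← sub_eq_add_neg] at h
  rw [h]
  ring

/-- The trace of `(∇X)²`. -/
def traceSq (X : VField M) (x : M) : ℝ :=
  ∑ i, ∑ k, covVecComp x X (ctr x) i k * covVecComp x X (ctr x) k i

lemma pd_covVecComp {X : VField M} (hX : SmoothV X) {x₀ : M} {y : E3} (hy : y ∈ tgt x₀)
    (m i k : Fin 3) :
    pd m (fun z => covVecComp x₀ X z i k) y = pd m (pd i fun z => vecComp x₀ X z k) y +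
      ∑ j, (pd m (christoffel x₀ k i j) y * vecComp x₀ X y j +
        christoffel x₀ k i j y * pd m (fun z => vecComp x₀ X z j) y) := by
  have d1 : DifferentiableAt ℝ (pd i fun z => vecComp x₀ X z k) y :=
    (contDiffAt_pd i (hX.contDiffAt hy k)).differentiableAt (by simp)
  have d2 : ∀ j, DifferentiableAt ℝ (christoffel x₀ k i j) y := fun j =>
    (contDiffAt_christoffel hy k i j).differentiableAt (by simp)
  have d3 := fun j => hX.diffAt hy j
  unfold covVecComp
  rw [pd_add m d1 (DifferentiableAt.fun_sum fun j _ => (d2 j).fun_mul (d3 j)),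
    pd_sum m _ (fun j _ => (d2 j).fun_mul (d3 j))]
  simp only [pd_mul m (d2 _) (d3 _)]

/-- Bochner's formula for `div ∇_W W` when `div W = 0`. -/
lemma divergence_adv_self {W : VField M} (hW : SmoothV W) (hdiv : ∀ x, divergence W x = 0) (x : M) :
    divergence (adv W W) x = traceSq W x + ∑ i, ∑ j, ricciComp x (ctr x) i j *
      vecComp x W (ctr x) i * vecComp x W (ctr x) j := by
  have hx := ctr_mem_tgt x
  -- The divergence vanishes near `x`, hence so do its first derivatives. This removes the term `Wⁱ
  -- ∂ᵢ(div W)` that appears when covariant derivatives are commuted.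
  have h0 : ∀ i, ∑ k, pd i (fun z => covVecComp x W z k k) (ctr x) = 0 := by
    intro i
    have d : ∀ k, DifferentiableAt ℝ (fun z => covVecComp x W z k k) (ctr x) := fun k =>
      (hW.contDiffAt_covVecComp hx k k).differentiableAt (by simp)
    rw [← pd_sum i _ (fun k _ => d k), pd_congr i (g := fun _ => 0), pd_const]
    filter_upwards [tgt_mem_nhds hx] with z hz
    rw [← divergence_eq hW hz, hdiv]
  have d1 := fun i => hW.diffAt hx i
  have d2 : ∀ i k, DifferentiableAt ℝ (fun z => covVecComp x W z i k) (ctr x) := fun i k =>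
    (hW.contDiffAt_covVecComp hx i k).differentiableAt (by simp)
  have h1 : ∀ k, pd k (fun z => vecComp x (adv W W) z k) (ctr x) =
      ∑ i, (pd k (fun z => vecComp x W z i) (ctr x) * covVecComp x W (ctr x) i k +
        vecComp x W (ctr x) i * pd k (fun z => covVecComp x W z i k) (ctr x)) := by
    intro k
    have : (fun z => vecComp x (adv W W) z k) =ᶠ[𝓝 (ctr x)]
        fun z => ∑ i, vecComp x W z i * covVecComp x W z i k := by
      filter_upwards [tgt_mem_nhds hx] with z hz
      exact vecComp_adv hW W hz k
    rw [pd_congr k this, pd_sum k _ (fun i _ => (d1 i).fun_mul (d2 i k))]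
    simp only [pd_mul k (d1 _) (d2 _ k)]
  have h2 : divergence (adv W W) x = ∑ k, (∑ i, (pd k (fun z => vecComp x W z i) (ctr x) *
      covVecComp x W (ctr x) i k +
        vecComp x W (ctr x) i * pd k (fun z => covVecComp x W z i k) (ctr x)) +
      ∑ j, christoffel x k k j (ctr x) * ∑ i, vecComp x W (ctr x) i * covVecComp x W (ctr x) i j) := by
    rw [divergence]
    refine Finset.sum_congr rfl fun k _ => ?_
    rw [covVecComp, h1]
    congr 1
    exact Finset.sum_congr rfl fun j _ => by rw [vecComp_adv hW W hx]
  rw [h2, traceSq]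
  simp only [pd_covVecComp hW hx] at h0 ⊢
  have c := christoffel_symm x (ctr x)
  have c' : ∀ m k i j, pd m (christoffel x k i j) (ctr x) = pd m (christoffel x k j i) (ctr x) := by
    intro m k i j
    congr 1
    ext z
    exact christoffel_symm x z k i j
  have s2 : ∀ m i k, pd m (pd i fun z => vecComp x W z k) (ctr x) =
      pd i (pd m fun z => vecComp x W z k) (ctr x) := fun m i k => pd_comm m i (hW.contDiffAt hx k)
  simp only [covVecComp, ricciComp]
  have hsum : ∑ i, vecComp x W (ctr x) i * ∑ k, (pd i (pd k fun z => vecComp x W z k) (ctr x) +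
      ∑ j, (pd i (christoffel x k k j) (ctr x) * vecComp x W (ctr x) j +
        christoffel x k k j (ctr x) * pd i (fun z => vecComp x W z j) (ctr x))) = 0 := by
    simp only [h0, mul_zero, Finset.sum_const_zero]
  -- Components, Christoffel symbols and their derivatives become free variables, reduced to a
  -- normal form by the symmetry of the lower indices and of second derivatives. Commuting the
  -- derivatives is then a polynomial identity modulo `hsum`.
  generalize hw : vecComp x W (ctr x) = w at *
  generalize hDW : (fun m k => pd m (fun z => vecComp x W z k) (ctr x)) = DW at *
  generalize hD2 : (fun m i k => pd m (pd i fun z => vecComp x W z k) (ctr x)) = D2 at *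
  generalize hG : (fun k i j => christoffel x k i j (ctr x)) = G at *
  generalize hdG : (fun m k i j => pd m (christoffel x k i j) (ctr x)) = dG at *
  have eDW : ∀ m k, pd m (fun z => vecComp x W z k) (ctr x) = DW m k := fun m k => by rw [← hDW]
  have eD2 : ∀ m i k, pd m (pd i fun z => vecComp x W z k) (ctr x) = D2 m i k := fun m i k => by
    rw [← hD2]
  have eG : ∀ k i j, christoffel x k i j (ctr x) = G k i j := fun k i j => by rw [← hG]
  have edG : ∀ m k i j, pd m (christoffel x k i j) (ctr x) = dG m k i j := fun m k i j => by
    rw [← hdG]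
  simp only [eDW, eD2, eG, edG] at *
  have g10 := fun k => c k 1 0
  have g20 := fun k => c k 2 0
  have g21 := fun k => c k 2 1
  have dg10 := fun m k => c' m k 1 0
  have dg20 := fun m k => c' m k 2 0
  have dg21 := fun m k => c' m k 2 1
  have t10 := fun k => s2 1 0 k
  have t20 := fun k => s2 2 0 k
  have t21 := fun k => s2 2 1 k
  clear c c' s2 h0 h1 h2
  simp only [Fin.sum_univ_three, g10, g20, g21, dg10, dg20, dg21, t10, t20, t21] at hsum ⊢
  linear_combination hsum

lemma covFormNormSq_eq {X : VField M} (hX : SmoothV X) {x₀ : M} {y : E3} (hy : y ∈ tgt x₀) :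
    covFormNormSq (flat X) (pt x₀ y) = ∑ i, ∑ j, metricInv x₀ y i j *
      ∑ k, ∑ l, metricMat x₀ y k l * covVecComp x₀ X y i k * covVecComp x₀ X y j l := by
  have h := sum_onb_eq hy (stdOrthonormalBasis ℝ (TangentSpace (𝓡 3) (pt x₀ y)))
    (LinearMap.mk₂ ℝ (fun a b => inner ℝ (covVec X (pt x₀ y) a) (covVec X (pt x₀ y) b))
    (by intros; simp [inner_add_left]) (by intros; simp [inner_smul_left])
    (by intros; simp [inner_add_right]) (by intros; simp [inner_smul_right]))
  simp only [LinearMap.mk₂_apply, real_inner_self_eq_norm_sq] at h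
  simp only [covFormNormSq, norm_covForm_flat hX]
  rw [h]
  refine Finset.sum_congr rfl fun i _ => Finset.sum_congr rfl fun j _ => ?_
  congr 1
  rw [covVec_coordVec hX hy, covVec_coordVec hX hy, sum_inner]
  refine Finset.sum_congr rfl fun k _ => ?_
  rw [inner_sum]
  refine Finset.sum_congr rfl fun l _ => ?_
  rw [inner_smul_left, inner_smul_right, metricMat]
  simp
  ring

/-- Here `b` stands for `∇X` with both indices lowered. The identity is `½|b - bᵀ|² = |b|² - tr b²`,
its left side being the squared length of the dual vector. -/
lemma curl_norm_algebra {g h : Matrix (Fin 3) (Fin 3) ℝ} (hgh : g * h = 1)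
    (hs : ∀ i j, h i j = h j i) {v : ℝ} (hv : v ≠ 0) (hdet : v ^ 2 = g.det)
    (b : Fin 3 → Fin 3 → ℝ) :
    ∑ j, ∑ k, g j k * (dualVec (fun i j => b i j - b j i) k / v) *
        (dualVec (fun i j => b i j - b j i) j / v) =
      ∑ i, ∑ j, h i j * ∑ k, (∑ m, h k m * b i m) * b j k
        - ∑ i, ∑ k, (∑ m, h k m * b i m) * (∑ m, h i m * b k m) := by
  have e : ∀ j k, g j k * (dualVec (fun i j => b i j - b j i) k / v) *
        (dualVec (fun i j => b i j - b j i) j / v) = h.adjugate j k *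
        dualVec (fun i j => b i j - b j i) k * dualVec (fun i j => b i j - b j i) j := by
    intro j k
    rw [eq_det_mul_adjugate hgh, ← hdet]
    field_simp
  simp only [e]
  simp only [Matrix.adjugate_fin_three, dualVec]
  have s10 := hs 1 0
  have s21 := hs 2 1
  have s20 := hs 2 0
  simp [Fin.sum_univ_three, s10, s21, s20]
  ring

/-- `|curl X|² = |∇X|² - tr (∇X)²`. -/
lemma norm_curl_sq (o : TangentOrientation M) {X : VField M} (hX : SmoothV X) (x : M) :
    inner ℝ (curl o X x) (curl o X x) = covFormNormSq (flat X) x - traceSq X x := by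
  have hx := ctr_mem_tgt x
  have h1 := inner_eq_sum (curl o X) (curl o X) hx
  have h2 := covFormNormSq_eq hX hx
  rw [pt_ctr] at h1 h2
  rw [h1, h2, traceSq]
  have key := curl_norm_algebra (metricMat_mul_metricInv hx) (metricInv_symm x (ctr x))
    (volComp_ne_zero o hx) (volComp_sq o x (ctr x)) (covLow x X (ctr x))
  have e1 : extD1 (formComp x (flat X)) (ctr x) =
      fun i j => covLow x X (ctr x) i j - covLow x X (ctr x) j i := by
    ext i j
    exact extD1_flat hX hx i j
  simp only [vecComp_curl o hX hx, e1, Finset.sum_mul]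
  rw [key]
  simp only [sum_metricInv_covLow X hx]
  congr 1
  refine Finset.sum_congr rfl fun i _ => Finset.sum_congr rfl fun j _ => ?_
  congr 1
  rw [Finset.sum_comm]
  simp only [covLow, Finset.mul_sum]
  rw [Finset.sum_comm]
  refine Finset.sum_congr rfl fun k _ => Finset.sum_congr rfl fun l _ => ?_
  rw [metricMat_symm x (ctr x) l k]
  ring

lemma formInner_formAct (X : VField M)
    (T : ∀ x : M, TangentSpace (𝓡 3) x →L[ℝ] TangentSpace (𝓡 3) x) (x : M) :
    formInner (formAct (flat X) T) (flat X) x = inner ℝ (X x) (T x (X x)) := by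
  rw [formInner, inner_sharp, sharp_flat]
  rfl

lemma formInner_ricci (X : VField M) (x : M) :
    formInner (formAct (flat X) ricci) (flat X) x = ∑ i, ∑ j, ricciComp x (ctr x) i j *
      vecComp x X (ctr x) i * vecComp x X (ctr x) j := by
  rw [formInner_formAct]
  have h1 : ∀ k, inner ℝ (X x) (coordVec x k x) = formComp x (flat X) (ctr x) k := by
    intro k
    change _ = inner ℝ (X (pt x (ctr x))) (coordVec x k (pt x (ctr x)))
    rw [pt_ctr]
  have h2 : ∀ i, coordCovec x i x (X x) = vecComp x X (ctr x) i := by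
    intro i
    rw [vecComp, pt_ctr]
  simp only [ricci, sum_apply, smul_apply,
    ContinuousLinearMap.smulRight_apply, inner_sum, inner_smul_right, h1, h2]
  have h3 := sum_metricInv_formComp X (ctr_mem_tgt x)
  have s := metricInv_symm x (ctr x)
  have h4 : ∀ i j, ricciComp x (ctr x) i j * vecComp x X (ctr x) i * vecComp x X (ctr x) j =
      ricciComp x (ctr x) i j * vecComp x X (ctr x) j *
        ∑ l, metricInv x (ctr x) i l * formComp x (flat X) (ctr x) l := by
    intro i j
    rw [h3]
    ring
  simp only [h4, Fin.sum_univ_three]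
  rw [s 1 0, s 2 0, s 2 1]
  ring

/-- The antisymmetric part of `∇Y` does not contribute to the quadratic form, so the stretching term
of the vorticity equation is the strain term. -/
lemma formInner_strain (X Y : VField M) (x : M) :
    formInner (formAct (flat X) (strain Y)) (flat X) x = inner ℝ (adv Y X x) (X x) := by
  rw [formInner_formAct, strain, adv]
  simp only [smul_apply, add_apply, inner_smul_right,
    inner_add_right, ContinuousLinearMap.adjoint_inner_right]
  rw [real_inner_comm (covVec Y x (X x)) (X x)]
  ring

variable {o : TangentOrientation M} (ho : IsOrientation o)
include ho

/-- The Bochner formula for the vorticity. -/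
lemma bochner {X : VField M} (hX : SmoothV X) (x : M) :
    divergence (gradient fun z => (1 / 2) * inner ℝ (curl o X z) (curl o X z)) x =
      covFormNormSq (flat (curl o X)) x
      + formInner (formAct (flat (curl o X)) ricci) (flat (curl o X)) x
      - inner ℝ (curl o (curl o (curl o X)) x) (curl o X x) := by
  have hW := hX.curl ho
  set W := curl o X with hWdef
  have hf : SmoothF fun z => (1 / 2) * inner ℝ (W z) (W z) :=
    (SmoothF.const (1/2)).mul (hW.inner hW)
  -- The divergence is taken of `½∇|W|² = ∇_W W - curl W × W`. The trace of `(∇W)²` from the first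
  -- term cancels against the one in `|curl W|² = |∇W|² - tr(∇W)²` from the second.
  have h1 := divergence_sub (hW.adv hW) (hW.cross hW) x
  have h2 : (fun z => adv W W z - cross W W z) =
      gradient fun z => (1 / 2) * inner ℝ (W z) (W z) := by
    ext1 z
    rw [adv_self hW]
    exact add_sub_cancel_left _ _
  rw [h2] at h1
  rw [h1, divergence_adv_self hW (divergence_curl ho hX), divergence_cross ho hW hW,
    norm_curl_sq o hW, formInner_ricci]
  ring

end Bochner

/-! ### Calculus on a time interval times an open set of coordinates. -/

section TimeCalculus

variable {J : Set ℝ} {U : Set E3} {F : ℝ → E3 → ℝ}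

/-- Nonempty interior makes derivatives within `J` unique, at endpoints as well. -/
lemma convex_of_ordConnected_nontrivial (hJ : J.OrdConnected) (hJ' : J.Nontrivial) :
    Convex ℝ J ∧ (interior J).Nonempty := by
  refine ⟨hJ.convex, ?_⟩
  obtain ⟨a, ha, b, hb, hab⟩ := hJ'.exists_lt
  have : Ioo a b ⊆ interior J :=
    interior_maximal (Ioo_subset_Icc_self.trans (hJ.out ha hb)) isOpen_Ioo
  exact (nonempty_Ioo.2 hab).mono this

variable (hJ : Convex ℝ J ∧ (interior J).Nonempty) (hU : IsOpen U)
include hJ hU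

lemma uniqueDiffOn_time : UniqueDiffOn ℝ J := uniqueDiffOn_convex hJ.1 hJ.2

lemma uniqueDiffOn_cylinder : UniqueDiffOn ℝ (J ×ˢ U) :=
  (uniqueDiffOn_convex hJ.1 hJ.2).prod hU.uniqueDiffOn

/-- At an endpoint of `J` the point lies on the boundary of the cylinder. There the second
derivative within the set is symmetric because the point is a limit of interior points. -/
lemma cylinder_subset_closure_interior : J ×ˢ U ⊆ closure (interior (J ×ˢ U)) := by
  rw [interior_prod_eq, closure_prod_eq, hU.interior_eq]
  refine prod_mono ?_ subset_closure
  rw [hJ.1.closure_interior_eq_closure_of_nonempty_interior hJ.2]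
  exact subset_closure

variable (hF : ContDiffOn ℝ ∞ (fun z : ℝ × E3 => F z.1 z.2) (J ×ˢ U))
include hF

lemma hasFDerivWithinAt_cylinder {t : ℝ} {y : E3} (ht : t ∈ J) (hy : y ∈ U) :
    HasFDerivWithinAt (fun z : ℝ × E3 => F z.1 z.2)
      (fderivWithin ℝ (fun z : ℝ × E3 => F z.1 z.2) (J ×ˢ U) (t, y)) (J ×ˢ U) (t, y) :=
  ((hF (t, y) ⟨ht, hy⟩).differentiableWithinAt (by simp)).hasFDerivWithinAt

lemma hasFDerivAt_space {t : ℝ} {y : E3} (ht : t ∈ J) (hy : y ∈ U) :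
    HasFDerivAt (F t) ((fderivWithin ℝ (fun z : ℝ × E3 => F z.1 z.2) (J ×ˢ U) (t, y)).comp
      (ContinuousLinearMap.inr ℝ ℝ E3)) y := by
  have h1 : HasFDerivAt (fun y : E3 => (t, y)) (ContinuousLinearMap.inr ℝ ℝ E3) y :=
    hasFDerivAt_prodMk_right t y
  have h2 := (hasFDerivWithinAt_cylinder hJ hU hF ht hy).comp y (h1.hasFDerivWithinAt (s := U))
    (fun z hz => mk_mem_prod ht hz)
  exact h2.hasFDerivAt (hU.mem_nhds hy)

lemma pd_eq_fderivWithin (i : Fin 3) {t : ℝ} {y : E3} (ht : t ∈ J) (hy : y ∈ U) :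
    pd i (F t) y = fderivWithin ℝ (fun z : ℝ × E3 => F z.1 z.2) (J ×ˢ U) (t, y)
      (0, EuclideanSpace.single i 1) := by
  rw [pd, (hasFDerivAt_space hJ hU hF ht hy).fderiv]
  rfl

lemma hasDerivWithinAt_time {t : ℝ} {y : E3} (ht : t ∈ J) (hy : y ∈ U) :
    HasDerivWithinAt (fun s => F s y)
      (fderivWithin ℝ (fun z : ℝ × E3 => F z.1 z.2) (J ×ˢ U) (t, y) (1, 0)) J t := by
  have h1 : HasFDerivAt (fun s : ℝ => (s, y)) (ContinuousLinearMap.inl ℝ ℝ E3) t :=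
    hasFDerivAt_prodMk_left t y
  have h2 := (hasFDerivWithinAt_cylinder hJ hU hF ht hy).comp t (h1.hasFDerivWithinAt (s := J))
    (fun z hz => mk_mem_prod hz hy)
  exact h2.hasDerivWithinAt

lemma derivWithin_eq_fderivWithin {t : ℝ} {y : E3} (ht : t ∈ J) (hy : y ∈ U) :
    derivWithin (fun s => F s y) J t =
      fderivWithin ℝ (fun z : ℝ × E3 => F z.1 z.2) (J ×ˢ U) (t, y) (1, 0) :=
  (hasDerivWithinAt_time hJ hU hF ht hy).derivWithin (uniqueDiffOn_time hJ hU t ht)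

lemma contDiffOn_fderivWithin_cylinder :
    ContDiffOn ℝ ∞ (fderivWithin ℝ (fun z : ℝ × E3 => F z.1 z.2) (J ×ˢ U)) (J ×ˢ U) :=
  hF.fderivWithin (uniqueDiffOn_cylinder hJ hU) (by simp)

lemma contDiffOn_pd_cylinder (i : Fin 3) :
    ContDiffOn ℝ ∞ (fun z : ℝ × E3 => pd i (F z.1) z.2) (J ×ˢ U) := by
  refine ((contDiffOn_fderivWithin_cylinder hJ hU hF).clm_apply
    (contDiffOn_const (c := ((0 : ℝ), EuclideanSpace.single i (1 : ℝ))))).congr fun z hz => ?_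
  exact pd_eq_fderivWithin hJ hU hF i hz.1 hz.2

lemma contDiffOn_derivWithin_cylinder :
    ContDiffOn ℝ ∞ (fun z : ℝ × E3 => derivWithin (fun s => F s z.2) J z.1) (J ×ˢ U) := by
  refine ((contDiffOn_fderivWithin_cylinder hJ hU hF).clm_apply
    (contDiffOn_const (c := ((1 : ℝ), (0 : E3))))).congr fun z hz => ?_
  exact derivWithin_eq_fderivWithin hJ hU hF hz.1 hz.2

/-- Time derivatives commute with space derivatives. -/
lemma hasDerivWithinAt_pd (i : Fin 3) {t : ℝ} {y : E3} (ht : t ∈ J) (hy : y ∈ U) :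
    HasDerivWithinAt (fun s => pd i (F s) y)
      (pd i (fun z => derivWithin (fun s => F s z) J t) y) J t := by
  set D := fderivWithin ℝ (fun z : ℝ × E3 => F z.1 z.2) (J ×ˢ U) with hD
  have hDc := contDiffOn_fderivWithin_cylinder hJ hU hF
  have hs : IsSymmSndFDerivWithinAt ℝ (fun z : ℝ × E3 => F z.1 z.2) (J ×ˢ U) (t, y) :=
    (hF (t, y) ⟨ht, hy⟩).isSymmSndFDerivWithinAt (by simpa using two_le_infty)
      (uniqueDiffOn_cylinder hJ hU) (cylinder_subset_closure_interior hJ hU ⟨ht, hy⟩) ⟨ht, hy⟩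
  have hD2 : HasFDerivWithinAt D (fderivWithin ℝ D (J ×ˢ U) (t, y)) (J ×ˢ U) (t, y) :=
    ((hDc (t, y) ⟨ht, hy⟩).differentiableWithinAt (by simp)).hasFDerivWithinAt
  have key : ∀ v : ℝ × E3, HasFDerivWithinAt (fun z => D z v)
      ((fderivWithin ℝ D (J ×ˢ U) (t, y)).flip v) (J ×ˢ U) (t, y) := by
    intro v
    have := hD2.clm_apply (hasFDerivWithinAt_const v (t, y) (J ×ˢ U))
    exact this.congr_fderiv (by ext w <;> simp)
  have h1 : HasDerivWithinAt (fun s => D (s, y) (0, EuclideanSpace.single i 1))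
      (fderivWithin ℝ D (J ×ˢ U) (t, y) (1, 0) (0, EuclideanSpace.single i 1)) J t := by
    have h1 : HasFDerivAt (fun s : ℝ => (s, y)) (ContinuousLinearMap.inl ℝ ℝ E3) t :=
      hasFDerivAt_prodMk_left t y
    exact ((key _).comp t (h1.hasFDerivWithinAt (s := J)) (fun z hz => mk_mem_prod hz hy)).hasDerivWithinAt
  have h2 : HasFDerivAt (fun z => D (t, z) (1, 0))
      (((fderivWithin ℝ D (J ×ˢ U) (t, y)).flip (1, 0)).comp (ContinuousLinearMap.inr ℝ ℝ E3)) y := by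
    have h1 : HasFDerivAt (fun y : E3 => (t, y)) (ContinuousLinearMap.inr ℝ ℝ E3) y :=
      hasFDerivAt_prodMk_right t y
    exact ((key _).comp y (h1.hasFDerivWithinAt (s := U)) (fun z hz => mk_mem_prod ht hz)).hasFDerivAt
      (hU.mem_nhds hy)
  have h3 : pd i (fun z => derivWithin (fun s => F s z) J t) y =
      fderivWithin ℝ D (J ×ˢ U) (t, y) (1, 0) (0, EuclideanSpace.single i 1) := by
    have : (fun z => derivWithin (fun s => F s z) J t) =ᶠ[𝓝 y] fun z => D (t, z) (1, 0) := by
      filter_upwards [hU.mem_nhds hy] with z hz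
      exact derivWithin_eq_fderivWithin hJ hU hF ht hz
    rw [pd_congr i this, pd, h2.fderiv]
    exact hs.eq (0, EuclideanSpace.single i 1) (1, 0)
  rw [h3]
  refine h1.congr_of_mem (fun s hs' => pd_eq_fderivWithin hJ hU hF i hs' hy) ht

end TimeCalculus

/-! ### Time-dependent fields and the commutation of `∂ₜ` with the curl. -/

section TimeFields

variable {M : Type*} [EMetricSpace M] [ChartedSpace E3 M] [IsManifold (𝓡 3) ∞ M]

/-- A time-dependent vector field with jointly smooth components in every chart. -/
def SmoothT (J : Set ℝ) (X : ℝ → VField M) : Prop :=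
  ∀ x₀ i, ContDiffOn ℝ ∞ (fun z : ℝ × E3 => vecComp x₀ (X z.1) z.2 i) (J ×ˢ tgt x₀)

/-- A time-dependent function with jointly smooth coordinate expressions. -/
def SmoothFT (J : Set ℝ) (f : ℝ → M → ℝ) : Prop :=
  ∀ x₀, ContDiffOn ℝ ∞ (fun z : ℝ × E3 => f z.1 (pt x₀ z.2)) (J ×ˢ tgt x₀)

variable {J : Set ℝ}

lemma SmoothT.smoothV {X : ℝ → VField M} (hX : SmoothT J X) {t : ℝ} (ht : t ∈ J) :
    SmoothV (X t) := fun x₀ i =>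
  (hX x₀ i).comp (f := fun y : E3 => (t, y)) (contDiff_prodMk_right t).contDiffOn
    fun _ hy => mk_mem_prod ht hy

lemma SmoothFT.smoothF {f : ℝ → M → ℝ} (hf : SmoothFT J f) {t : ℝ} (ht : t ∈ J) :
    SmoothF (f t) := fun x₀ =>
  (hf x₀).comp (f := fun y : E3 => (t, y)) (contDiff_prodMk_right t).contDiffOn
    fun _ hy => mk_mem_prod ht hy

lemma SmoothFT.congr {f g : ℝ → M → ℝ} (hf : SmoothFT J f) (h : ∀ t ∈ J, ∀ x, g t x = f t x) :
    SmoothFT J g := fun x₀ => (hf x₀).congr fun z hz => h z.1 hz.1 _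

lemma SmoothFT.add {f g : ℝ → M → ℝ} (hf : SmoothFT J f) (hg : SmoothFT J g) :
    SmoothFT J (fun t x => f t x + g t x) := fun x₀ => (hf x₀).add (hg x₀)

lemma SmoothFT.sub {f g : ℝ → M → ℝ} (hf : SmoothFT J f) (hg : SmoothFT J g) :
    SmoothFT J (fun t x => f t x - g t x) := fun x₀ => (hf x₀).sub (hg x₀)

lemma SmoothFT.mul {f g : ℝ → M → ℝ} (hf : SmoothFT J f) (hg : SmoothFT J g) :
    SmoothFT J (fun t x => f t x * g t x) := fun x₀ => (hf x₀).mul (hg x₀)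

lemma SmoothFT.const_mul (c : ℝ) {f : ℝ → M → ℝ} (hf : SmoothFT J f) :
    SmoothFT J (fun t x => c * f t x) := fun x₀ => contDiffOn_const.mul (hf x₀)

lemma SmoothFT.continuousOn {f : ℝ → M → ℝ} (hf : SmoothFT J f) :
    ContinuousOn (fun z : ℝ × M => f z.1 z.2) (J ×ˢ univ) := by
  rintro ⟨t, x⟩ ⟨ht, -⟩
  have h1 : ContinuousWithinAt (fun z : ℝ × E3 => f z.1 (pt x z.2)) (J ×ˢ tgt x) (t, ctr x) :=
    (hf x).continuousOn (t, ctr x) ⟨ht, ctr_mem_tgt x⟩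
  have h2 : ContinuousWithinAt (fun z : ℝ × M => (z.1, crd x z.2)) (J ×ˢ src x) (t, x) :=
    continuousWithinAt_fst.prodMk
      (((continuousOn_crd x) x (mem_src_self x)).comp continuousWithinAt_snd fun z hz => hz.2)
  have h3 := ContinuousWithinAt.comp (g := fun z : ℝ × E3 => f z.1 (pt x z.2)) (x := (t, x)) h1 h2
    (fun z hz => mk_mem_prod hz.1 (crd_mem_tgt hz.2))
  have h4 : ContinuousWithinAt (fun z : ℝ × M => f z.1 z.2) (J ×ˢ src x) (t, x) := by
    refine h3.congr (fun z hz => ?_) ?_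
    · simp only [Function.comp_apply, pt_crd hz.2]
    · simp only [Function.comp_apply, pt_crd (mem_src_self x)]
  refine h4.mono_of_mem_nhdsWithin ?_
  rw [mem_nhdsWithin]
  exact ⟨univ ×ˢ src x, isOpen_univ.prod (isOpen_src x), ⟨mem_univ _, mem_src_self x⟩,
    fun z hz => ⟨hz.2.1, hz.1.2⟩⟩

lemma contDiffOn_snd_cylinder {f : E3 → ℝ} {x₀ : M}
    (hf : ∀ {y}, y ∈ tgt x₀ → ContDiffAt ℝ ∞ f y) :
    ContDiffOn ℝ ∞ (fun z : ℝ × E3 => f z.2) (J ×ˢ tgt x₀) := fun z hz =>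
  ((hf hz.2).comp z contDiffAt_snd).contDiffWithinAt

variable [RiemannianBundle (fun x : M => TangentSpace (𝓡 3) x)]
variable [IsContMDiffRiemannianBundle (𝓡 3) ∞ E3 (fun x : M => TangentSpace (𝓡 3) x)]

lemma SmoothT.formComp {X : ℝ → VField M} (hX : SmoothT J X) (x₀ : M) (j : Fin 3) :
    ContDiffOn ℝ ∞ (fun z : ℝ × E3 => formComp x₀ (flat (X z.1)) z.2 j) (J ×ˢ tgt x₀) := by
  have : ContDiffOn ℝ ∞ (fun z : ℝ × E3 => ∑ k, metricMat x₀ z.2 j k * vecComp x₀ (X z.1) z.2 k)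
      (J ×ˢ tgt x₀) := ContDiffOn.sum fun k _ =>
    (contDiffOn_snd_cylinder fun hy => contDiffAt_metricMat hy j k).mul (hX x₀ k)
  exact this.congr fun z hz => formComp_flat (X z.1) hz.2 j

lemma smoothT_of_formComp {X : ℝ → VField M} (h : ∀ x₀ j, ContDiffOn ℝ ∞
    (fun z : ℝ × E3 => VorticityEnergy.formComp x₀ (flat (X z.1)) z.2 j) (J ×ˢ tgt x₀)) :
    SmoothT J X := by
  intro x₀ i
  have : ContDiffOn ℝ ∞ (fun z : ℝ × E3 => ∑ l, metricInv x₀ z.2 i l *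
      VorticityEnergy.formComp x₀ (flat (X z.1)) z.2 l) (J ×ˢ tgt x₀) :=
    ContDiffOn.sum fun l _ =>
      (contDiffOn_snd_cylinder fun hy => contDiffAt_metricInv hy i l).mul (h x₀ l)
  exact this.congr fun z hz => (sum_metricInv_formComp (X z.1) hz.2 i).symm

lemma SmoothT.inner {X Y : ℝ → VField M} (hX : SmoothT J X) (hY : SmoothT J Y) :
    SmoothFT J (fun t x => Inner.inner ℝ (X t x) (Y t x)) := by
  intro x₀
  have : ContDiffOn ℝ ∞ (fun z : ℝ × E3 => ∑ j, (∑ k, metricMat x₀ z.2 j k *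
      vecComp x₀ (X z.1) z.2 k) * vecComp x₀ (Y z.1) z.2 j) (J ×ˢ tgt x₀) :=
    ContDiffOn.sum fun j _ => (ContDiffOn.sum fun k _ =>
      (contDiffOn_snd_cylinder fun hy => contDiffAt_metricMat hy j k).mul (hX x₀ k)).mul (hY x₀ j)
  exact this.congr fun z hz => inner_eq_sum (X z.1) (Y z.1) hz.2

variable (hJ : Convex ℝ J ∧ (interior J).Nonempty)
include hJ

lemma SmoothT.covVecComp {X : ℝ → VField M} (hX : SmoothT J X) (x₀ : M) (i k : Fin 3) :
    ContDiffOn ℝ ∞ (fun z : ℝ × E3 => covVecComp x₀ (X z.1) z.2 i k) (J ×ˢ tgt x₀) := by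
  unfold VorticityEnergy.covVecComp
  exact (contDiffOn_pd_cylinder (F := fun t y => vecComp x₀ (X t) y k) hJ (isOpen_tgt x₀)
    (hX x₀ k) i).add (ContDiffOn.sum fun j _ =>
    (contDiffOn_snd_cylinder fun hy => contDiffAt_christoffel hy k i j).mul (hX x₀ j))

lemma SmoothT.adv {X Y : ℝ → VField M} (hX : SmoothT J X) (hY : SmoothT J Y) :
    SmoothT J (fun t => adv (X t) (Y t)) := by
  intro x₀ k
  have : ContDiffOn ℝ ∞ (fun z : ℝ × E3 => ∑ i, vecComp x₀ (Y z.1) z.2 i *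
      VorticityEnergy.covVecComp x₀ (X z.1) z.2 i k) (J ×ˢ tgt x₀) :=
    ContDiffOn.sum fun i _ => (hY x₀ i).mul (hX.covVecComp hJ x₀ i k)
  exact this.congr fun z hz => vecComp_adv (hX.smoothV hz.1) (Y z.1) hz.2 k

lemma SmoothT.divergence {X : ℝ → VField M} (hX : SmoothT J X) :
    SmoothFT J (fun t => divergence (X t)) := by
  intro x₀
  have : ContDiffOn ℝ ∞ (fun z : ℝ × E3 => ∑ i,
      VorticityEnergy.covVecComp x₀ (X z.1) z.2 i i) (J ×ˢ tgt x₀) :=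
    ContDiffOn.sum fun i _ => hX.covVecComp hJ x₀ i i
  exact this.congr fun z hz => divergence_eq (hX.smoothV hz.1) hz.2

lemma SmoothT.covFormNormSq {X : ℝ → VField M} (hX : SmoothT J X) :
    SmoothFT J (fun t => covFormNormSq (flat (X t))) := by
  intro x₀
  have : ContDiffOn ℝ ∞ (fun z : ℝ × E3 => ∑ i, ∑ j, metricInv x₀ z.2 i j *
      ∑ k, ∑ l, metricMat x₀ z.2 k l * VorticityEnergy.covVecComp x₀ (X z.1) z.2 i k *
        VorticityEnergy.covVecComp x₀ (X z.1) z.2 j l) (J ×ˢ tgt x₀) := by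
    refine ContDiffOn.sum fun i _ => ContDiffOn.sum fun j _ => ?_
    refine (contDiffOn_snd_cylinder fun hy => contDiffAt_metricInv hy i j).mul ?_
    refine ContDiffOn.sum fun k _ => ContDiffOn.sum fun l _ => ?_
    exact ((contDiffOn_snd_cylinder fun hy => contDiffAt_metricMat hy k l).mul
      (hX.covVecComp hJ x₀ i k)).mul (hX.covVecComp hJ x₀ j l)
  exact this.congr fun z hz => covFormNormSq_eq (hX.smoothV hz.1) hz.2

lemma SmoothFT.gradient {f : ℝ → M → ℝ} (hf : SmoothFT J f) :
    SmoothT J (fun t => gradient (f t)) := by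
  refine smoothT_of_formComp fun x₀ j => ?_
  refine (contDiffOn_pd_cylinder (F := fun t y => f t (pt x₀ y)) hJ (isOpen_tgt x₀)
    (hf x₀) j).congr fun z hz => ?_
  exact formComp_gradient (hf.smoothF hz.1) hz.2 j

lemma SmoothT.curl {o : TangentOrientation M} (ho : IsOrientation o) {X : ℝ → VField M}
    (hX : SmoothT J X) : SmoothT J (fun t => curl o (X t)) := by
  intro x₀ n
  have h : ∀ i j, ContDiffOn ℝ ∞ (fun z : ℝ × E3 =>
      extD1 (VorticityEnergy.formComp x₀ (flat (X z.1))) z.2 i j) (J ×ˢ tgt x₀) := fun i j =>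
    (contDiffOn_pd_cylinder (F := fun t y => VorticityEnergy.formComp x₀ (flat (X t)) y j) hJ
      (isOpen_tgt x₀) (hX.formComp x₀ j) i).sub
    (contDiffOn_pd_cylinder (F := fun t y => VorticityEnergy.formComp x₀ (flat (X t)) y i) hJ
      (isOpen_tgt x₀) (hX.formComp x₀ i) j)
  have : ContDiffOn ℝ ∞ (fun z : ℝ × E3 =>
      dualVec (extD1 (VorticityEnergy.formComp x₀ (flat (X z.1))) z.2) n /
      volComp o x₀ (pt x₀ z.2) 0 1 2) (J ×ˢ tgt x₀) := by
    refine ContDiffOn.div ?_ (contDiffOn_snd_cylinder fun hy => contDiffAt_volComp ho hy)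
      fun z hz => volComp_ne_zero o hz.2
    fin_cases n
    · exact h 1 2
    · exact h 2 0
    · exact h 0 1
  exact this.congr fun z hz => vecComp_curl o (hX.smoothV hz.1) hz.2 n

/-- The time derivative of a time-dependent vector field. -/
def timeDeriv (J : Set ℝ) (X : ℝ → VField M) (t : ℝ) : VField M :=
  fun x => derivWithin (fun s => X s x) J t

/-- The coordinate frame at a fixed point does not depend on time, so the field is differentiated
coefficient by coefficient. -/
lemma vecComp_timeDeriv {X : ℝ → VField M} (hX : SmoothT J X) {t : ℝ} (ht : t ∈ J) {x₀ : M}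
    {y : E3} (hy : y ∈ tgt x₀) (i : Fin 3) :
    vecComp x₀ (timeDeriv J X t) y i = derivWithin (fun s => vecComp x₀ (X s) y i) J t := by
  have h := pt_mem_src hy
  have h1 := fun i => hasDerivWithinAt_time (F := fun s y => vecComp x₀ (X s) y i) hJ
    (isOpen_tgt x₀) (hX x₀ i) ht hy
  have h2 : HasDerivWithinAt (fun s => X s (pt x₀ y)) (∑ i, derivWithin
      (fun s => vecComp x₀ (X s) y i) J t • coordVec x₀ i (pt x₀ y)) J t := by
    have h3 : HasDerivWithinAt (fun s => ∑ i, vecComp x₀ (X s) y i • coordVec x₀ i (pt x₀ y))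
        (∑ i, derivWithin (fun s => vecComp x₀ (X s) y i) J t • coordVec x₀ i (pt x₀ y)) J t :=
      HasDerivWithinAt.fun_sum fun i _ =>
        (h1 i).differentiableWithinAt.hasDerivWithinAt.smul_const (coordVec x₀ i (pt x₀ y))
    exact h3.congr_of_mem (fun s _ => (sum_coordCovec_smul h (X s (pt x₀ y))).symm) ht
  have h4 : timeDeriv J X t (pt x₀ y) = ∑ i, derivWithin
      (fun s => vecComp x₀ (X s) y i) J t • coordVec x₀ i (pt x₀ y) :=
    h2.derivWithin (uniqueDiffOn_time hJ (isOpen_tgt x₀) t ht)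
  have h5 : vecComp x₀ (timeDeriv J X t) y i =
    coordCovec x₀ i (pt x₀ y) (timeDeriv J X t (pt x₀ y)) := rfl
  rw [h5, h4, coordCovec_sum_smul h]

lemma SmoothT.timeDeriv {X : ℝ → VField M} (hX : SmoothT J X) : SmoothT J (timeDeriv J X) := by
  intro x₀ i
  exact (contDiffOn_derivWithin_cylinder (F := fun s y => vecComp x₀ (X s) y i) hJ
    (isOpen_tgt x₀) (hX x₀ i)).congr fun z hz => vecComp_timeDeriv hJ hX hz.1 hz.2 i

/-- In a fixed chart the curl is a linear first-order operator whose coefficients do not depend on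
time. Only the exchange of `∂ₜ` with a partial derivative is needed. -/
lemma hasDerivWithinAt_vecComp_curl (o : TangentOrientation M) {X : ℝ → VField M}
    (hX : SmoothT J X) {t : ℝ} (ht : t ∈ J) {x₀ : M} {y : E3} (hy : y ∈ tgt x₀) (n : Fin 3) :
    HasDerivWithinAt (fun s => vecComp x₀ (VorticityEnergy.curl o (X s)) y n)
      (vecComp x₀ (VorticityEnergy.curl o (VorticityEnergy.timeDeriv J X t)) y n) J t := by
  have hX' := (hX.timeDeriv hJ).smoothV ht
  have h1 : ∀ j, ∀ z ∈ tgt x₀, derivWithin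
      (fun s => VorticityEnergy.formComp x₀ (flat (X s)) z j) J t =
        VorticityEnergy.formComp x₀ (flat (VorticityEnergy.timeDeriv J X t)) z j := by
    intro j z hz
    simp only [formComp_flat _ hz, vecComp_timeDeriv hJ hX ht hz]
    have h2 := fun k => (hasDerivWithinAt_time (F := fun s y => vecComp x₀ (X s) y k) hJ
      (isOpen_tgt x₀) (hX x₀ k) ht hz).differentiableWithinAt.hasDerivWithinAt
    exact (HasDerivWithinAt.fun_sum fun k _ => (h2 k).const_mul _).derivWithin
      (uniqueDiffOn_time hJ (isOpen_tgt x₀) t ht)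
  have h2 : ∀ i j, HasDerivWithinAt (fun s => extD1 (VorticityEnergy.formComp x₀ (flat (X s))) y i j)
      (extD1 (VorticityEnergy.formComp x₀ (flat (VorticityEnergy.timeDeriv J X t))) y i j) J t := by
    intro i j
    have h3 : ∀ i j, HasDerivWithinAt
        (fun s => pd i (fun z => VorticityEnergy.formComp x₀ (flat (X s)) z j) y)
        (pd i (fun z => VorticityEnergy.formComp x₀ (flat (VorticityEnergy.timeDeriv J X t)) z j) y)
        J t := by
      intro i j
      have h4 := hasDerivWithinAt_pd (F := fun t y => VorticityEnergy.formComp x₀ (flat (X t)) y j)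
        hJ (isOpen_tgt x₀) (hX.formComp x₀ j) i ht hy
      rwa [pd_congr i (f := fun z => derivWithin _ J t)
        (Filter.eventuallyEq_of_mem (tgt_mem_nhds hy) (h1 j))] at h4
    exact (h3 i j).sub (h3 j i)
  rw [vecComp_curl o hX' hy]
  have h3 : HasDerivWithinAt (fun s => dualVec (extD1 (VorticityEnergy.formComp x₀ (flat (X s))) y) n /
      volComp o x₀ (pt x₀ y) 0 1 2) (dualVec (extD1 (VorticityEnergy.formComp x₀
        (flat (VorticityEnergy.timeDeriv J X t))) y) n / volComp o x₀ (pt x₀ y) 0 1 2) J t := by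
    refine HasDerivWithinAt.div_const ?_ _
    fin_cases n
    · exact h2 1 2
    · exact h2 2 0
    · exact h2 0 1
  exact h3.congr_of_mem (fun s hs => vecComp_curl o (hX.smoothV hs) hy n) ht

/-- The time derivative of `½|curl X|²`. -/
lemma hasDerivWithinAt_half_normSq_curl (o : TangentOrientation M) {X : ℝ → VField M}
    (hX : SmoothT J X) {t : ℝ} (ht : t ∈ J) (x : M) :
    HasDerivWithinAt (fun s => (1 / 2) * Inner.inner ℝ (VorticityEnergy.curl o (X s) x)
      (VorticityEnergy.curl o (X s) x))
      (Inner.inner ℝ (VorticityEnergy.curl o (VorticityEnergy.timeDeriv J X t) x)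
        (VorticityEnergy.curl o (X t) x)) J t := by
  have hx := ctr_mem_tgt x
  have s := metricMat_symm x (ctr x)
  have h : ∀ Y Z : VField M, Inner.inner ℝ (Y x) (Z x) = ∑ j, (∑ k, metricMat x (ctr x) j k *
      vecComp x Y (ctr x) k) * vecComp x Z (ctr x) j := by
    intro Y Z
    rw [inner_eq_sum_ctr]
    simp only [formComp_flat _ hx, Fin.sum_univ_three]
    rw [s 1 0, s 2 0, s 2 1]
    ring
  have h1 := fun n => hasDerivWithinAt_vecComp_curl hJ o hX ht hx n
  have e := fun s => h (VorticityEnergy.curl o (X s)) (VorticityEnergy.curl o (X s))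
  simp only [e, h (VorticityEnergy.curl o (VorticityEnergy.timeDeriv J X t))
    (VorticityEnergy.curl o (X t))]
  have h2 := (HasDerivWithinAt.fun_sum fun j (_ : j ∈ Finset.univ) => (HasDerivWithinAt.fun_sum
    fun k (_ : k ∈ Finset.univ) => (h1 k).const_mul (metricMat x (ctr x) j k)).fun_mul
      (h1 j)).const_mul (1 / 2 : ℝ)
  refine h2.congr_deriv ?_
  simp only [Fin.sum_univ_three]
  rw [s 1 0, s 2 0, s 2 1]
  ring

end TimeFields

/-! ### The vorticity equation, the flux and the local balance law. -/

section Solutions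

variable {M : Type*} [EMetricSpace M] [ChartedSpace E3 M] [IsManifold (𝓡 3) ∞ M]
variable [RiemannianBundle (fun x : M => TangentSpace (𝓡 3) x)]
variable [IsContMDiffRiemannianBundle (𝓡 3) ∞ E3 (fun x : M => TangentSpace (𝓡 3) x)]

lemma norm_vorticity (o : TangentOrientation M) (X : VField M) (x : M) :
    ‖vorticity o X x‖ = ‖curl o X x‖ := (norm_sharp _ x).symm

lemma covFormNormSq_nonneg (α : OneForm M) (x : M) : 0 ≤ covFormNormSq α x :=
  Finset.sum_nonneg fun _ _ => sq_nonneg _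

/-- Cauchy-Schwarz over an orthonormal basis: the operator norm is at most the Hilbert-Schmidt norm.
-/
lemma norm_covVec_le {X : VField M} (hX : SmoothV X) (x : M) (v : TangentSpace (𝓡 3) x) :
    ‖covVec X x v‖ ≤ √(covFormNormSq (flat X) x) * ‖v‖ := by
  set b := stdOrthonormalBasis ℝ (TangentSpace (𝓡 3) x) with hb
  have h1 : covVec X x v = ∑ a, inner ℝ (b a) v • covVec X x (b a) := by
    conv_lhs => rw [← b.sum_repr' v, map_sum]
    simp only [map_smul]
  have h2 : ‖covVec X x v‖ ≤ ∑ a, ‖covVec X x (b a)‖ * ‖(inner ℝ (b a) v : ℝ)‖ := by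
    rw [h1]
    refine (norm_sum_le _ _).trans (le_of_eq (Finset.sum_congr rfl fun a _ => ?_))
    rw [norm_smul, mul_comm]
  refine h2.trans ((Real.sum_mul_le_sqrt_mul_sqrt _ _ _).trans (le_of_eq ?_))
  have h3 : ∑ a, ‖covVec X x (b a)‖ ^ 2 = covFormNormSq (flat X) x := by
    refine Finset.sum_congr rfl fun a _ => ?_
    rw [norm_covForm_flat hX]
  have h4 : ∑ a, ‖(inner ℝ (b a) v : ℝ)‖ ^ 2 = ‖v‖ ^ 2 := b.sum_sq_norm_inner_right v
  rw [h3, h4, Real.sqrt_sq (norm_nonneg v)]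

/-- By metric compatibility this gradient is the adjoint of `∇X` applied to `X`, and the adjoint
obeys the same norm bound. -/
lemma norm_gradient_half_normSq_le {X : VField M} (hX : SmoothV X) (x : M) :
    ‖gradient (fun z => (1 / 2) * inner ℝ (X z) (X z)) x‖ ≤
      √(covFormNormSq (flat X) x) * ‖X x‖ := by
  rw [gradient_half_normSq hX]
  set w := ContinuousLinearMap.adjoint (covVec X x) (X x)
  have h : ‖w‖ * ‖w‖ ≤ (√(covFormNormSq (flat X) x) * ‖X x‖) * ‖w‖ := by
    calc ‖w‖ * ‖w‖ = inner ℝ w w := (real_inner_self_eq_norm_mul_norm w).symm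
      _ = inner ℝ (X x) (covVec X x w) := ContinuousLinearMap.adjoint_inner_left _ _ _
      _ ≤ ‖X x‖ * ‖covVec X x w‖ := real_inner_le_norm _ _
      _ ≤ ‖X x‖ * (√(covFormNormSq (flat X) x) * ‖w‖) := by
        gcongr
        exact norm_covVec_le hX x w
      _ = _ := by ring
  rcases eq_or_lt_of_le (norm_nonneg w) with h0 | h0
  · rw [← h0]; positivity
  · exact le_of_mul_le_mul_right h h0

variable {o : TangentOrientation M} {ν : ℝ} {J : Set ℝ} {u : ℝ → VField M} {p : ℝ → M → ℝ}

lemma IsSmoothSolution.smoothT (hsol : IsSmoothSolution o ν J u p) : SmoothT J u :=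
  fun x₀ i => contDiffOn_vecComp_of_contMDiffOn hsol.smooth_velocity x₀ i

lemma IsSmoothSolution.smoothF_pressure (hsol : IsSmoothSolution o ν J u p) {t : ℝ} (ht : t ∈ J) :
    SmoothF (p t) := fun x₀ =>
  contMDiffOn_iff_contDiffOn.1 ((hsol.smooth_pressure t ht).comp_contMDiffOn (contMDiffOn_pt x₀))

variable (ho : IsOrientation o) (hJ : Convex ℝ J ∧ (interior J).Nonempty)
  (hsol : IsSmoothSolution o ν J u p)
include ho hJ hsol

/-- The vorticity equation `∂ₜω = ∇_ω u - ∇_u ω - ν curl curl ω`. -/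
lemma IsSmoothSolution.curl_timeDeriv {t : ℝ} (ht : t ∈ J) (x : M) :
    curl o (timeDeriv J u t) x = adv (u t) (curl o (u t)) x - adv (curl o (u t)) (u t) x
      - ν • curl o (curl o (curl o (u t))) x := by
  have hu := hsol.smoothT.smoothV ht
  have hp := hsol.smoothF_pressure ht
  have hk : SmoothF (fun z => (1 / 2) * inner ℝ (u t z) (u t z)) :=
    (SmoothF.const (1/2)).mul (hu.inner hu)
  have hcu := hu.curl ho
  have hccu := hcu.curl ho
  have hcr : SmoothV (cross (u t) (u t)) := hu.cross hu
  -- The momentum equation reads `∂ₜu = -W × u - ½∇|u|² - ν curl W - ∇p`. The two gradients are sent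
  -- to zero by the curl, and in `curl_cross` both divergence terms vanish.
  have e : timeDeriv J u t = fun x => ((-1 : ℝ) • cross (u t) (u t) x +
      (-1 : ℝ) • gradient (fun z => (1 / 2) * inner ℝ (u t z) (u t z)) x) +
      ((-ν) • curl o (curl o (u t)) x + (-1 : ℝ) • gradient (p t) x) := by
    ext1 x
    have h := hsol.momentum t ht x
    rw [hodgeVec_eq ho hu (hsol.div_free t ht)] at h
    have h2 := adv_self hu x
    have h3 : covVec (u t) x (u t x) = adv (u t) (u t) x := rfl
    rw [h3, h2] at h
    have h4 : derivWithin (fun s => u s x) J t = timeDeriv J u t x := rfl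
    rw [h4] at h
    rw [add_assoc] at h
    rw [eq_sub_of_add_eq h]
    module
  rw [e, curl_add ((hcr.const_smul _).add (hk.gradient.const_smul _))
      ((hccu.const_smul _).add (hp.gradient.const_smul _)),
    curl_add (hcr.const_smul _) (hk.gradient.const_smul _),
    curl_add (hccu.const_smul _) (hp.gradient.const_smul _),
    curl_const_smul hcr, curl_const_smul hk.gradient, curl_const_smul hccu,
    curl_const_smul hp.gradient, curl_gradient hk, curl_gradient hp, curl_cross ho hu hu,
    hsol.div_free t ht, divergence_curl ho hu]
  module

omit ho hJ hsol in
/-- The energy flux: `ν ∇(½|ω|²) - ½|ω|² u`. -/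
def flux (o : TangentOrientation M) (ν : ℝ) (X : VField M) : VField M := fun x =>
  ν • gradient (fun z => (1 / 2) * inner ℝ (curl o X z) (curl o X z)) x -
    ((1 / 2) * inner ℝ (curl o X x) (curl o X x)) • X x

omit hJ hsol in
lemma smoothV_flux (ν : ℝ) {X : VField M} (hX : SmoothV X) : SmoothV (flux o ν X) := by
  have hk : SmoothF (fun z => (1 / 2) * inner ℝ (curl o X z) (curl o X z)) :=
    (SmoothF.const (1/2)).mul ((hX.curl ho).inner (hX.curl ho))
  exact (hk.gradient.const_smul ν).sub (SmoothV.smul hk hX)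

omit hJ hsol in
-- By `|∇½|W|²| ≤ |∇W||W| ≤ |∇W|² + |W|²` the flux is dominated by exactly the quantities that the
-- assumption at infinity controls. The constants are not sharp.
lemma norm_flux_le (hν : 0 ≤ ν) {X : VField M} (hX : SmoothV X) (x : M) :
    ‖flux o ν X x‖ ≤ ν * (covFormNormSq (vorticity o X) x + ‖vorticity o X x‖ ^ 2) +
      ‖X x‖ * ‖vorticity o X x‖ ^ 2 := by
  have h1 := norm_gradient_half_normSq_le (hX.curl ho) x
  rw [flat_curl] at h1
  rw [norm_vorticity]
  set q := covFormNormSq (vorticity o X) x with hq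
  have hq0 : 0 ≤ q := covFormNormSq_nonneg _ x
  have hs := Real.sq_sqrt hq0
  refine (norm_sub_le _ _).trans (add_le_add ?_ ?_)
  · rw [norm_smul, Real.norm_of_nonneg hν]
    gcongr
    refine h1.trans ?_
    nlinarith [sq_nonneg (√q - ‖curl o X x‖), sq_nonneg (√q), sq_nonneg ‖curl o X x‖]
  · rw [norm_smul, real_inner_self_eq_norm_sq, Real.norm_of_nonneg (by positivity)]
    nlinarith [mul_nonneg (norm_nonneg (X x)) (sq_nonneg ‖curl o X x‖)]

/-- The local balance law of the enstrophy density. -/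
lemma IsSmoothSolution.balance {t : ℝ} (ht : t ∈ J) (x : M) :
    HasDerivWithinAt (fun s => ‖vorticity o (u s) x‖ ^ 2)
      (2 * (-ν * covFormNormSq (vorticity o (u t)) x
        - ν * formInner (formAct (vorticity o (u t)) ricci) (vorticity o (u t)) x
        + formInner (formAct (vorticity o (u t)) (strain (u t))) (vorticity o (u t)) x
        + divergence (flux o ν (u t)) x)) J t := by
  have hu := hsol.smoothT.smoothV ht
  have hcu := hu.curl ho
  have hk : SmoothF (fun z => (1 / 2) * inner ℝ (curl o (u t) z) (curl o (u t) z)) :=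
    (SmoothF.const (1/2)).mul (hcu.inner hcu)
  have h1 := (hasDerivWithinAt_half_normSq_curl hJ o hsol.smoothT ht x).const_mul 2
  have e : (fun s => ‖vorticity o (u s) x‖ ^ 2) =
      fun s => 2 * ((1 / 2) * inner ℝ (curl o (u s) x) (curl o (u s) x)) := by
    ext1 s
    rw [norm_vorticity, real_inner_self_eq_norm_sq]
    ring
  rw [e]
  refine h1.congr_deriv ?_
  congr 1
  -- Since `div u = 0`, the convective part satisfies `div(½|W|² u) = ⟨∇_u W, W⟩`, the transport
  -- term of the vorticity equation.
  have h2 : divergence (flux o ν (u t)) x = ν * divergence (gradient fun z =>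
      (1 / 2) * inner ℝ (curl o (u t) z) (curl o (u t) z)) x -
      inner ℝ (adv (curl o (u t)) (u t) x) (curl o (u t) x) := by
    have h3 : divergence (flux o ν (u t)) x = _ :=
      divergence_sub (hk.gradient.const_smul ν) (SmoothV.smul hk hu) x
    rw [h3, divergence_const_smul ν hk.gradient, divergence_smul hk hu, hsol.div_free t ht,
      gradient_half_normSq hcu, ContinuousLinearMap.adjoint_inner_left,
      real_inner_comm (covVec (curl o (u t)) x (u t x))]
    simp only [mul_zero, zero_add]
    rfl
  rw [h2, bochner ho hu, ← flat_curl o (u t), formInner_strain, hsol.curl_timeDeriv ho hJ ht,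
    inner_sub_left, inner_sub_left, inner_smul_left]
  simp only [conj_trivial]
  ring

omit ho hJ hsol in
lemma smoothFT_strain {X : ℝ → VField M} (hJ : Convex ℝ J ∧ (interior J).Nonempty)
    (ho : IsOrientation o) (hX : SmoothT J X) : SmoothFT J (fun t =>
    formInner (formAct (vorticity o (X t)) (strain (X t))) (vorticity o (X t))) :=
  ((hX.adv hJ (hX.curl hJ ho)).inner (hX.curl hJ ho)).congr fun t _ x => by
    rw [← flat_curl]
    exact formInner_strain _ _ x

omit ho hJ hsol in
lemma smoothFT_covFormNormSq_vorticity {X : ℝ → VField M} (hJ : Convex ℝ J ∧ (interior J).Nonempty)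
    (ho : IsOrientation o) (hX : SmoothT J X) :
    SmoothFT J (fun t => covFormNormSq (vorticity o (X t))) :=
  ((hX.curl hJ ho).covFormNormSq hJ).congr fun t _ x => by rw [flat_curl]

omit ho hJ hsol in
-- Bochner's formula is solved for the Ricci term: the remaining terms are known to be smooth, so
-- the chart dependence of `ricci` need not be examined.
lemma smoothFT_ricci {X : ℝ → VField M} (hJ : Convex ℝ J ∧ (interior J).Nonempty)
    (ho : IsOrientation o) (hX : SmoothT J X) : SmoothFT J (fun t =>
    formInner (formAct (vorticity o (X t)) ricci) (vorticity o (X t))) := by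
  have hc := hX.curl hJ ho
  have hk : SmoothFT J (fun t z => (1 / 2) * inner ℝ (curl o (X t) z) (curl o (X t) z)) :=
    (hc.inner hc).const_mul (1 / 2)
  refine ((((hk.gradient hJ).divergence hJ).add
    (((hc.curl hJ ho).curl hJ ho).inner hc)).sub (smoothFT_covFormNormSq_vorticity hJ ho hX)).congr
      fun t ht x => ?_
  rw [bochner ho (hX.smoothV ht), ← flat_curl]
  ring

omit ho hJ hsol in
lemma smoothFT_normSq_vorticity {X : ℝ → VField M} (hJ : Convex ℝ J ∧ (interior J).Nonempty)
    (ho : IsOrientation o) (hX : SmoothT J X) :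
    SmoothFT J (fun t x => ‖vorticity o (X t) x‖ ^ 2) :=
  ((hX.curl hJ ho).inner (hX.curl hJ ho)).congr fun t _ x => by
    rw [norm_vorticity, real_inner_self_eq_norm_sq]

omit ho hJ hsol in
lemma smoothFT_divergence_flux {X : ℝ → VField M} (hJ : Convex ℝ J ∧ (interior J).Nonempty)
    (ho : IsOrientation o) (ν : ℝ) (hX : SmoothT J X) :
    SmoothFT J (fun t => divergence (flux o ν (X t))) := by
  have hc := hX.curl hJ ho
  have hk : SmoothFT J (fun t z => (1 / 2) * inner ℝ (curl o (X t) z) (curl o (X t) z)) :=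
    (hc.inner hc).const_mul (1 / 2)
  refine ((((hk.gradient hJ).divergence hJ).const_mul ν).sub
    ((hk.mul (hX.divergence hJ)).add ((hk.gradient hJ).inner hX))).congr fun t ht x => ?_
  have h := hk.smoothF ht
  have hX' := hX.smoothV ht
  have h3 : divergence (flux o ν (X t)) x = _ :=
    divergence_sub (h.gradient.const_smul ν) (SmoothV.smul h hX') x
  rw [h3, divergence_const_smul ν h.gradient, divergence_smul h hX']

omit ho hJ hsol in
lemma SmoothT.continuousOn_norm {X : ℝ → VField M} (hX : SmoothT J X) :
    ContinuousOn (fun z : ℝ × M => ‖X z.1 z.2‖) (J ×ˢ univ) := by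
  refine ((hX.inner hX).continuousOn.sqrt).congr fun z _ => ?_
  exact (norm_eq_sqrt_real_inner _)

end Solutions

/-! ### The Riemannian volume in charts. -/

section Volume

open scoped ENNReal

variable {M : Type*} [EMetricSpace M] [ChartedSpace E3 M] [IsManifold (𝓡 3) ∞ M]
variable [RiemannianBundle (fun x : M => TangentSpace (𝓡 3) x)]
variable [IsContMDiffRiemannianBundle (𝓡 3) ∞ E3 (fun x : M => TangentSpace (𝓡 3) x)]

/-- The density `√(det g)` of the Riemannian volume in the chart around `x₀`. -/
def density (x₀ : M) (y : E3) : ℝ := √(metricMat x₀ y).det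

lemma metricForm_eq_sum (x₀ : M) (y v w : E3) :
    metricForm x₀ y v w = ∑ i, ∑ j, metricMat x₀ y i j * v i * w j := by
  rw [metricForm]
  simp only [sum_apply, smul_apply,
    ContinuousLinearMap.smulRight_apply, smul_eq_mul]
  refine Finset.sum_congr rfl fun i _ => Finset.sum_congr rfl fun j _ => ?_
  simp
  ring

lemma det_metricMat_trans {x₀ x₁ : M} {y : E3} (hy : y ∈ tgt x₀) (h : pt x₀ y ∈ src x₁) :
    (metricMat x₀ y).det =
      (fderiv ℝ (trans x₀ x₁) y).det ^ 2 * (metricMat x₁ (trans x₀ x₁ y)).det := by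
  set A : Matrix (Fin 3) (Fin 3) ℝ :=
    fun k i => fderiv ℝ (trans x₀ x₁) y (EuclideanSpace.single i 1) k with hA
  have h1 : metricMat x₀ y = A.transpose * metricMat x₁ (trans x₀ x₁ y) * A := by
    ext i j
    rw [← metricForm_single, metricForm_trans hy h, metricForm_eq_sum]
    simp only [Matrix.mul_apply, Matrix.transpose_apply, Fin.sum_univ_three]
    simp only [hA]
    ring
  have h2 : (fderiv ℝ (trans x₀ x₁) y).det = A.det := by
    rw [ContinuousLinearMap.det, ← LinearMap.det_toMatrix
      (EuclideanSpace.basisFun (Fin 3) ℝ).toBasis]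
    congr 1
  rw [h1, h2, Matrix.det_mul, Matrix.det_mul, Matrix.det_transpose]
  ring

lemma density_trans {x₀ x₁ : M} {y : E3} (hy : y ∈ tgt x₀) (h : pt x₀ y ∈ src x₁) :
    density x₀ y = |(fderiv ℝ (trans x₀ x₁) y).det| * density x₁ (trans x₀ x₁ y) := by
  rw [density, density, det_metricMat_trans hy h, Real.sqrt_mul (sq_nonneg _), Real.sqrt_sq_eq_abs]

variable [MeasurableSpace M] [BorelSpace M]

omit [IsContMDiffRiemannianBundle (𝓡 3) ∞ E3 (fun x : M => TangentSpace (𝓡 3) x)]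
  [RiemannianBundle (fun x : M => TangentSpace (𝓡 3) x)] [IsManifold (𝓡 3) ∞ M] in
lemma measurableSet_tgt (x₀ : M) : MeasurableSet (tgt x₀) := (isOpen_tgt x₀).measurableSet

omit [IsContMDiffRiemannianBundle (𝓡 3) ∞ E3 (fun x : M => TangentSpace (𝓡 3) x)]
  [RiemannianBundle (fun x : M => TangentSpace (𝓡 3) x)] [IsManifold (𝓡 3) ∞ M] in
lemma measurableSet_src (x₀ : M) : MeasurableSet (src x₀) := (isOpen_src x₀).measurableSet

omit [IsContMDiffRiemannianBundle (𝓡 3) ∞ E3 (fun x : M => TangentSpace (𝓡 3) x)]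
  [RiemannianBundle (fun x : M => TangentSpace (𝓡 3) x)] [IsManifold (𝓡 3) ∞ M] in
lemma aemeasurable_pt (x₀ : M) : AEMeasurable (pt x₀) (volume.restrict (tgt x₀)) :=
  (continuousOn_pt x₀).aemeasurable (measurableSet_tgt x₀)

omit [IsContMDiffRiemannianBundle (𝓡 3) ∞ E3 (fun x : M => TangentSpace (𝓡 3) x)]
  [RiemannianBundle (fun x : M => TangentSpace (𝓡 3) x)] [IsManifold (𝓡 3) ∞ M] in
lemma measurableSet_preimage_pt (x₀ : M) {A : Set M} (hA : MeasurableSet A) :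
    MeasurableSet (tgt x₀ ∩ pt x₀ ⁻¹' A) := by
  have h1 : Measurable (fun y : tgt x₀ => pt x₀ y) :=
    (continuousOn_iff_continuous_domRestrict.1 (continuousOn_pt x₀)).measurable
  have := (measurableSet_tgt x₀).subtype_image (h1 hA)
  convert this using 1
  ext y
  simp [and_comm]

lemma chartVolume_eq_map (x₀ : M) : chartVolume x₀ =
    Measure.map (pt x₀) ((volume.restrict (tgt x₀)).withDensity
      (fun y => ENNReal.ofReal (density x₀ y))) := rfl

lemma chartVolume_apply (x₀ : M) {A : Set M} (hA : MeasurableSet A) :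
    chartVolume x₀ A = ∫⁻ y in tgt x₀ ∩ pt x₀ ⁻¹' A, ENNReal.ofReal (density x₀ y) := by
  have h1 := measurableSet_preimage_pt x₀ hA
  have hac : (volume.restrict (tgt x₀)).withDensity (fun y => ENNReal.ofReal (density x₀ y)) ≪
    volume.restrict (tgt x₀) := withDensity_absolutelyContinuous _ _
  rw [chartVolume_eq_map, Measure.map_apply_of_aemeasurable
    ((aemeasurable_pt x₀).mono_ac hac) hA]
  have h2 : (pt x₀ ⁻¹' A : Set E3) =ᵐ[volume.restrict (tgt x₀)] (tgt x₀ ∩ pt x₀ ⁻¹' A : Set E3) := by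
    filter_upwards [ae_restrict_mem (measurableSet_tgt x₀)] with y hy
    exact propext ⟨fun h => ⟨hy, h⟩, fun h => h.2⟩
  rw [measure_congr (hac.ae_eq h2), withDensity_apply _ h1, Measure.restrict_restrict h1]
  congr 2
  ext y
  exact ⟨fun h => h.1, fun h => ⟨h, h.1⟩⟩

lemma chartVolume_inter_src (x₀ : M) {A : Set M} (hA : MeasurableSet A) :
    chartVolume x₀ (A ∩ src x₀) = chartVolume x₀ A := by
  rw [chartVolume_apply x₀ hA, chartVolume_apply x₀ (hA.inter (measurableSet_src x₀))]
  congr 2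
  ext y
  exact ⟨fun h => ⟨h.1, h.2.1⟩, fun h => ⟨h.1, h.2, pt_mem_src h.1⟩⟩

/-- Change of variables under the transition map; its Jacobian is the factor by which the densities
differ in `density_trans`. -/
lemma chartVolume_eq_of_subset {x₀ x₁ : M} {A : Set M} (hA : MeasurableSet A) (h₀ : A ⊆ src x₀)
    (h₁ : A ⊆ src x₁) : chartVolume x₀ A = chartVolume x₁ A := by
  rw [chartVolume_apply x₀ hA, chartVolume_apply x₁ hA]
  have e : tgt x₁ ∩ pt x₁ ⁻¹' A = trans x₀ x₁ '' (tgt x₀ ∩ pt x₀ ⁻¹' A) := by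
    ext y
    constructor
    · rintro ⟨hy, hyA⟩
      refine ⟨trans x₁ x₀ y, ⟨trans_mem_tgt (h₀ hyA), ?_⟩, ?_⟩
      · rw [mem_preimage, pt_trans (h₀ hyA)]
        exact hyA
      · rw [trans, pt_trans (h₀ hyA), crd_pt hy]
    · rintro ⟨z, ⟨hz, hzA⟩, rfl⟩
      refine ⟨trans_mem_tgt (h₁ hzA), ?_⟩
      rw [mem_preimage, pt_trans (h₁ hzA)]
      exact hzA
  rw [e, lintegral_image_eq_lintegral_abs_det_fderiv_mul volume (measurableSet_preimage_pt x₀ hA)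
    (f' := fderiv ℝ (trans x₀ x₁))]
  · refine setLIntegral_congr_fun (measurableSet_preimage_pt x₀ hA) fun y hy => ?_
    rw [density_trans hy.1 (h₁ hy.2), ENNReal.ofReal_mul (abs_nonneg _)]
  · intro y hy
    exact ((contDiffAt_trans hy.1 (h₁ hy.2)).differentiableAt (by simp)).hasFDerivAt.hasFDerivWithinAt
  · intro y hy z hz hyz
    have h : pt x₀ y = pt x₀ z := by
      rw [← pt_trans (h₁ hy.2), ← pt_trans (h₁ hz.2), hyz]
    rw [← crd_pt hy.1, ← crd_pt hz.1, h]

variable [SecondCountableTopology M]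

/-- On a chart domain the Riemannian volume is the volume of the chart. -/
lemma riemVolume_apply_of_subset {x₀ : M} {A : Set M} (hA : MeasurableSet A) (h₀ : A ⊆ src x₀) :
    riemVolume M A = chartVolume x₀ A := by
  refine le_antisymm ?_ (Measure.le_iff'.1 (le_iSup (fun x : M => chartVolume x) x₀) A)
  obtain ⟨s, hs, hcov⟩ := TopologicalSpace.countable_cover_nhds
    (fun x : M => (isOpen_src x).mem_nhds (mem_src_self x))
  have hne : s.Nonempty := by
    rcases s.eq_empty_or_nonempty with rfl | h
    · simp only [mem_empty_iff_false, iUnion_of_empty, iUnion_empty] at hcov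
      exact absurd (mem_univ x₀) (hcov ▸ notMem_empty x₀)
    · exact h
  obtain ⟨c, rfl⟩ := hs.exists_eq_range hne
  rw [biUnion_range] at hcov
  set D : ℕ → Set M := disjointed fun n => src (c n) with hD
  have hDm : ∀ n, MeasurableSet (D n) := MeasurableSet.disjointed fun n => measurableSet_src (c n)
  have hDs : ∀ n, D n ⊆ src (c n) := fun n => disjointed_subset _ n
  have hDu : ⋃ n, D n = univ := by rw [hD, iUnion_disjointed, hcov]
  have hDd : Pairwise (Function.onFun Disjoint D) := disjoint_disjointed _
  have split : ∀ (y : M) {B : Set M}, MeasurableSet B →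
      chartVolume y B = ∑' n, chartVolume y (B ∩ D n) := by
    intro y B hB
    rw [← measure_iUnion (fun i j hij => (hDd hij).mono inter_subset_right inter_subset_right)
      (fun n => hB.inter (hDm n)), ← inter_iUnion, hDu, inter_univ]
  -- The measure `κ` is glued from chart measures along a countable disjoint refinement of a cover
  -- by chart domains. It dominates every chart measure, hence their supremum, and on subsets of the
  -- chart around `x₀` it equals that chart's measure.
  set κ : Measure M := Measure.sum fun n => (chartVolume (c n)).restrict (D n) with hκ
  have hκa : ∀ {B : Set M}, MeasurableSet B → κ B = ∑' n, chartVolume (c n) (B ∩ D n) := by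
    intro B hB
    rw [hκ, Measure.sum_apply _ hB]
    exact tsum_congr fun n => Measure.restrict_apply hB
  have hle : riemVolume M ≤ κ := by
    refine iSup_le fun y => Measure.le_iff.2 fun B hB => ?_
    rw [split y hB, hκa hB]
    refine ENNReal.tsum_le_tsum fun n => ?_
    rw [← chartVolume_inter_src y (hB.inter (hDm n)), chartVolume_eq_of_subset (x₁ := c n)
      ((hB.inter (hDm n)).inter (measurableSet_src y)) inter_subset_right
      ((inter_subset_left.trans inter_subset_right).trans (hDs n))]
    exact measure_mono inter_subset_left
  refine (Measure.le_iff'.1 hle A).trans (le_of_eq ?_)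
  rw [hκa hA, split x₀ hA]
  exact tsum_congr fun n => chartVolume_eq_of_subset (hA.inter (hDm n))
    (inter_subset_right.trans (hDs n)) (inter_subset_left.trans h₀)

lemma restrict_riemVolume (x₀ : M) : (riemVolume M).restrict (src x₀) = chartVolume x₀ := by
  ext A hA
  rw [Measure.restrict_apply hA, riemVolume_apply_of_subset (hA.inter (measurableSet_src x₀))
    inter_subset_right, chartVolume_inter_src x₀ hA]

omit [MeasurableSpace M] [BorelSpace M] [SecondCountableTopology M] in
lemma contDiffAt_density {x₀ : M} {y : E3} (hy : y ∈ tgt x₀) : ContDiffAt ℝ ∞ (density x₀) y :=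
  contDiffAt_sqrt_det hy

omit [MeasurableSpace M] [BorelSpace M] [SecondCountableTopology M] in
lemma continuousOn_density (x₀ : M) : ContinuousOn (density x₀) (tgt x₀) :=
  fun _ hy => (contDiffAt_density hy).continuousAt.continuousWithinAt

/-- Integration over a chart domain. -/
lemma setIntegral_src (x₀ : M) (f : M → ℝ) (hf : ContinuousOn f (src x₀)) :
    ∫ x in src x₀, f x ∂(riemVolume M) = ∫ y in tgt x₀, density x₀ y * f (pt x₀ y) := by
  have hac : (volume.restrict (tgt x₀)).withDensity (fun y => ENNReal.ofReal (density x₀ y)) ≪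
    volume.restrict (tgt x₀) := withDensity_absolutelyContinuous _ _
  have hd : AEMeasurable (density x₀) (volume.restrict (tgt x₀)) :=
    (continuousOn_density x₀).aemeasurable (measurableSet_tgt x₀)
  rw [restrict_riemVolume, chartVolume_eq_map, integral_map ((aemeasurable_pt x₀).mono_ac hac),
    integral_withDensity_eq_integral_toReal_smul₀ hd.ennreal_ofReal]
  · refine integral_congr_ae (Filter.Eventually.of_forall fun y => ?_)
    simp only [smul_eq_mul]
    rw [ENNReal.toReal_ofReal (show 0 ≤ density x₀ y from Real.sqrt_nonneg _)]
  · exact Filter.Eventually.of_forall fun _ => ENNReal.ofReal_lt_top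
  · rw [← chartVolume_eq_map, ← restrict_riemVolume]
    exact hf.aestronglyMeasurable (measurableSet_src x₀)

/-- A compact coordinate neighbourhood has finite volume because the density is continuous on it.
Hence continuous functions of compact support are integrable. -/
lemma isLocallyFiniteMeasure_riemVolume : IsLocallyFiniteMeasure (riemVolume M) := by
  refine ⟨fun x => ?_⟩
  obtain ⟨K, hK, hxK, hKt⟩ := exists_compact_subset (isOpen_tgt x) (ctr_mem_tgt x)
  have hA : IsCompact (pt x '' K) := hK.image_of_continuousOn ((continuousOn_pt x).mono hKt)
  have hAs : pt x '' K ⊆ src x := by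
    rintro _ ⟨y, hy, rfl⟩
    exact pt_mem_src (hKt hy)
  refine ⟨pt x '' K, ?_, ?_⟩
  · have h1 : ContinuousAt (crd x) x :=
      (continuousOn_crd x).continuousAt ((isOpen_src x).mem_nhds (mem_src_self x))
    filter_upwards [h1 (mem_interior_iff_mem_nhds.1 hxK), (isOpen_src x).mem_nhds (mem_src_self x)]
      with q hq hqs
    exact ⟨crd x q, hq, pt_crd hqs⟩
  · rw [riemVolume_apply_of_subset hA.measurableSet hAs, chartVolume_apply x hA.measurableSet]
    have e : tgt x ∩ pt x ⁻¹' (pt x '' K) = K := by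
      ext y
      constructor
      · rintro ⟨hy, z, hz, hzy⟩
        rwa [← crd_pt hy, ← hzy, crd_pt (hKt hz)]
      · exact fun hy => ⟨hKt hy, y, hy, rfl⟩
    rw [e]
    exact (((continuousOn_density x).mono hKt).integrableOn_compact hK).lintegral_lt_top

lemma integral_of_forall_notMem_src (x₀ : M) (f : M → ℝ) (hf : ContinuousOn f (src x₀))
    (h0 : ∀ x ∉ src x₀, f x = 0) :
    ∫ x, f x ∂(riemVolume M) = ∫ y in tgt x₀, density x₀ y * f (pt x₀ y) := by
  rw [← setIntegral_src x₀ f hf, setIntegral_eq_integral_of_forall_compl_eq_zero h0]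

end Volume

attribute [local instance] isLocallyFiniteMeasure_riemVolume

/-! ### Hopf-Rinow for approximate length spaces, and cutoff functions. -/

section HopfRinow

open scoped ENNReal NNReal
open Metric Filter

/-- Intermediate points: the length-space property in approximate form. -/
def HasIntermediatePoints (X : Type*) [EMetricSpace X] : Prop :=
  ∀ (x y : X) (a b : ℝ≥0∞), edist x y < a + b → a ≠ ⊤ → 0 < b →
    ∃ z, edist x z ≤ a ∧ edist z y < b

variable {X : Type*} [EMetricSpace X]

/-- With `δ < ε/2`, every point of the `R`-ball lies within `ε/2` of the compact ball of radius `R -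
δ`, so a finite `ε/2`-net of the latter is an `ε`-net of the former. If `δ > R` the truncated
difference is `0` and the estimate still holds. -/
lemma HasIntermediatePoints.totallyBounded_closedEBall (hX : HasIntermediatePoints X) {x : X}
    {R : ℝ≥0} (hR : 0 < R) (h : ∀ s < R, IsCompact (closedEBall x (s : ℝ≥0∞))) :
    TotallyBounded (closedEBall x (R : ℝ≥0∞)) := by
  rw [EMetric.totallyBounded_iff]
  intro ε hε
  obtain ⟨δ, hδ, hδε⟩ := ENNReal.lt_iff_exists_nnreal_btwn.1 (ENNReal.half_pos hε.ne')
  have hδ0 : 0 < δ := by simpa using hδ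
  obtain ⟨t, ht, hcov⟩ := EMetric.totallyBounded_iff.1
    (h (R - δ) (tsub_lt_self hR hδ0)).totallyBounded (ε / 2) (ENNReal.half_pos hε.ne')
  refine ⟨t, ht, fun y hy => ?_⟩
  have hy' : edist x y < ((R - δ : ℝ≥0) : ℝ≥0∞) + ε / 2 := by
    calc edist x y ≤ R := by rw [edist_comm]; exact hy
      _ ≤ ((R - δ : ℝ≥0) : ℝ≥0∞) + δ := by
        rw [← ENNReal.coe_add]
        exact ENNReal.coe_le_coe.2 le_tsub_add
      _ < _ := by
        exact ENNReal.add_lt_add_left ENNReal.coe_ne_top hδε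
  obtain ⟨z, hz, hzy⟩ := hX x y _ _ hy' ENNReal.coe_ne_top (ENNReal.half_pos hε.ne')
  have hz' : z ∈ closedEBall x ((R - δ : ℝ≥0) : ℝ≥0∞) := by
    rw [mem_closedEBall, edist_comm]
    exact hz
  obtain ⟨w, hw, hzw⟩ := mem_iUnion₂.1 (hcov hz')
  refine mem_iUnion₂.2 ⟨w, hw, ?_⟩
  rw [mem_eball] at hzw ⊢
  calc edist y w ≤ edist y z + edist z w := edist_triangle _ _ _
    _ < ε / 2 + ε / 2 := ENNReal.add_lt_add (by rwa [edist_comm]) hzw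
    _ = ε := ENNReal.add_halves ε

/-- The Hopf-Rinow theorem: closed balls of finite radius are compact. -/
theorem HasIntermediatePoints.isCompact_closedEBall [CompleteSpace X] [LocallyCompactSpace X]
    (hX : HasIntermediatePoints X) (x : X) (r : ℝ≥0) : IsCompact (closedEBall x (r : ℝ≥0∞)) := by
  by_contra hr
  -- The supremum `R` of the radii of compact balls is attained, by total boundedness and
  -- completeness. A compact neighbourhood of that ball then contains a strictly larger one, a
  -- contradiction.
  set S : Set ℝ≥0 := {s | IsCompact (closedEBall x (s : ℝ≥0∞))} with hS
  have hmono : ∀ s t : ℝ≥0, s ≤ t → t ∈ S → s ∈ S := fun s t hst ht =>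
    IsCompact.of_isClosed_subset ht isClosed_closedEBall
      (closedEBall_subset_closedEBall (ENNReal.coe_le_coe.2 hst))
  have h0 : (0 : ℝ≥0) ∈ S := by
    simp only [hS, mem_ofPred_eq, ENNReal.coe_zero, closedEBall_zero]
    exact isCompact_singleton
  have hb : BddAbove S := ⟨r, fun s hs => le_of_lt (lt_of_not_ge fun h => hr (hmono r s h hs))⟩
  set R := sSup S with hRdef
  have hlt : ∀ s < R, s ∈ S := fun s hs => by
    obtain ⟨t, ht, hst⟩ := exists_lt_of_lt_csSup ⟨0, h0⟩ hs
    exact hmono s t hst.le ht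
  have hR : R ∈ S := by
    rcases eq_or_lt_of_le (show 0 ≤ R from zero_le) with h | h
    · rw [← h]; exact h0
    · exact isCompact_iff_totallyBounded_isComplete.2
        ⟨hX.totallyBounded_closedEBall h hlt, isClosed_closedEBall.isComplete⟩
  obtain ⟨δ, hδ, hδc⟩ := IsCompact.exists_isCompact_cthickening (s := closedEBall x (R : ℝ≥0∞)) hR
  have hδ' : 0 < (δ / 2).toNNReal := by simpa using hδ
  -- The radius grows by `δ/2` only, since intermediate points need the strict inequality `edist x y
  -- < R + δ`.
  have hmem : R + (δ / 2).toNNReal ∈ S := by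
    refine IsCompact.of_isClosed_subset hδc isClosed_closedEBall fun y hy => ?_
    have hy' : edist x y < (R : ℝ≥0∞) + ENNReal.ofReal δ := by
      rw [edist_comm]
      refine lt_of_le_of_lt (b := ((R + (δ / 2).toNNReal : ℝ≥0) : ℝ≥0∞)) hy ?_
      rw [ENNReal.coe_add]
      refine ENNReal.add_lt_add_left ENNReal.coe_ne_top ?_
      exact (ENNReal.ofReal_lt_ofReal_iff hδ).2 (half_lt_self hδ)
    obtain ⟨z, hz, hzy⟩ := hX x y _ _ hy' ENNReal.coe_ne_top (ENNReal.ofReal_pos.2 hδ)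
    have hz' : z ∈ closedEBall x (R : ℝ≥0∞) := by
      rw [mem_closedEBall, edist_comm]
      exact hz
    rw [mem_cthickening_iff]
    refine (infEDist_le_edist_of_mem hz').trans ?_
    rw [edist_comm]
    exact hzy.le
  have := le_csSup hb hmem
  exact absurd this (not_le.2 (lt_add_of_pos_right R hδ'))

/-- A space whose finite balls are compact has compactly supported cutoff functions with small
Lipschitz constants. -/
theorem exists_cutoff [SecondCountableTopology X]
    (hX : ∀ (x : X) (r : ℝ≥0), IsCompact (closedEBall x (r : ℝ≥0∞))) :
    ∃ χ : ℕ → X → ℝ, (∀ n : ℕ, LipschitzWith ((n : ℝ≥0) + 1)⁻¹ (χ n)) ∧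
      (∀ n, HasCompactSupport (χ n)) ∧ (∀ n x, 0 ≤ χ n x) ∧ (∀ n x, χ n x ≤ 1) ∧
      ∀ x, Tendsto (fun n => χ n x) atTop (𝓝 1) := by
  rcases isEmpty_or_nonempty X with hE | hE
  · refine ⟨fun _ _ => 0, fun n x => hE.elim x, fun n => ?_, fun _ _ => le_rfl,
      fun _ _ => zero_le_one, fun x => hE.elim x⟩
    exact HasCompactSupport.zero
  -- The cutoff is the indicator of the first `n + 1` points of a dense sequence, thickened by `n +
  -- 1`. Several centres are used rather than one because points of different components may be at
  -- infinite distance.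
  set F : ℕ → Set X := fun n => TopologicalSpace.denseSeq X '' (Iic n) with hF
  have hpos : ∀ n : ℕ, (0 : ℝ) < (n + 1 : ℝ) := fun n => by positivity
  have hlip : ∀ n : ℕ, LipschitzWith (n + 1 : ℝ≥0)⁻¹
      (fun x => (thickenedIndicator (hpos n) (F n) x : ℝ)) := by
    intro n
    have h := lipschitzWith_thickenedIndicator (hpos n) (F n)
    have e : (n + 1 : ℝ).toNNReal = (n + 1 : ℝ≥0) := by
      rw [Real.toNNReal_add (by positivity) zero_le_one]
      simp
    rw [e] at h
    exact fun x y => h x y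
  refine ⟨fun n x => thickenedIndicator (hpos n) (F n) x, hlip, fun n => ?_,
    fun n x => NNReal.coe_nonneg _, fun n x => ?_, fun x => ?_⟩
  · have hK : IsCompact (⋃ i ∈ Iic n, closedEBall (TopologicalSpace.denseSeq X i)
        (((n + 1 : ℝ).toNNReal : ℝ≥0) : ℝ≥0∞)) :=
      (finite_Iic n).isCompact_biUnion fun i _ => hX _ _
    refine HasCompactSupport.intro hK fun x hx => ?_
    refine NNReal.coe_eq_zero.2 (thickenedIndicator_zero (hpos n) (F n) fun hxt => ?_)
    refine hx ?_
    rw [mem_thickening_iff_exists_edist_lt] at hxt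
    obtain ⟨_, ⟨i, hi, rfl⟩, hxi⟩ := hxt
    exact mem_iUnion₂.2 ⟨i, hi, hxi.le⟩
  · exact_mod_cast thickenedIndicator_le_one (hpos n) (F n) x
  · obtain ⟨k, hk⟩ := (TopologicalSpace.denseRange_denseSeq X).exists_mem_open
      isOpen_eball (⟨x, mem_eball_self (zero_lt_one' ℝ≥0∞)⟩ : (eball x (1 : ℝ≥0∞)).Nonempty)
    -- The point `x` is within distance `1` of the `k`-th dense point, where `χₙ = 1` once `n ≥ k`;
    -- the Lipschitz bound does the rest.
    have h1 : ∀ n ≥ k, 1 - (n + 1 : ℝ)⁻¹ ≤ thickenedIndicator (hpos n) (F n) x := by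
      intro n hn
      have h2 : thickenedIndicator (hpos n) (F n) (TopologicalSpace.denseSeq X k) = 1 :=
        thickenedIndicator_one (hpos n) (F n) ⟨k, hn, rfl⟩
      have h3 := hlip n (TopologicalSpace.denseSeq X k) x
      simp only [h2, NNReal.coe_one] at h3
      rw [edist_dist, Real.dist_eq] at h3
      have h4 : ENNReal.ofReal |1 - (thickenedIndicator (hpos n) (F n) x : ℝ)| ≤
          ENNReal.ofReal ((n + 1 : ℝ)⁻¹) := by
        refine h3.trans ?_
        refine (mul_le_mul_right (mem_eball.1 hk).le _).trans (le_of_eq ?_)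
        rw [mul_one, ENNReal.ofReal, ENNReal.coe_inj]
        ext
        rw [Real.coe_toNNReal _ (by positivity)]
        push_cast
        rfl
      rw [ENNReal.ofReal_le_ofReal_iff (by positivity)] at h4
      linarith [le_abs_self (1 - (thickenedIndicator (hpos n) (F n) x : ℝ))]
    refine tendsto_of_tendsto_of_tendsto_of_le_of_le' (g := fun n : ℕ => 1 - (n + 1 : ℝ)⁻¹)
      (h := fun _ => 1) ?_ tendsto_const_nhds (eventually_atTop.2 ⟨k, h1⟩)
      (Eventually.of_forall fun n => ?_)
    · have := (tendsto_one_div_add_atTop_nhds_zero_nat (𝕜 := ℝ)).const_sub 1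
      simpa using this
    · exact_mod_cast thickenedIndicator_le_one (hpos n) (F n) x

end HopfRinow

/-! ### The Riemannian distance as a length metric. -/

section LengthSpace

open scoped ENNReal NNReal

variable {M : Type*} [EMetricSpace M] [ChartedSpace E3 M] [IsManifold (𝓡 3) ∞ M]
variable [RiemannianBundle (fun x : M => TangentSpace (𝓡 3) x)]
variable [IsRiemannianManifold (𝓡 3) M]

/-- On a path of length less than `a + b`, the intermediate value theorem finds a point at distance
exactly `a` from `x`. The initial piece has length at least `a`, so less than `b` remains. -/
lemma hasIntermediatePoints : HasIntermediatePoints M := by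
  intro x y a b hab ha hb
  rcases lt_or_ge (edist x y) a with h | h
  · exact ⟨y, h.le, by rwa [edist_self]⟩
  rw [IsRiemannianManifold.out (I := 𝓡 3) x y] at hab
  obtain ⟨γ, hγ0, hγ1, hγ, hL⟩ := exists_lt_of_riemannianEDist_lt hab
  have hc : ContinuousOn (fun t => edist x (γ t)) (Icc 0 1) :=
    continuous_const.edist continuous_id |>.comp_continuousOn hγ.continuousOn
  have hmem : a ∈ Icc (edist x (γ 0)) (edist x (γ 1)) := by
    rw [hγ0, hγ1, edist_self]
    exact ⟨zero_le, h⟩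
  obtain ⟨t, ht, hta⟩ := intermediate_value_Icc zero_le_one hc hmem
  refine ⟨γ t, hta.le, ?_⟩
  have h1 : a ≤ pathELength (𝓡 3) γ 0 t := by
    rw [← hta]
    change edist x (γ t) ≤ _
    rw [IsRiemannianManifold.out (I := 𝓡 3) x (γ t)]
    exact riemannianEDist_le_pathELength (hγ.mono (Icc_subset_Icc_right ht.2)) hγ0 rfl ht.1
  have h2 : edist (γ t) y ≤ pathELength (𝓡 3) γ t 1 := by
    rw [IsRiemannianManifold.out (I := 𝓡 3) (γ t) y]
    exact riemannianEDist_le_pathELength (hγ.mono (Icc_subset_Icc_left ht.1)) rfl hγ1 ht.2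
  refine h2.trans_lt ?_
  rw [← pathELength_add ht.1 ht.2] at hL
  have h3 : a + pathELength (𝓡 3) γ t 1 < a + b := (add_le_add_left h1 _).trans_lt hL
  exact (ENNReal.add_lt_add_iff_left ha).1 h3

omit [RiemannianBundle (fun x : M => TangentSpace (𝓡 3) x)] [IsRiemannianManifold (𝓡 3) M] in
lemma mfderiv_pt {x₀ : M} {y : E3} (hy : y ∈ tgt x₀) (v : E3) :
    mfderiv 𝓘(ℝ, E3) (𝓡 3) (pt x₀) y v = frame x₀ (pt x₀ y) v := by
  have := isManifold_one_three (M := M)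
  have h := TangentBundle.symmL_trivializationAt (𝕜 := ℝ) (I := 𝓡 3) (pt_mem_src hy)
  have h1 : extChartAt (𝓡 3) x₀ (pt x₀ y) = y := crd_pt hy
  rw [h1, ModelWithCorners.Boundaryless.range_eq_univ, mfderivWithin_univ] at h
  exact (DFunLike.congr_fun h v).symm

/-- The Riemannian distance between two points of a chart is at most the length of the
coordinate segment. -/
lemma edist_pt_le {x₀ : M} {y v : E3} {C : ℝ} (hs : ∀ s ∈ Icc (0 : ℝ) 1, y + s • v ∈ tgt x₀)
    (hC : ∀ s ∈ Icc (0 : ℝ) 1, ‖frame x₀ (pt x₀ (y + s • v)) v‖ ≤ C) :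
    edist (pt x₀ y) (pt x₀ (y + v)) ≤ ENNReal.ofReal C := by
  set γ : ℝ → M := fun s => pt x₀ (y + s • v) with hγ
  have hline : ContDiff ℝ ∞ (fun s : ℝ => y + s • v) :=
    contDiff_const.add (contDiff_id.smul contDiff_const)
  have hγs : ContMDiffOn 𝓘(ℝ, ℝ) (𝓡 3) 1 γ (Icc 0 1) :=
    ((contMDiffOn_pt x₀).comp hline.contMDiff.contMDiffOn hs).of_le (by simp)
  have hm : ∀ s ∈ Icc (0 : ℝ) 1, mfderiv 𝓘(ℝ, ℝ) (𝓡 3) γ s 1 = frame x₀ (γ s) v := by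
    intro s h
    have h1 : HasMFDerivAt 𝓘(ℝ, ℝ) 𝓘(ℝ, E3) (fun s : ℝ => y + s • v) s
        (ContinuousLinearMap.toSpanSingleton ℝ v) := by
      refine HasFDerivAt.hasMFDerivAt ?_
      have := ((hasDerivAt_id s).smul_const v).const_add y
      have h : HasFDerivAt (fun s : ℝ => y + s • v) _ s := this.hasFDerivAt
      rwa [one_smul] at h
    have h2 : HasMFDerivAt 𝓘(ℝ, E3) (𝓡 3) (pt x₀) (y + s • v)
        (mfderiv 𝓘(ℝ, E3) (𝓡 3) (pt x₀) (y + s • v)) :=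
      (((contMDiffOn_pt x₀).contMDiffAt (tgt_mem_nhds (hs s h))).mdifferentiableAt
        (by simp)).hasMFDerivAt
    have h3 := (h2.comp s h1).mfderiv
    have h4 : mfderiv 𝓘(ℝ, ℝ) (𝓡 3) γ s 1 =
        mfderiv 𝓘(ℝ, E3) (𝓡 3) (pt x₀) (y + s • v) ((1 : ℝ) • v) := DFunLike.congr_fun h3 1
    rw [h4, one_smul, mfderiv_pt (hs s h)]
  rw [IsRiemannianManifold.out (I := 𝓡 3)]
  refine (riemannianEDist_le_pathELength hγs (by simp [hγ]) (by simp [hγ]) zero_le_one).trans ?_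
  rw [pathELength_eq_lintegral_mfderiv_Icc]
  calc ∫⁻ t in Icc (0 : ℝ) 1, ‖mfderiv 𝓘(ℝ, ℝ) (𝓡 3) γ t 1‖ₑ
      ≤ ∫⁻ t in Icc (0 : ℝ) 1, ENNReal.ofReal C := by
        refine setLIntegral_mono measurable_const fun s h => ?_
        rw [hm s h, ← ofReal_norm]
        exact ENNReal.ofReal_le_ofReal (hC s h)
    _ = ENNReal.ofReal C := by simp

end LengthSpace

/-! ### Integration by parts against Lipschitz functions on Euclidean space. -/

section IntegrationByParts

open scoped NNReal

/-- Integration by parts against a Lipschitz function on `ℝ³`, as an estimate. -/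
lemma abs_integral_mul_sum_pd_le {f : E3 → ℝ} {C : ℝ≥0} (hf : LipschitzWith C f)
    {h : Fin 3 → E3 → ℝ} (hh : ∀ i, ContDiff ℝ ∞ (h i)) (hc : ∀ i, HasCompactSupport (h i))
    {B : E3 → ℝ} (hB : Integrable B) (hfB : ∀ y, DifferentiableAt ℝ f y →
      |fderiv ℝ f y (WithLp.toLp 2 fun i => h i y)| ≤ B y) :
    |∫ y, f y * ∑ i, pd i (h i) y| ≤ ∫ y, B y := by
  have hlip : ∀ i, ∃ D, LipschitzWith D (h i) := fun i =>
    ContDiff.lipschitzWith_of_hasCompactSupport (hc i) (hh i) (by simp)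
  have hpd : ∀ i y, lineDeriv ℝ (h i) y (-EuclideanSpace.single i 1) = - pd i (h i) y := by
    intro i y
    rw [((hh i).differentiable (by simp)).differentiableAt.lineDeriv_eq_fderiv, map_neg]
    rfl
  have h1 : ∀ i, ∫ y, f y * pd i (h i) y =
      - ∫ y, lineDeriv ℝ f y (EuclideanSpace.single i 1) * h i y := by
    intro i
    obtain ⟨D, hD⟩ := hlip i
    rw [hf.integral_lineDeriv_mul_eq hD (hc i), ← integral_neg]
    refine integral_congr_ae (Filter.Eventually.of_forall fun y => ?_)
    simp only [hpd]
    ring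
  have hpdc : ∀ i, Continuous (pd i (h i)) := fun i =>
    ((hh i).continuous_fderiv (by simp)).clm_apply continuous_const
  have hpds : ∀ i, HasCompactSupport (pd i (h i)) := fun i =>
    (hc i).fderiv_apply (𝕜 := ℝ) (EuclideanSpace.single i 1)
  have i1 : ∀ i, Integrable fun y => f y * pd i (h i) y := fun i =>
    (hf.continuous.mul (hpdc i)).integrable_of_hasCompactSupport ((hpds i).mul_left)
  have i2 : ∀ i, Integrable fun y => lineDeriv ℝ f y (EuclideanSpace.single i 1) * h i y :=
    fun i => ((hh i).continuous.integrable_of_hasCompactSupport (hc i)).bdd_mul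
      (aestronglyMeasurable_lineDeriv hf.continuous volume)
      (Filter.Eventually.of_forall fun y => norm_lineDeriv_le_of_lipschitz ℝ hf)
  have e1 : ∫ y, f y * ∑ i, pd i (h i) y =
      - ∫ y, ∑ i, lineDeriv ℝ f y (EuclideanSpace.single i 1) * h i y := by
    simp only [Finset.mul_sum]
    rw [integral_finsetSum _ fun i _ => i1 i, integral_finsetSum _ fun i _ => i2 i,
      ← Finset.sum_neg_distrib]
    exact Finset.sum_congr rfl fun i _ => h1 i
  rw [e1, abs_neg, ← Real.norm_eq_abs]
  refine norm_integral_le_of_norm_le hB ?_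
  -- By Rademacher's theorem it is enough that the pointwise bound holds where `f` is
  -- differentiable.
  filter_upwards [hf.ae_differentiableAt] with y hy
  refine le_trans (le_of_eq ?_) (hfB y hy)
  rw [Real.norm_eq_abs]
  congr 1
  conv_rhs => rw [single_sum (WithLp.toLp 2 fun i => h i y), map_sum]
  refine Finset.sum_congr rfl fun i _ => ?_
  rw [hy.lineDeriv_eq_fderiv, map_smul, smul_eq_mul, mul_comm]

end IntegrationByParts

/-! ### Riemannian Lipschitz functions in coordinates. -/

section Local

open scoped NNReal ENNReal
open Metric

variable {M : Type*} [EMetricSpace M] [ChartedSpace E3 M] [IsManifold (𝓡 3) ∞ M]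
variable [RiemannianBundle (fun x : M => TangentSpace (𝓡 3) x)]
variable [IsContMDiffRiemannianBundle (𝓡 3) ∞ E3 (fun x : M => TangentSpace (𝓡 3) x)]

lemma norm_frame (x₀ : M) (y v : E3) : ‖frame x₀ (pt x₀ y) v‖ = √(metricForm x₀ y v v) := by
  rw [metricForm_apply]
  exact norm_eq_sqrt_real_inner _

lemma continuousAt_norm_frame {x₀ : M} {y : E3} (hy : y ∈ tgt x₀) (v : E3) :
    ContinuousAt (fun z => ‖frame x₀ (pt x₀ z) v‖) y := by
  simp only [norm_frame]
  exact (((contDiffAt_metricForm hy).continuousAt.clm_apply continuousAt_const).clm_apply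
    continuousAt_const).sqrt

lemma vecVec_frame {x₀ : M} {y : E3} (hy : y ∈ tgt x₀) (X : VField M) :
    frame x₀ (pt x₀ y) (vecVec x₀ X y) = X (pt x₀ y) := frame_coframe (pt_mem_src hy) _

lemma LipschitzWith.abs_sub_le {f : M → ℝ} {L : ℝ≥0} (hf : LipschitzWith L f) {a b : M} {C : ℝ}
    (hC : 0 ≤ C) (h : edist a b ≤ ENNReal.ofReal C) : |f a - f b| ≤ L * C := by
  have h1 := (hf a b).trans (mul_le_mul_right h _)
  rw [edist_dist, Real.dist_eq, ← ENNReal.ofReal_coe_nnreal, ← ENNReal.ofReal_mul L.coe_nonneg,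
    ENNReal.ofReal_le_ofReal_iff (by positivity)] at h1
  exact h1

variable [IsRiemannianManifold (𝓡 3) M]

/-- By continuity the metric form is bounded on a small ball, and coordinate segments stay in it by
convexity. Hence functions that are Lipschitz on the manifold are locally Lipschitz in coordinates,
as Rademacher's theorem requires. -/
lemma exists_edist_pt_le (x₀ : M) : ∃ C : ℝ≥0, ∃ r > 0, closedBall (ctr x₀) r ⊆ tgt x₀ ∧
    ∀ y ∈ ball (ctr x₀) r, ∀ z ∈ ball (ctr x₀) r,
      edist (pt x₀ y) (pt x₀ z) ≤ ENNReal.ofReal (C * ‖z - y‖) := by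
  have hx := ctr_mem_tgt x₀
  set B := ‖metricForm x₀ (ctr x₀)‖ + 1 with hB
  have h1 : ∀ᶠ y in 𝓝 (ctr x₀), ‖metricForm x₀ y‖ < B ∧ y ∈ tgt x₀ :=
    ((contDiffAt_metricForm hx).continuousAt.norm.eventually_lt_const (by simp [hB])).and
      (tgt_mem_nhds hx)
  obtain ⟨r, hr, hrB⟩ := Metric.eventually_nhds_iff_ball.1 h1
  refine ⟨⟨√B, Real.sqrt_nonneg _⟩, r / 2, half_pos hr, fun y hy =>
    (hrB y (closedBall_subset_ball (half_lt_self hr) hy)).2, fun y hy z hz => ?_⟩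
  have hseg : ∀ s ∈ Icc (0 : ℝ) 1, y + s • (z - y) ∈ ball (ctr x₀) r := fun s hs =>
    ball_subset_ball (half_le_self hr.le)
      ((convex_ball _ _).add_smul_sub_mem hy hz hs)
  have h2 := edist_pt_le (x₀ := x₀) (y := y) (v := z - y) (C := √B * ‖z - y‖)
    (fun s hs => (hrB _ (hseg s hs)).2) fun s hs => ?_
  · rwa [add_sub_cancel] at h2
  · rw [norm_frame, ← Real.sqrt_sq (norm_nonneg (z - y)), ← Real.sqrt_mul (by positivity)]
    refine Real.sqrt_le_sqrt ((le_abs_self _).trans ?_)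
    refine ((metricForm x₀ _).le_opNorm₂ _ _).trans ?_
    rw [mul_assoc, ← sq]
    gcongr
    exact (hrB _ (hseg s hs)).1.le

/-- The differential of a Lipschitz function is bounded by the Lipschitz constant. -/
lemma abs_fderiv_le {χ : M → ℝ} {L : ℝ≥0} (hχ : LipschitzWith L χ) {x₀ : M} {y : E3}
    (hy : y ∈ tgt x₀) {f : E3 → ℝ} (hf : f =ᶠ[𝓝 y] fun z => χ (pt x₀ z))
    (hd : DifferentiableAt ℝ f y) (v : E3) :
    |fderiv ℝ f y v| ≤ L * ‖frame x₀ (pt x₀ y) v‖ := by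
  set N := ‖frame x₀ (pt x₀ y) v‖
  -- The length of `v` varies along the segment, but near `y` it stays below `N + ε`. Difference
  -- quotients are bounded with this loss, which is removed at the end; this keeps the sharp
  -- constant `L`.
  refine le_of_forall_pos_le_add fun ε' hε' => ?_
  obtain ⟨ε, hε, hLε⟩ : ∃ ε > 0, L * ε ≤ ε' :=
    ⟨ε' / (L + 1), by positivity, by
      rw [mul_div_assoc', div_le_iff₀ (by positivity)]
      nlinarith [L.coe_nonneg]⟩
  have hgood : ∀ᶠ z in 𝓝 y, ‖frame x₀ (pt x₀ z) v‖ < N + ε ∧ z ∈ tgt x₀ ∧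
      f z = χ (pt x₀ z) :=
    ((continuousAt_norm_frame hy v).eventually_lt_const (by simp [N, hε])).and
      (Filter.Eventually.and (p := fun z => z ∈ tgt x₀) (tgt_mem_nhds hy) hf)
  obtain ⟨r, hr, hgood⟩ := Metric.eventually_nhds_iff_ball.1 hgood
  have hlim : Filter.Tendsto (fun s : ℝ => |s⁻¹ • (f (y + (0 + s) • v) - f (y + (0 : ℝ) • v))|)
      (𝓝[>] 0) (𝓝 |fderiv ℝ f y v|) :=
    (HasDerivAt.tendsto_slope_zero_right (hd.hasFDerivAt.hasLineDerivAt v)).abs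
  have hsmall : ∀ᶠ s : ℝ in 𝓝[>] 0, s * ‖v‖ < r := by
    have : ContinuousAt (fun s : ℝ => s * ‖v‖) 0 := by fun_prop
    exact (this.eventually_lt_const (by simpa using hr)).filter_mono nhdsWithin_le_nhds
  have hbd : |fderiv ℝ f y v| ≤ L * (N + ε) := by
    refine le_of_tendsto hlim ?_
    filter_upwards [hsmall, self_mem_nhdsWithin] with s hs hs0
    have hs0 : 0 < s := hs0
    have hball : ∀ τ ∈ Icc (0 : ℝ) 1, y + τ • (s • v) ∈ ball y r := by
      intro τ hτ
      rw [mem_ball, dist_eq_norm, add_sub_cancel_left, norm_smul, norm_smul,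
        Real.norm_of_nonneg hτ.1, Real.norm_of_nonneg hs0.le]
      exact (mul_le_of_le_one_left (by positivity) hτ.2).trans_lt hs
    have hN : 0 ≤ N + ε := by positivity
    have h1 := edist_pt_le (x₀ := x₀) (y := y) (v := s • v) (C := s * (N + ε))
      (fun τ hτ => (hgood _ (hball τ hτ)).2.1) fun τ hτ => by
        rw [map_smul, norm_smul, Real.norm_of_nonneg hs0.le]
        exact mul_le_mul_of_nonneg_left (hgood _ (hball τ hτ)).1.le hs0.le
    have h2 := LipschitzWith.abs_sub_le hχ (by positivity) h1
    have e0 : f (y + (0 : ℝ) • v) = χ (pt x₀ y) := by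
      rw [zero_smul, add_zero]
      exact (hgood y (mem_ball_self hr)).2.2
    have e1 : f (y + (0 + s) • v) = χ (pt x₀ (y + s • v)) := by
      rw [zero_add]
      have := hball 1 ⟨zero_le_one, le_rfl⟩
      rw [one_smul] at this
      exact (hgood _ this).2.2
    rw [e0, e1, smul_eq_mul, abs_mul, abs_inv, abs_of_pos hs0, abs_sub_comm,
      inv_mul_le_iff₀ hs0]
    linarith
  linarith [mul_add (L : ℝ) N ε]

end Local

/-! ### Continuity, locality and finite sums for the divergence. -/

section Smooth

variable {M : Type*} [EMetricSpace M] [ChartedSpace E3 M] [IsManifold (𝓡 3) ∞ M]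

lemma SmoothF.continuous {f : M → ℝ} (hf : SmoothF f) : Continuous f := by
  rw [continuous_iff_continuousAt]
  intro x
  have h1 : ContinuousAt (fun y => f (pt x y)) (crd x x) :=
    ((hf x).contDiffAt (tgt_mem_nhds (ctr_mem_tgt x))).continuousAt
  have h2 : ContinuousAt (crd x) x :=
    (continuousOn_crd x).continuousAt ((isOpen_src x).mem_nhds (mem_src_self x))
  refine (h1.comp h2).congr ?_
  filter_upwards [(isOpen_src x).mem_nhds (mem_src_self x)] with q hq
  simp only [Function.comp_apply, pt_crd hq]

lemma smoothF_of_contMDiff {f : M → ℝ} (hf : ContMDiff (𝓡 3) 𝓘(ℝ, ℝ) ∞ f) : SmoothF f :=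
  fun x₀ => contMDiffOn_iff_contDiffOn.1 (hf.comp_contMDiffOn (contMDiffOn_pt x₀))

variable [RiemannianBundle (fun x : M => TangentSpace (𝓡 3) x)]

lemma divergence_congr {X Y : VField M} {x : M} (h : ∀ᶠ q in 𝓝 x, X q = Y q) :
    divergence X x = divergence Y x := by
  have h1 : ∀ᶠ z in 𝓝 (ctr x), X (pt x z) = Y (pt x z) :=
    eventually_pt (ctr_mem_tgt x) (by rwa [pt_ctr])
  unfold divergence
  refine Finset.sum_congr rfl fun i _ => ?_
  unfold covVecComp
  have h2 : ∀ j, (fun z => vecComp x X z j) =ᶠ[𝓝 (ctr x)] fun z => vecComp x Y z j := fun j =>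
    h1.mono fun z hz => by simp only [vecComp, hz]
  rw [pd_congr i (h2 i)]
  simp only [(h2 _).eq_of_nhds]

variable [IsContMDiffRiemannianBundle (𝓡 3) ∞ E3 (fun x : M => TangentSpace (𝓡 3) x)]

lemma SmoothV.divergence {X : VField M} (hX : SmoothV X) : SmoothF (divergence X) := by
  intro x₀
  have : ContDiffOn ℝ ∞ (fun y => ∑ i, covVecComp x₀ X y i i) (tgt x₀) := fun y hy =>
    (ContDiffAt.sum fun i _ => hX.contDiffAt_covVecComp hy i i).contDiffWithinAt
  exact this.congr fun y hy => divergence_eq hX hy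

lemma SmoothV.continuous_norm {X : VField M} (hX : SmoothV X) : Continuous fun x => ‖X x‖ := by
  have := (hX.inner hX).continuous.sqrt
  refine this.congr fun x => ?_
  exact (norm_eq_sqrt_real_inner _).symm

lemma smoothV_zero : SmoothV (fun _ => 0 : VField M) := by
  intro x₀ i
  refine contDiffOn_const (c := 0) |>.congr fun y _ => ?_
  simp [vecComp]

lemma divergence_zero (x : M) : VorticityEnergy.divergence (fun _ => 0 : VField M) x = 0 := by
  have := divergence_const_smul 0 (smoothV_zero (M := M)) x
  simpa using this

lemma smoothV_sum {ι : Type*} (s : Finset ι) {X : ι → VField M} (hX : ∀ i, SmoothV (X i)) :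
    SmoothV (fun x => ∑ i ∈ s, X i x) := by
  classical
  induction s using Finset.induction_on with
  | empty => simpa using smoothV_zero (M := M)
  | insert a s ha ih =>
    simp only [Finset.sum_insert ha]
    exact (hX a).add ih

lemma divergence_sum {ι : Type*} (s : Finset ι) {X : ι → VField M} (hX : ∀ i, SmoothV (X i))
    (x : M) : VorticityEnergy.divergence (fun x => ∑ i ∈ s, X i x) x =
      ∑ i ∈ s, VorticityEnergy.divergence (X i) x := by
  classical
  induction s using Finset.induction_on with
  | empty => simpa using divergence_zero x
  | insert a s ha ih =>
    simp only [Finset.sum_insert ha]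
    rw [divergence_add (hX a) (smoothV_sum s hX), ih]

end Smooth

/-! ### The divergence theorem against Lipschitz cutoffs. -/

section DivergenceTheorem

open scoped NNReal ENNReal
open Metric

variable {M : Type*} [EMetricSpace M] [SecondCountableTopology M]
variable [ChartedSpace E3 M] [IsManifold (𝓡 3) ∞ M]
variable [RiemannianBundle (fun x : M => TangentSpace (𝓡 3) x)]
variable [IsContMDiffRiemannianBundle (𝓡 3) ∞ E3 (fun x : M => TangentSpace (𝓡 3) x)]
variable [IsRiemannianManifold (𝓡 3) M] [MeasurableSpace M] [BorelSpace M]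

/-- The divergence theorem against a Lipschitz function, for vector fields supported in a small
chart ball. -/
lemma abs_integral_mul_divergence_smul_le {x₀ : M} {C : ℝ≥0} {r : ℝ}
    (hr : closedBall (ctr x₀) r ⊆ tgt x₀)
    (hC : ∀ y ∈ ball (ctr x₀) r, ∀ z ∈ ball (ctr x₀) r,
      edist (pt x₀ y) (pt x₀ z) ≤ ENNReal.ofReal (C * ‖z - y‖))
    {χ : M → ℝ} {L : ℝ≥0} (hχ : LipschitzWith L χ) {ρ : M → ℝ} (hρ : SmoothF ρ)
    (hρs : tsupport ρ ⊆ pt x₀ '' ball (ctr x₀) r) {Z : VField M} (hZ : SmoothV Z) :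
    |∫ x, χ x * divergence (fun z => ρ z • Z z) x ∂(riemVolume M)| ≤
      L * ∫ x, |ρ x| * ‖Z x‖ ∂(riemVolume M) := by
  have hbt : ball (ctr x₀) r ⊆ tgt x₀ := ball_subset_closedBall.trans hr
  have hY : SmoothV (fun z => ρ z • Z z) := SmoothV.smul hρ hZ
  have hρsrc : tsupport ρ ⊆ src x₀ := fun x hx => by
    obtain ⟨y, hy, rfl⟩ := hρs hx
    exact pt_mem_src (hbt hy)
  -- The support of `ρ` in coordinates is compact inside the open ball. The vector density therefore
  -- stays smooth when extended by zero to the whole space.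
  set K : Set E3 := closedBall (ctr x₀) r ∩ pt x₀ ⁻¹' tsupport ρ with hK
  have hKc : IsCompact K := by
    refine IsCompact.of_isClosed_subset (isCompact_closedBall (ctr x₀) r) ?_ inter_subset_left
    exact ((continuousOn_pt x₀).mono hr).preimage_isClosed_of_isClosed isClosed_closedBall
      (isClosed_tsupport ρ)
  have hKmem : ∀ y ∈ tgt x₀, pt x₀ y ∈ tsupport ρ → y ∈ K ∧ y ∈ ball (ctr x₀) r := by
    intro y hy hyρ
    obtain ⟨z, hz, hzy⟩ := hρs hyρ
    have : z = y := by rw [← crd_pt hy, ← hzy, crd_pt (hbt hz)]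
    rw [this] at hz
    exact ⟨⟨ball_subset_closedBall hz, hyρ⟩, hz⟩
  have hKball : K ⊆ ball (ctr x₀) r := fun y hy => (hKmem y (hr hy.1) hy.2).2
  have hρ0 : ∀ y ∈ tgt x₀, y ∉ K → ρ (pt x₀ y) = 0 := fun y hy hyK => by
    by_contra h
    exact hyK (hKmem y hy (subset_tsupport ρ h)).1
  -- the components of the vector density
  classical
  set h : Fin 3 → E3 → ℝ := fun i => (tgt x₀).indicator fun y =>
    density x₀ y * vecComp x₀ (fun z => ρ z • Z z) y i with hh
  have hvc : ∀ y i, vecComp x₀ (fun z => ρ z • Z z) y i = ρ (pt x₀ y) * vecComp x₀ Z y i := by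
    intro y i
    simp only [vecComp, map_smul, smul_eq_mul]
  have h0 : ∀ i, ∀ y ∉ K, h i y = 0 := by
    intro i y hy
    by_cases hyt : y ∈ tgt x₀
    · simp only [hh, indicator_of_mem hyt]
      rw [hvc, hρ0 y hyt hy]
      ring
    · simp only [hh, indicator_of_notMem hyt]
  have hev : ∀ i, ∀ y ∈ tgt x₀, h i =ᶠ[𝓝 y] fun y =>
      density x₀ y * vecComp x₀ (fun z => ρ z • Z z) y i := fun i y hy => by
    filter_upwards [tgt_mem_nhds hy] with z hz
    exact indicator_of_mem hz _
  have hev0 : ∀ i, ∀ y ∉ K, h i =ᶠ[𝓝 y] fun _ => 0 := fun i y hy => by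
    filter_upwards [hKc.isClosed.isOpen_compl.mem_nhds hy] with z hz
    exact h0 i z hz
  have hsm : ∀ i, ContDiff ℝ ∞ (h i) := by
    intro i
    rw [contDiff_iff_contDiffAt]
    intro y
    by_cases hyt : y ∈ tgt x₀
    · exact ((contDiffAt_density hyt).mul (hY.contDiffAt hyt i)).congr_of_eventuallyEq (hev i y hyt)
    · exact contDiffAt_const.congr_of_eventuallyEq (hev0 i y fun hyK => hyt (hr hyK.1))
  have hcs : ∀ i, HasCompactSupport (h i) := fun i => HasCompactSupport.intro hKc (h0 i)
  -- a global Lipschitz extension of the cutoff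
  have hLip : LipschitzOnWith (L * C) (fun y => χ (pt x₀ y)) (ball (ctr x₀) r) := by
    refine LipschitzOnWith.of_dist_le_mul fun y hy z hz => ?_
    have := LipschitzWith.abs_sub_le hχ (by positivity) (hC y hy z hz)
    rw [Real.dist_eq, dist_comm, dist_eq_norm]
    push_cast
    linarith
  obtain ⟨f, hf, hfχ⟩ := hLip.extend_real
  -- the bound
  set B : E3 → ℝ := (tgt x₀).indicator fun y =>
    L * (density x₀ y * (|ρ (pt x₀ y)| * ‖Z (pt x₀ y)‖)) with hB
  have hd0 : ∀ y, 0 ≤ density x₀ y := fun y => Real.sqrt_nonneg _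
  have hBint : Integrable B := by
    have h1 : IntegrableOn B K := by
      refine ContinuousOn.integrableOn_compact hKc ?_
      have : ContinuousOn (fun y => (L : ℝ) * (density x₀ y * (|ρ (pt x₀ y)| * ‖Z (pt x₀ y)‖)))
          (tgt x₀) := continuousOn_const.mul ((continuousOn_density x₀).mul
        ((hρ.continuous.abs.mul hZ.continuous_norm).comp_continuousOn (continuousOn_pt x₀)))
      exact (this.mono (inter_subset_left.trans hr)).congr fun y hy => by
        rw [hB, indicator_of_mem (hr hy.1)]
    rw [integrableOn_iff_integrable_of_support_subset] at h1
    · exact h1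
    · intro y hy
      by_contra hyK
      refine hy ?_
      by_cases hyt : y ∈ tgt x₀
      · simp only [hB, indicator_of_mem hyt]
        rw [hρ0 y hyt hyK]
        simp
      · simp only [hB, indicator_of_notMem hyt]
  have hB0 : ∀ y, 0 ≤ B y := fun y => indicator_nonneg (fun y _ => by
    have := hd0 y
    positivity) y
  have hbound : ∀ y, DifferentiableAt ℝ f y →
      |fderiv ℝ f y (WithLp.toLp 2 fun i => h i y)| ≤ B y := by
    intro y hy
    by_cases hyK : y ∈ K
    · have hyt := hr hyK.1
      have e : (WithLp.toLp 2 fun i => h i y : E3) = (density x₀ y * ρ (pt x₀ y)) • vecVec x₀ Z y := by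
        ext i
        simp only [hh, indicator_of_mem hyt, hvc, PiLp.smul_apply, vecVec_apply, smul_eq_mul]
        ring
      have hfe : f =ᶠ[𝓝 y] fun z => χ (pt x₀ z) := by
        filter_upwards [isOpen_ball.mem_nhds (hKball hyK)] with z hz
        exact (hfχ hz).symm
      refine (abs_fderiv_le hχ hyt hfe hy _).trans (le_of_eq ?_)
      rw [e, map_smul, vecVec_frame hyt, norm_smul, norm_mul, Real.norm_of_nonneg (hd0 y),
        Real.norm_eq_abs, hB, indicator_of_mem hyt]
      ring
    · have e : (WithLp.toLp 2 fun i => h i y : E3) = 0 := by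
        ext i
        exact h0 i y hyK
      rw [e, map_zero, abs_zero]
      exact hB0 y
  have key := abs_integral_mul_sum_pd_le hf hsm hcs hBint hbound
  have hout : ∀ x ∉ tsupport ρ, divergence (fun z => ρ z • Z z) x = 0 := by
    intro x hx
    rw [divergence_congr (Y := fun _ => 0), divergence_zero]
    filter_upwards [(isClosed_tsupport ρ).isOpen_compl.mem_nhds hx] with q hq
    rw [image_eq_zero_of_notMem_tsupport hq, zero_smul]
  have e0 : ∫ y in tgt x₀, f y * ∑ i, pd i (h i) y = ∫ y, f y * ∑ i, pd i (h i) y := by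
    refine setIntegral_eq_integral_of_forall_compl_eq_zero fun y hy => ?_
    have : ∀ i, pd i (h i) y = 0 := fun i => by
      rw [pd_congr i (hev0 i y fun hyK => hy (hr hyK.1)), pd_const]
    simp [this]
  have e1 : ∫ x, χ x * divergence (fun z => ρ z • Z z) x ∂(riemVolume M) =
      ∫ y, f y * ∑ i, pd i (h i) y := by
    rw [integral_of_forall_notMem_src x₀ (fun x => χ x * divergence (fun z => ρ z • Z z) x)
      (hχ.continuous.mul hY.divergence.continuous).continuousOn
      fun x hx => by rw [hout x fun hxρ => hx (hρsrc hxρ), mul_zero], ← e0]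
    · refine setIntegral_congr_fun (measurableSet_tgt x₀) fun y hy => ?_
      -- The volume density absorbs the Christoffel symbols, so the integral becomes one of a flat
      -- divergence.
      have hs : density x₀ y * divergence (fun z => ρ z • Z z) (pt x₀ y) =
          ∑ i, pd i (h i) y := by
        rw [divergence_eq hY hy, mul_sum_covVecComp (w := density x₀) hY hy
          (Filter.eventually_of_mem (tgt_mem_nhds hy) fun z hz =>
            Real.sq_sqrt (det_metricMat_pos hz).le)
          ((contDiffAt_density hy).differentiableAt (by simp))]
        exact Finset.sum_congr rfl fun i _ => (pd_congr i (hev i y hy)).symm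
      rw [← hs]
      by_cases hyK : y ∈ K
      · have : χ (pt x₀ y) = f y := hfχ (hKball hyK)
        rw [this]
        ring
      · have : divergence (fun z => ρ z • Z z) (pt x₀ y) = 0 :=
          hout _ fun hyρ => hyK (hKmem y hy hyρ).1
        rw [this]
        ring
  have e2 : ∫ y, B y = L * ∫ x, |ρ x| * ‖Z x‖ ∂(riemVolume M) := by
    rw [integral_of_forall_notMem_src x₀ (fun x => |ρ x| * ‖Z x‖)
      (hρ.continuous.abs.mul hZ.continuous_norm).continuousOn
      fun x hx => by
        rw [image_eq_zero_of_notMem_tsupport fun hxρ => hx (hρsrc hxρ), abs_zero, zero_mul],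
      hB, integral_indicator (measurableSet_tgt x₀), integral_const_mul]
  rw [e1, ← e2]
  exact key

/-- The divergence theorem against a compactly supported Lipschitz function, as an estimate. -/
theorem abs_integral_mul_divergence_le {χ : M → ℝ} {L : ℝ≥0} (hχ : LipschitzWith L χ)
    (hχc : HasCompactSupport χ) {Z : VField M} (hZ : SmoothV Z)
    (hZi : Integrable (fun x => ‖Z x‖) (riemVolume M)) :
    |∫ x, χ x * divergence Z x ∂(riemVolume M)| ≤ L * ∫ x, ‖Z x‖ ∂(riemVolume M) := by
  choose C r hr hrt hC using exists_edist_pt_le (M := M)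
  set U : M → Set M := fun x₀ => pt x₀ '' ball (ctr x₀) (r x₀) with hU
  have hbt : ∀ x₀ : M, ball (ctr x₀) (r x₀) ⊆ tgt x₀ := fun x₀ =>
    ball_subset_closedBall.trans (hrt x₀)
  have hUo : ∀ x₀, IsOpen (U x₀) := by
    intro x₀
    have e : U x₀ = src x₀ ∩ crd x₀ ⁻¹' ball (ctr x₀) (r x₀) := by
      ext q
      constructor
      · rintro ⟨y, hy, rfl⟩
        refine ⟨pt_mem_src (hbt x₀ hy), ?_⟩
        rw [mem_preimage, crd_pt (hbt x₀ hy)]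
        exact hy
      · rintro ⟨hq, hqb⟩
        exact ⟨crd x₀ q, hqb, pt_crd hq⟩
    rw [e]
    exact (continuousOn_crd x₀).isOpen_inter_preimage (isOpen_src x₀) isOpen_ball
  have hcov : (univ : Set M) ⊆ ⋃ x₀, U x₀ := fun x _ =>
    mem_iUnion.2 ⟨x, ctr x, mem_ball_self (hr x), pt_ctr x⟩
  have : LocallyCompactSpace M := ChartedSpace.locallyCompactSpace E3 M
  have : SigmaCompactSpace M := sigmaCompactSpace_of_locallyCompact_secondCountable
  obtain ⟨ρ, hρ⟩ := SmoothPartitionOfUnity.exists_isSubordinate (𝓡 3) (isClosed_univ (X := M)) U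
    hUo hcov
  have hρs : ∀ i, SmoothF (ρ i) := fun i => smoothF_of_contMDiff (ρ i).contMDiff
  -- Only finitely many members of the partition meet the compact support of `χ`.
  have hfin := ρ.locallyFinite.finite_nonempty_inter_compact hχc.isCompact
  set s := hfin.toFinset with hs
  have hsum : ∀ x ∈ tsupport χ, ∑ i ∈ s, ρ i x = 1 := by
    intro x hx
    rw [← ρ.sum_eq_one (mem_univ x), finsum_eq_sum_of_support_subset]
    intro i hi
    rw [hs, Finite.coe_toFinset]
    exact ⟨x, hi, hx⟩
  have hdiv : ∀ x, χ x * divergence Z x =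
      ∑ i ∈ s, χ x * divergence (fun z => ρ i z • Z z) x := by
    intro x
    by_cases hx : χ x = 0
    · simp [hx]
    rw [← Finset.mul_sum, ← divergence_sum s fun i => SmoothV.smul (hρs i) hZ]
    congr 1
    -- The `ρ i` sum to one on the support of `χ`, which is a neighbourhood of any point where `χ ≠
    -- 0`. The derivatives of the partition therefore leave no trace in the sum.
    refine divergence_congr ?_
    have : Function.support χ ∈ 𝓝 x := hχ.continuous.isOpen_support.mem_nhds hx
    filter_upwards [this] with q hq
    rw [← Finset.sum_smul, hsum q (subset_tsupport χ hq), one_smul]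
  have hint : ∀ i, Integrable (fun x => χ x * divergence (fun z => ρ i z • Z z) x)
      (riemVolume M) := fun i =>
    (hχ.continuous.mul (SmoothV.smul (hρs i) hZ).divergence.continuous).integrable_of_hasCompactSupport
      hχc.mul_right
  have hint2 : ∀ i, Integrable (fun x => |ρ i x| * ‖Z x‖) (riemVolume M) := fun i =>
    hZi.bdd_mul (c := 1) (hρs i).continuous.abs.aestronglyMeasurable
      (Filter.Eventually.of_forall fun x => by
        rw [Real.norm_eq_abs, abs_abs, abs_of_nonneg (ρ.nonneg i x)]
        exact ρ.le_one i x)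
  calc |∫ x, χ x * divergence Z x ∂(riemVolume M)|
      = |∑ i ∈ s, ∫ x, χ x * divergence (fun z => ρ i z • Z z) x ∂(riemVolume M)| := by
        simp only [hdiv]
        rw [integral_finsetSum _ fun i _ => hint i]
    _ ≤ ∑ i ∈ s, |∫ x, χ x * divergence (fun z => ρ i z • Z z) x ∂(riemVolume M)| :=
        Finset.abs_sum_le_sum_abs _ _
    _ ≤ ∑ i ∈ s, L * ∫ x, |ρ i x| * ‖Z x‖ ∂(riemVolume M) :=
        Finset.sum_le_sum fun i _ =>
          abs_integral_mul_divergence_smul_le (hrt i) (hC i) hχ (hρs i) (hρ i) hZ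
    _ = L * ∫ x, ∑ i ∈ s, |ρ i x| * ‖Z x‖ ∂(riemVolume M) := by
        rw [integral_finsetSum _ fun i _ => hint2 i, Finset.mul_sum]
    _ ≤ L * ∫ x, ‖Z x‖ ∂(riemVolume M) := by
        -- Each piece was estimated by `|ρ i| ‖Z‖` with no derivative of `ρ i`. As the `ρ i` sum to
        -- at most one, the constant `L` survives the localization.
        refine mul_le_mul_of_nonneg_left ?_ L.coe_nonneg
        refine integral_mono (integrable_finsetSum _ fun i _ => hint2 i) hZi fun x => ?_
        simp only
        rw [← Finset.sum_mul]
        refine mul_le_of_le_one_left (norm_nonneg _) ?_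
        simp only [abs_of_nonneg (ρ.nonneg _ x)]
        classical
        have hle := ρ.sum_le_one x
        rw [finsum_eq_sum_of_support_subset _ (s := s ∪ (ρ.locallyFinite.point_finite x).toFinset)
          (fun i hi => Finset.mem_coe.2 (Finset.mem_union_right _ (by simpa using hi)))] at hle
        exact (Finset.sum_le_sum_of_subset_of_nonneg Finset.subset_union_left
          fun i _ _ => ρ.nonneg i x).trans hle

end DivergenceTheorem

/-! ### Differentiating integrals and passing to the limit in the cutoffs. -/

section ParametricIntegrals

open Filter

variable {X : Type*} [TopologicalSpace X] {J : Set ℝ}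

lemma continuous_slice {f : ℝ → X → ℝ}
    (hf : ContinuousOn (fun z : ℝ × X => f z.1 z.2) (J ×ˢ univ)) {t : ℝ} (ht : t ∈ J) :
    Continuous (f t) :=
  continuousOn_univ.1 (hf.comp (f := fun x : X => (t, x)) (by fun_prop)
    fun _ _ => mk_mem_prod ht (mem_univ _))

lemma continuousWithinAt_slice {f : ℝ → X → ℝ}
    (hf : ContinuousOn (fun z : ℝ × X => f z.1 z.2) (J ×ˢ univ)) {t : ℝ} (ht : t ∈ J) (x : X) :
    ContinuousWithinAt (fun s => f s x) J t :=
  (hf.comp (f := fun s : ℝ => (s, x)) (by fun_prop)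
    fun _ hs => mk_mem_prod hs (mem_univ _)) t ht

/-- A tube argument: a bound on `K` at time `t` persists, up to adding `1`, on a neighbourhood of
`{t} × K`, and compactness makes the time neighbourhood uniform. -/
lemma exists_forall_abs_le_of_isCompact {f : ℝ → X → ℝ}
    (hf : ContinuousOn (fun z : ℝ × X => f z.1 z.2) (J ×ˢ univ)) {t : ℝ} (ht : t ∈ J)
    {K : Set X} (hK : IsCompact K) :
    ∃ C, 0 ≤ C ∧ ∀ᶠ s in 𝓝[J] t, ∀ x ∈ K, |f s x| ≤ C := by
  obtain ⟨C, hC⟩ := hK.exists_bound_of_continuousOn (continuous_slice hf ht).continuousOn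
  refine ⟨|C| + 1, by positivity, ?_⟩
  have h : {z : ℝ × X | |f z.1 z.2| ≤ |C| + 1} ∈ 𝓝[J] t ×ˢ 𝓝ˢ K := by
    refine hK.mem_prod_nhdsSet_of_forall fun x hx => ?_
    have h1 : Tendsto (fun z : ℝ × X => |f z.1 z.2|) (𝓝[J] t ×ˢ 𝓝 x) (𝓝 |f t x|) := by
      have := (hf (t, x) ⟨ht, mem_univ x⟩).tendsto.abs
      rwa [nhdsWithin_prod_eq, nhdsWithin_univ] at this
    have h2 : |f t x| < |C| + 1 := by
      have := hC x hx
      rw [Real.norm_eq_abs] at this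
      linarith [le_abs_self C]
    exact (h1.eventually_lt_const h2).mono fun z hz => hz.le
  obtain ⟨U, hU, V, hV, hUV⟩ := mem_prod_iff.1 h
  filter_upwards [hU] with s hs x hx
  exact hUV (mk_mem_prod hs (subset_of_mem_nhdsSet hV hx))

variable [T2Space X] [MeasurableSpace X] [BorelSpace X] {μ : Measure X}
  [IsFiniteMeasureOnCompacts μ]

/-- A bound near infinity by an integrable function extends to a bound everywhere. -/
lemma exists_integrable_bound {f : ℝ → X → ℝ}
    (hf : ContinuousOn (fun z : ℝ × X => f z.1 z.2) (J ×ˢ univ)) {t : ℝ} (ht : t ∈ J)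
    {K : Set X} (hK : IsCompact K) {G : X → ℝ} (hG : Integrable G μ)
    (hb : ∀ᶠ s in 𝓝[J] t, ∀ x ∉ K, |f s x| ≤ G x) :
    ∃ B : X → ℝ, Integrable B μ ∧ ∀ᶠ s in 𝓝[J] t, ∀ x, |f s x| ≤ B x := by
  obtain ⟨C, hC, hfC⟩ := exists_forall_abs_le_of_isCompact hf ht hK
  refine ⟨fun x => |G x| + K.indicator (fun _ => C) x, hG.abs.add ?_, ?_⟩
  · rw [integrable_indicator_iff hK.measurableSet]
    exact integrableOn_const (hK.measure_lt_top.ne)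
  · filter_upwards [hb, hfC] with s hs hsC x
    by_cases hx : x ∈ K
    · rw [indicator_of_mem hx]
      linarith [hsC x hx, abs_nonneg (G x)]
    · rw [indicator_of_notMem hx]
      linarith [hs x hx, le_abs_self (G x)]

lemma integrable_of_abs_le {f B : X → ℝ} (hf : Continuous f) (hB : Integrable B μ)
    (h : ∀ x, |f x| ≤ B x) : Integrable f μ :=
  hB.mono' hf.aestronglyMeasurable (Eventually.of_forall h)

/-- Differentiation under the integral sign, against a compactly supported weight. -/
lemma hasDerivWithinAt_integral_mul (hJ : Convex ℝ J) {e e' : ℝ → X → ℝ}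
    (he : ContinuousOn (fun z : ℝ × X => e z.1 z.2) (J ×ˢ univ))
    (he' : ContinuousOn (fun z : ℝ × X => e' z.1 z.2) (J ×ˢ univ))
    (hder : ∀ s ∈ J, ∀ x, HasDerivWithinAt (fun r => e r x) (e' s x) J s)
    {χ : X → ℝ} (hχ : Continuous χ) (hχc : HasCompactSupport χ) {t : ℝ} (ht : t ∈ J) :
    HasDerivWithinAt (fun s => ∫ x, χ x * e s x ∂μ) (∫ x, χ x * e' t x ∂μ) J t := by
  obtain ⟨C, hC, hbd⟩ := exists_forall_abs_le_of_isCompact he' ht hχc.isCompact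
  obtain ⟨δ, hδ, hbd⟩ := Metric.mem_nhdsWithin_iff.1 hbd
  have hint : ∀ s ∈ J, Integrable (fun x => χ x * e s x) μ := fun s hs =>
    (hχ.mul (continuous_slice he hs)).integrable_of_hasCompactSupport hχc.mul_right
  rw [hasDerivWithinAt_iff_tendsto_slope]
  have hmemJ : ∀ᶠ s in 𝓝[J \ {t}] t, s ∈ J ∧ s ∈ Metric.ball t δ := by
    filter_upwards [self_mem_nhdsWithin, mem_nhdsWithin_of_mem_nhds (Metric.ball_mem_nhds t hδ)]
      with s hs hsb
    exact ⟨hs.1, hsb⟩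
  have hslope : ∀ s ∈ J, slope (fun s => ∫ x, χ x * e s x ∂μ) t s =
      ∫ x, χ x * slope (fun r => e r x) t s ∂μ := by
    intro s hs
    simp only [slope, vsub_eq_sub, smul_eq_mul]
    rw [← integral_sub (hint s hs) (hint t ht), ← integral_const_mul]
    refine integral_congr_ae (Eventually.of_forall fun x => ?_)
    simp only
    ring
  have hlim : Tendsto (fun s => ∫ x, χ x * slope (fun r => e r x) t s ∂μ) (𝓝[J \ {t}] t)
      (𝓝 (∫ x, χ x * e' t x ∂μ)) := by
    refine tendsto_integral_filter_of_dominated_convergence (fun x => |χ x| * C) ?_ ?_ ?_ ?_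
    · filter_upwards [hmemJ] with s hs
      have : Continuous fun x => χ x * slope (fun r => e r x) t s := by
        simp only [slope, vsub_eq_sub, smul_eq_mul]
        exact hχ.mul (continuous_const.mul ((continuous_slice he hs.1).sub (continuous_slice he ht)))
      exact this.aestronglyMeasurable
    · filter_upwards [hmemJ] with s hs
      refine Eventually.of_forall fun x => ?_
      rw [norm_mul, Real.norm_eq_abs]
      by_cases hx : x ∈ tsupport χ
      · refine mul_le_mul_of_nonneg_left ?_ (abs_nonneg _)
        have hconv : Convex ℝ (J ∩ Metric.ball t δ) := hJ.inter (convex_ball t δ)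
        -- The mean value inequality on the convex set `J ∩ ball` bounds the difference quotients by
        -- `C`, which supplies the dominating function.
        have h1 := hconv.norm_image_sub_le_of_norm_hasDerivWithin_le (f := fun r => e r x)
          (f' := fun r => e' r x) (C := C)
          (fun r hr => (hder r hr.1 x).mono inter_subset_left)
          (fun r hr => hbd ⟨hr.2, hr.1⟩ x hx) ⟨ht, Metric.mem_ball_self hδ⟩ hs
        simp only [slope, vsub_eq_sub, smul_eq_mul, norm_mul, norm_inv]
        by_cases hst : s - t = 0
        · simp [hst, hC]
        · rw [inv_mul_le_iff₀ (norm_pos_iff.2 hst), mul_comm]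
          exact h1
      · rw [image_eq_zero_of_notMem_tsupport hx]
        simp
    · exact (hχ.abs.mul continuous_const).integrable_of_hasCompactSupport
        (HasCompactSupport.mul_right (hχc.comp_left abs_zero))
    · refine Eventually.of_forall fun x => ?_
      exact (hasDerivWithinAt_iff_tendsto_slope.1 (hder t ht x)).const_mul _
  refine hlim.congr' ?_
  filter_upwards [hmemJ] with s hs
  exact (hslope s hs.1).symm

/-- Integration of a local balance law `∂ₜe = g + d`, where `d` is negligible in the sense that
its integrals against a sequence of cutoff functions are small. -/
theorem hasDerivWithinAt_integral_of_balance (hJ : Convex ℝ J) {e g d : ℝ → X → ℝ}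
    (he : ContinuousOn (fun z : ℝ × X => e z.1 z.2) (J ×ˢ univ))
    (hg : ContinuousOn (fun z : ℝ × X => g z.1 z.2) (J ×ˢ univ))
    (hd : ContinuousOn (fun z : ℝ × X => d z.1 z.2) (J ×ˢ univ))
    (hder : ∀ s ∈ J, ∀ x, HasDerivWithinAt (fun r => e r x) (g s x + d s x) J s)
    {t : ℝ} (ht : t ∈ J) {B B' : X → ℝ} (hB : Integrable B μ) (hB' : Integrable B' μ)
    (heB : ∀ᶠ s in 𝓝[J] t, ∀ x, |e s x| ≤ B x) (hgB : ∀ᶠ s in 𝓝[J] t, ∀ x, |g s x| ≤ B' x)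
    {χ : ℕ → X → ℝ} (hχ : ∀ n, Continuous (χ n)) (hχc : ∀ n, HasCompactSupport (χ n))
    (hχ0 : ∀ n x, 0 ≤ χ n x) (hχ1 : ∀ n x, χ n x ≤ 1)
    (hχt : ∀ x, Tendsto (fun n => χ n x) atTop (𝓝 1))
    {a : ℕ → ℝ} (ha : Tendsto a atTop (𝓝 0))
    (hda : ∀ᶠ s in 𝓝[J] t, ∀ n, |∫ x, χ n x * d s x ∂μ| ≤ a n) :
    HasDerivWithinAt (fun s => ∫ x, e s x ∂μ) (∫ x, g t x ∂μ) J t := by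
  have hgt := hgB.self_of_nhdsWithin ht
  have hgti : Integrable (g t) μ := integrable_of_abs_le (continuous_slice hg ht) hB' hgt
  -- the oscillation of `g` in time
  have hosc : Tendsto (fun s => ∫ x, |g s x - g t x| ∂μ) (𝓝[J] t) (𝓝 0) := by
    have h0 : ∫ x, |g t x - g t x| ∂μ = 0 := by simp
    rw [← h0]
    refine tendsto_integral_filter_of_dominated_convergence (fun x => B' x + B' x) ?_ ?_
      (hB'.add hB') ?_
    · filter_upwards [self_mem_nhdsWithin] with s hs
      exact ((continuous_slice hg hs).sub (continuous_slice hg ht)).abs.aestronglyMeasurable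
    · filter_upwards [hgB] with s hs
      refine Eventually.of_forall fun x => ?_
      rw [Real.norm_eq_abs, abs_abs]
      exact (abs_sub _ _).trans (add_le_add (hs x) (hgt x))
    · exact Eventually.of_forall fun x =>
        ((continuousWithinAt_slice hg ht x).tendsto.sub_const _).abs
  -- the tails of `g`
  have htail : Tendsto (fun n => ∫ x, (1 - χ n x) * |g t x| ∂μ) atTop (𝓝 0) := by
    have h0 : ∫ x, (1 - 1) * |g t x| ∂μ = 0 := by simp
    rw [← h0]
    refine tendsto_integral_of_dominated_convergence (fun x => |g t x|) (fun n => ?_) hgti.abs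
      (fun n => Eventually.of_forall fun x => ?_) (Eventually.of_forall fun x => ?_)
    · exact ((continuous_const.sub (hχ n)).mul (continuous_slice hg ht).abs).aestronglyMeasurable
    · rw [norm_mul, Real.norm_eq_abs, Real.norm_eq_abs, abs_abs,
        abs_of_nonneg (sub_nonneg.2 (hχ1 n x))]
      exact mul_le_of_le_one_left (abs_nonneg _) (by linarith [hχ0 n x])
    · exact ((hχt x).const_sub 1).mul_const _
  have hEn : ∀ s ∈ J, (∀ x, |e s x| ≤ B x) →
      Tendsto (fun n => ∫ x, χ n x * e s x ∂μ) atTop (𝓝 (∫ x, e s x ∂μ)) := by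
    intro s hs hsB
    refine tendsto_integral_of_dominated_convergence B (fun n => ?_) hB
      (fun n => Eventually.of_forall fun x => ?_) (Eventually.of_forall fun x => ?_)
    · exact ((hχ n).mul (continuous_slice he hs)).aestronglyMeasurable
    · rw [norm_mul, Real.norm_eq_abs, Real.norm_eq_abs, abs_of_nonneg (hχ0 n x)]
      exact (mul_le_of_le_one_left (abs_nonneg _) (hχ1 n x)).trans (hsB x)
    · simpa using (hχt x).mul_const (e s x)
  rw [hasDerivWithinAt_iff_isLittleO, Asymptotics.isLittleO_iff]
  intro ε hε
  have hev : ∀ᶠ s in 𝓝[J] t, (∫ x, |g s x - g t x| ∂μ) < ε ∧ (∀ x, |g s x| ≤ B' x) ∧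
      (∀ x, |e s x| ≤ B x) ∧ ∀ n, |∫ x, χ n x * d s x ∂μ| ≤ a n :=
    (hosc.eventually_lt_const hε).and (hgB.and (heB.and hda))
  obtain ⟨δ, hδ, hev⟩ := Metric.mem_nhdsWithin_iff.1 hev
  have hballJ : Metric.ball t δ ∩ J ∈ 𝓝[J] t :=
    inter_mem (mem_nhdsWithin_of_mem_nhds (Metric.ball_mem_nhds t hδ)) self_mem_nhdsWithin
  filter_upwards [hballJ] with s hs
  set F := ∫ x, g t x ∂μ with hF
  set τ : ℕ → ℝ := fun n => ∫ x, (1 - χ n x) * |g t x| ∂μ with hτ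
  -- The mean value inequality is applied to `r ↦ ∫ χₙ e_r - rF`. Its derivative is bounded by `ε`
  -- from the oscillation of `g` in time, `τ n` from its tails at time `t`, and `a n` from `d`, all
  -- uniformly in `r`.
  have hn : ∀ n, |∫ x, χ n x * e s x ∂μ - ∫ x, χ n x * e t x ∂μ - (s - t) * F| ≤
      (ε + τ n + a n) * |s - t| := by
    intro n
    have hconv : Convex ℝ (Metric.ball t δ ∩ J) := (convex_ball t δ).inter hJ
    have h1 := hconv.norm_image_sub_le_of_norm_hasDerivWithin_le
      (f := fun r => ∫ x, χ n x * e r x ∂μ - r * F)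
      (f' := fun r => ∫ x, χ n x * (g r x + d r x) ∂μ - F) (C := ε + τ n + a n)
      (fun r hr => ((hasDerivWithinAt_integral_mul hJ he (hg.add hd) hder (hχ n) (hχc n)
        hr.2).mono inter_subset_right).sub (by
          simpa using (hasDerivWithinAt_id r _).mul_const F)) (fun r hr => ?_)
      ⟨Metric.mem_ball_self hδ, ht⟩ hs
    · rw [Real.norm_eq_abs, Real.norm_eq_abs] at h1
      convert h1 using 2
      ring
    · obtain ⟨ho, hrg, -, hra⟩ := hev hr
      have hcg := continuous_slice hg hr.2
      have i1 : Integrable (fun x => χ n x * g r x) μ :=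
        ((hχ n).mul hcg).integrable_of_hasCompactSupport (hχc n).mul_right
      have i2 : Integrable (fun x => χ n x * d r x) μ :=
        ((hχ n).mul (continuous_slice hd hr.2)).integrable_of_hasCompactSupport (hχc n).mul_right
      have i3 : Integrable (fun x => |g r x - g t x|) μ :=
        ((integrable_of_abs_le hcg hB' hrg).sub hgti).abs
      have i4 : Integrable (fun x => (1 - χ n x) * |g t x|) μ := by
        have i5 : Integrable (fun x => χ n x * |g t x|) μ :=
          ((hχ n).mul (continuous_slice hg ht).abs).integrable_of_hasCompactSupport (hχc n).mul_right
        refine (hgti.abs.sub i5).congr (Eventually.of_forall fun x => ?_)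
        simp only [Pi.sub_apply]
        ring
      have e1 : ∫ x, χ n x * (g r x + d r x) ∂μ - F =
          ∫ x, (χ n x * g r x - g t x) ∂μ + ∫ x, χ n x * d r x ∂μ := by
        simp only [mul_add]
        rw [integral_add i1 i2, integral_sub i1 hgti]
        ring
      have e2 : |∫ x, (χ n x * g r x - g t x) ∂μ| ≤ ε + τ n := by
        calc |∫ x, (χ n x * g r x - g t x) ∂μ|
            ≤ ∫ x, (|g r x - g t x| + (1 - χ n x) * |g t x|) ∂μ := by
              rw [← Real.norm_eq_abs]
              refine norm_integral_le_of_norm_le (i3.add i4) (Eventually.of_forall fun x => ?_)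
              have : χ n x * g r x - g t x = χ n x * (g r x - g t x) - (1 - χ n x) * g t x := by
                ring
              rw [this, Real.norm_eq_abs]
              refine (abs_sub _ _).trans (add_le_add ?_ ?_)
              · rw [abs_mul, abs_of_nonneg (hχ0 n x)]
                exact mul_le_of_le_one_left (abs_nonneg _) (hχ1 n x)
              · rw [abs_mul, abs_of_nonneg (sub_nonneg.2 (hχ1 n x))]
          _ = ∫ x, |g r x - g t x| ∂μ + τ n := integral_add i3 i4
          _ ≤ ε + τ n := by linarith
      rw [e1, Real.norm_eq_abs]
      exact (abs_add_le _ _).trans (add_le_add e2 (hra n))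
  -- Letting `n → ∞` at fixed `s` leaves the error `ε |s - t|`, so no exchange of the limit with the
  -- derivative is needed.
  have hlim1 := (((hEn s hs.2 (hev hs).2.2.1).sub
    (hEn t ht (heB.self_of_nhdsWithin ht))).sub_const ((s - t) * F)).abs
  have hlim2 : Tendsto (fun n => (ε + τ n + a n) * |s - t|) atTop (𝓝 ((ε + 0 + 0) * |s - t|)) :=
    ((htail.const_add ε).add ha).mul_const _
  have := le_of_tendsto_of_tendsto' hlim1 hlim2 hn
  rw [add_zero, add_zero] at this
  rw [Real.norm_eq_abs, Real.norm_eq_abs, smul_eq_mul]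
  exact this

end ParametricIntegrals

/-! ### The enstrophy identity. -/

section Energy

open Filter
open scoped NNReal

variable {M : Type*} [EMetricSpace M] [CompleteSpace M] [SecondCountableTopology M]
  [ChartedSpace E3 M] [IsManifold (𝓡 3) ∞ M]
  [RiemannianBundle (fun x : M => TangentSpace (𝓡 3) x)]
  [IsContMDiffRiemannianBundle (𝓡 3) ∞ E3 (fun x : M => TangentSpace (𝓡 3) x)]
  [IsRiemannianManifold (𝓡 3) M] [MeasurableSpace M] [BorelSpace M]

/-- A complete Riemannian manifold has compactly supported cutoff functions with small Lipschitz
constants. -/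
lemma exists_riemannian_cutoff : ∃ χ : ℕ → M → ℝ,
    (∀ n : ℕ, LipschitzWith ((n : ℝ≥0) + 1)⁻¹ (χ n)) ∧
      (∀ n, HasCompactSupport (χ n)) ∧ (∀ n x, 0 ≤ χ n x) ∧ (∀ n x, χ n x ≤ 1) ∧
      ∀ x, Tendsto (fun n => χ n x) atTop (𝓝 1) := by
  have : LocallyCompactSpace M := ChartedSpace.locallyCompactSpace E3 M
  exact exists_cutoff fun x r => hasIntermediatePoints.isCompact_closedEBall x r

variable {o : TangentOrientation M} {ν : ℝ} {J : Set ℝ} {u : ℝ → VField M} {p : ℝ → M → ℝ}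

/-- The balance law is integrated with `e = |ω|²`, `d = 2 div Z` and `g` the remaining terms. Joint
continuity extends the bounds outside `K` to all of `M`, which gives the integrability and all the
dominating functions. -/
theorem energy_identity (ho : IsOrientation o) (hν : 0 ≤ ν)
    (hJ : Convex ℝ J ∧ (interior J).Nonempty) (hsol : IsSmoothSolution o ν J u p)
    (hint : IntegrableAtInfinity o J u) {t : ℝ} (ht : t ∈ J) :
    Integrable (fun x => ‖vorticity o (u t) x‖ ^ 2) (riemVolume M) ∧
    Integrable (covFormNormSq (vorticity o (u t))) (riemVolume M) ∧
    Integrable (formInner (formAct (vorticity o (u t)) ricci) (vorticity o (u t)))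
      (riemVolume M) ∧
    Integrable (formInner (formAct (vorticity o (u t)) (strain (u t))) (vorticity o (u t)))
      (riemVolume M) ∧
    HasDerivWithinAt (fun s => ∫ x, ‖vorticity o (u s) x‖ ^ 2 ∂(riemVolume M))
      (2 * (-ν * ∫ x, covFormNormSq (vorticity o (u t)) x ∂(riemVolume M)
        - ν * ∫ x, formInner (formAct (vorticity o (u t)) ricci) (vorticity o (u t)) x
          ∂(riemVolume M)
        + ∫ x, formInner (formAct (vorticity o (u t)) (strain (u t))) (vorticity o (u t)) x
          ∂(riemVolume M))) J t := by
  obtain ⟨K, hK, G, hG, hb⟩ := hint t ht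
  have hu := hsol.smoothT
  have se := smoothFT_normSq_vorticity hJ ho hu
  have sq := smoothFT_covFormNormSq_vorticity hJ ho hu
  have sr := smoothFT_ricci hJ ho hu
  have ss := smoothFT_strain hJ ho hu
  have sd := smoothFT_divergence_flux hJ ho ν hu
  have ce := se.continuousOn
  have cq := sq.continuousOn
  have cr := sr.continuousOn
  have cs := ss.continuousOn
  have cu : ContinuousOn (fun z : ℝ × M => ‖u z.1 z.2‖ * ‖vorticity o (u z.1) z.2‖ ^ 2)
      (J ×ˢ univ) := hu.continuousOn_norm.mul ce
  obtain ⟨Be, hBe, hbe⟩ := exists_integrable_bound (f := fun s x => ‖vorticity o (u s) x‖ ^ 2)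
    ce ht hK hG (hb.mono fun s hs x hx => by
      rw [abs_of_nonneg (sq_nonneg _)]; exact (hs x hx).1)
  obtain ⟨Bu, hBu, hbu⟩ := exists_integrable_bound
    (f := fun s x => ‖u s x‖ * ‖vorticity o (u s) x‖ ^ 2)
    cu ht hK hG (hb.mono fun s hs x hx => by
      rw [abs_of_nonneg (by positivity)]; exact (hs x hx).2.1)
  obtain ⟨Bq, hBq, hbq⟩ := exists_integrable_bound
    (f := fun s x => covFormNormSq (vorticity o (u s)) x)
    cq ht hK hG (hb.mono fun s hs x hx => by
      rw [abs_of_nonneg (covFormNormSq_nonneg _ _)]; exact (hs x hx).2.2.1)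
  obtain ⟨Br, hBr, hbr⟩ := exists_integrable_bound
    (f := fun s x => formInner (formAct (vorticity o (u s)) ricci) (vorticity o (u s)) x)
    cr ht hK hG (hb.mono fun s hs x hx => (hs x hx).2.2.2.1)
  obtain ⟨Bs, hBs, hbs⟩ := exists_integrable_bound
    (f := fun s x =>
      formInner (formAct (vorticity o (u s)) (strain (u s))) (vorticity o (u s)) x)
    cs ht hK hG (hb.mono fun s hs x hx => (hs x hx).2.2.2.2)
  have ie := integrable_of_abs_le (continuous_slice
    (f := fun s x => ‖vorticity o (u s) x‖ ^ 2) ce ht) hBe (hbe.self_of_nhdsWithin ht)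
  have iq := integrable_of_abs_le (continuous_slice
    (f := fun s x => covFormNormSq (vorticity o (u s)) x) cq ht) hBq (hbq.self_of_nhdsWithin ht)
  have ir := integrable_of_abs_le (continuous_slice
    (f := fun s x => formInner (formAct (vorticity o (u s)) ricci) (vorticity o (u s)) x) cr ht) hBr (hbr.self_of_nhdsWithin ht)
  have is := integrable_of_abs_le (continuous_slice
    (f := fun s x =>
      formInner (formAct (vorticity o (u s)) (strain (u s))) (vorticity o (u s)) x) cs ht) hBs (hbs.self_of_nhdsWithin ht)
  refine ⟨ie, iq, ir, is, ?_⟩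
  obtain ⟨χ, hχ, hχc, hχ0, hχ1, hχt⟩ := exists_riemannian_cutoff (M := M)
  set BZ : M → ℝ := fun x => ν * (Bq x + Be x) + Bu x with hBZ
  have hBZi : Integrable BZ (riemVolume M) := ((hBq.add hBe).const_mul ν).add hBu
  -- The flux is dominated by one integrable function `BZ` for all nearby times, so the Lipschitz
  -- constant `1/(n+1)` of the cutoff makes the divergence term vanish uniformly in time.
  have hdf : ∀ᶠ s in 𝓝[J] t, ∀ n : ℕ, |∫ x, χ n x * (2 * divergence (flux o ν (u s)) x)
      ∂(riemVolume M)| ≤ 2 * ((n : ℝ) + 1)⁻¹ * ∫ x, BZ x ∂(riemVolume M) := by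
    filter_upwards [self_mem_nhdsWithin, hbe, hbu, hbq] with s hs h1 h2 h3 n
    have hus := hu.smoothV hs
    have hZ := smoothV_flux ho ν hus
    have hle : ∀ x, ‖flux o ν (u s) x‖ ≤ BZ x := fun x => by
      refine (norm_flux_le ho hν hus x).trans ?_
      have a1 := (le_abs_self _).trans (h1 x)
      have a2 := (le_abs_self _).trans (h2 x)
      have a3 := (le_abs_self _).trans (h3 x)
      simp only [hBZ]
      gcongr
    have hZi : Integrable (fun x => ‖flux o ν (u s) x‖) (riemVolume M) :=
      integrable_of_abs_le hZ.continuous_norm hBZi fun x => by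
        rw [abs_norm]
        exact hle x
    have h4 := abs_integral_mul_divergence_le (hχ n) (hχc n) hZ hZi
    have e1 : ∫ x, χ n x * (2 * divergence (flux o ν (u s)) x) ∂(riemVolume M) =
        2 * ∫ x, χ n x * divergence (flux o ν (u s)) x ∂(riemVolume M) := by
      rw [← integral_const_mul]
      refine integral_congr_ae (Eventually.of_forall fun x => ?_)
      simp only
      ring
    rw [e1, abs_mul, abs_two, mul_assoc]
    refine mul_le_mul_of_nonneg_left (h4.trans ?_) zero_le_two
    push_cast
    exact mul_le_mul_of_nonneg_left (integral_mono hZi hBZi hle) (by positivity)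
  have ha : Tendsto (fun n : ℕ => 2 * ((n : ℝ) + 1)⁻¹ * ∫ x, BZ x ∂(riemVolume M)) atTop (𝓝 0) := by
    have h := ((tendsto_one_div_add_atTop_nhds_zero_nat (𝕜 := ℝ)).const_mul 2).mul_const
      (∫ x, BZ x ∂(riemVolume M))
    simpa using h
  have sg := (((sq.const_mul (-ν)).sub (sr.const_mul ν)).add ss).const_mul 2
  have hgb : ∀ᶠ s in 𝓝[J] t, ∀ x, |2 * (-ν * covFormNormSq (vorticity o (u s)) x
      - ν * formInner (formAct (vorticity o (u s)) ricci) (vorticity o (u s)) x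
      + formInner (formAct (vorticity o (u s)) (strain (u s))) (vorticity o (u s)) x)| ≤
      2 * (ν * Bq x + ν * Br x + Bs x) := by
    filter_upwards [hbq, hbr, hbs] with s h1 h2 h3 x
    rw [abs_mul, abs_two]
    refine mul_le_mul_of_nonneg_left ?_ zero_le_two
    refine (abs_add_le _ _).trans (add_le_add ((abs_sub _ _).trans (add_le_add ?_ ?_)) (h3 x))
    · rw [abs_mul, abs_neg, abs_of_nonneg hν]
      exact mul_le_mul_of_nonneg_left (h1 x) hν
    · rw [abs_mul, abs_of_nonneg hν]
      exact mul_le_mul_of_nonneg_left (h2 x) hν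
  have main := hasDerivWithinAt_integral_of_balance (μ := riemVolume M) hJ.1 ce sg.continuousOn
    (sd.const_mul 2).continuousOn
    (fun s hs x => (hsol.balance ho hJ hs x).congr_deriv (by ring)) ht hBe
    ((((hBq.const_mul ν).add (hBr.const_mul ν)).add hBs).const_mul 2) hbe hgb
    (fun n => (hχ n).continuous) hχc hχ0 hχ1 hχt ha hdf
  refine main.congr_deriv ?_
  have i1 : Integrable (fun x => -ν * covFormNormSq (vorticity o (u t)) x
      - ν * formInner (formAct (vorticity o (u t)) ricci) (vorticity o (u t)) x)
      (riemVolume M) := (iq.const_mul _).sub (ir.const_mul _)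
  rw [integral_const_mul, integral_add i1 is, integral_sub (iq.const_mul _) (ir.const_mul _),
    integral_const_mul, integral_const_mul]

end Energy

end

end VorticityEnergy

theorem mainTheorem9
    {M : Type*} [EMetricSpace M] [CompleteSpace M] [SecondCountableTopology M]
    [ChartedSpace E3 M] [IsManifold (𝓡 3) ∞ M]
    [RiemannianBundle (fun x : M => TangentSpace (𝓡 3) x)]
    [IsContMDiffRiemannianBundle (𝓡 3) ∞ E3 (fun x : M => TangentSpace (𝓡 3) x)]
    [IsRiemannianManifold (𝓡 3) M]
    [MeasurableSpace M] [BorelSpace M]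
    (o : TangentOrientation M) (ho : IsOrientation o)
    (ν : ℝ) (hν : 0 < ν)
    (J : Set ℝ) (hJ : J.OrdConnected) (hJ' : J.Nontrivial)
    (u : ℝ → VField M) (p : ℝ → M → ℝ)
    (hsol : IsSmoothSolution o ν J u p)
    (hint : IntegrableAtInfinity o J u) :
    ∀ t ∈ J,
      Integrable (fun x => ‖vorticity o (u t) x‖ ^ 2) (riemVolume M) ∧
      Integrable (covFormNormSq (vorticity o (u t))) (riemVolume M) ∧
      Integrable (formInner (formAct (vorticity o (u t)) ricci) (vorticity o (u t))) (riemVolume M) ∧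
      Integrable (formInner (formAct (vorticity o (u t)) (strain (u t))) (vorticity o (u t))) (riemVolume M) ∧
      ∃ D : ℝ, HasDerivWithinAt (fun s => ∫ x, ‖vorticity o (u s) x‖ ^ 2 ∂(riemVolume M)) D J t ∧
        (1 / 2) * D + ν * ∫ x, covFormNormSq (vorticity o (u t)) x ∂(riemVolume M)
          = -ν * ∫ x, formInner (formAct (vorticity o (u t)) ricci) (vorticity o (u t)) x ∂(riemVolume M)
            + ∫ x, formInner (formAct (vorticity o (u t)) (strain (u t))) (vorticity o (u t)) x ∂(riemVolume M) := by
  intro t ht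
  obtain ⟨ie, iq, ir, is, hd⟩ := energy_identity ho hν.le
    (convex_of_ordConnected_nontrivial hJ hJ') hsol hint ht
  refine ⟨ie, iq, ir, is, _, hd, ?_⟩
  ring
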